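/- **Proposition (Strichartz and Kato smoothing estimates).** For $u:\mathbb Z\to\mathbb C$, $a\in\mathbb R$ and $1\le p\le\infty$ put $\|u\|_{l^p_a}:=\|e^{a|\cdot|}u\|_{l^p(\mathbb Z)}$ and $l^p:=l^p_0$. Let $(\Delta_{\mathrm d}u)(x)=u(x+1)-2u(x)+u(x-1)$ be the discrete Laplacian, let $(P_0^\perp u)(x)=u(x)$ for $x\neq 0$ and $(P_0^\perp u)(0)=0$, and let $$\Delta_0:=P_0^\perp\Delta_{\mathrm d}:P_0^\perp l^2(\mathbb Z)\to P_0^\perp l^2(\mathbb Z),\qquad P_0^\perp l^2(\mathbb Z)=\{u\in l^2(\mathbb Z)\mid u(0)=0\},$$ a bounded operator, with $e^{\mathrm it\Delta_0}$ its operator exponential. For an interval $I\subset\mathbb R$ put $$\mathrm{Stz}(I):=L^\infty(I,l^2)\cap L^6(I,l^\infty),\qquad \mathrm{Stz}^*(I):=L^1(I,l^2)+L^{6/5}(I,l^1),$$ where an intersection carries the maximum of the two norms, and a sum $X+Y$ the infimum of $\|g\|_X+\|h\|_Y$ over all $f=g+h$ with $g\in X$, $h\in Y$. There is a constant $C<\infty$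 such that for every interval $I\subset\mathbb R$ with $0\in I$ the following hold. 1. For every $u_0\in l^2(\mathbb Z)$, $$\|e^{\mathrm it\Delta_0}P_0^\perp u_0\|_{\mathrm{Stz}(I)\cap L^2(I,l^2_{-1})}\le C\|u_0\|_{l^2}.$$ 2. For every $f\in \mathrm{Stz}^*(I)+L^2(I,l^2_1)$ and every $t\in I$ the integral $\int_0^t e^{\mathrm i(t-s)\Delta_0}P_0^\perp f(s)\,ds$ converges absolutely in $l^2$, and $$\Big\|\int_0^{\cdot}e^{\mathrm i(\cdot-s)\Delta_0}P_0^\perp f(s)\,ds\Big\|_{\mathrm{Stz}(I)}\le C\|f\|_{\mathrm{Stz}^*(I)+L^2(I,l^2_1)}.$$ 3. For every $f\in L^2(I,l^2_1)$ (for which the integral also converges absolutely in $l^2$, for every $t\in I$), $$\Big\|\int_0^{\cdot}e^{\mathrm i(\cdot-s)\Delta_0}P_0^\perp f(s)\,ds\Big\|_{L^2(I,l^2_{-1})}\le C\|f\|_{L^2(I,l^2_1)}.$$ -/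

import Mathlib

open MeasureTheory
open scoped ENNReal NNReal

noncomputable section

namespace DiscreteNLS

/-! ### The operators -/

/-- The complex Hilbert space `l²(ℤ)`. -/
abbrev L2Z : Type := lp (fun _ : ℤ => ℂ) 2

/-- Evaluation `u ↦ u(x)` on `l²(ℤ)`. -/
def evalAt (x : ℤ) : L2Z →L[ℂ] ℂ :=
  LinearMap.mkContinuous
    { toFun := fun u => u x
      map_add' := fun _ _ => rfl
      map_smul' := fun _ _ => rfl } 1
    (fun u => (lp.norm_apply_le_norm (by norm_num) u x).trans_eq (one_mul _).symm)

theorem memlp_translate (k : ℤ) (u : L2Z) : Memℓp (fun x : ℤ => u (x + k)) 2 := by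
  have hp : 0 < (2 : ℝ≥0∞).toReal := by norm_num
  have h := (memℓp_gen_iff hp).1 (lp.memℓp u)
  exact (memℓp_gen_iff hp).2 ((Equiv.addRight k).summable_iff.2 h)

/-- The translation `u ↦ u(· + k)` on `l²(ℤ)`. -/
def translate (k : ℤ) : L2Z →L[ℂ] L2Z :=
  LinearMap.mkContinuous
    { toFun := fun u => ⟨fun x => u (x + k), memlp_translate k u⟩
      map_add' := fun _ _ => rfl
      map_smul' := fun _ _ => rfl } 1
    (fun u => by
      have hp : 0 < (2 : ℝ≥0∞).toReal := by norm_num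
      rw [one_mul, lp.norm_eq_tsum_rpow hp, lp.norm_eq_tsum_rpow hp]
      exact le_of_eq (congrArg (fun r : ℝ => r ^ (1 / (2 : ℝ≥0∞).toReal))
        ((Equiv.addRight k).tsum_eq (fun x => ‖u x‖ ^ (2 : ℝ≥0∞).toReal))))

/-- The discrete Laplacian `(Δ_d u)(x) = u(x+1) - 2 u(x) + u(x-1)` on `l²(ℤ)`. -/
def discreteLaplacian : L2Z →L[ℂ] L2Z :=
  translate 1 - (2 : ℂ) • ContinuousLinearMap.id ℂ L2Z + translate (-1)

/-- The subspace `{u ∈ l²(ℤ) | u(0) = 0}` of `l²(ℤ)`. -/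
def perpSubmodule : Submodule ℂ L2Z := (evalAt 0).ker

/-- The Hilbert space `P₀^⊥ l²(ℤ) = {u ∈ l²(ℤ) | u(0) = 0}`, with the norm of `l²(ℤ)`. -/
def L2Perp : Type := perpSubmodule

instance : NormedAddCommGroup L2Perp := inferInstanceAs (NormedAddCommGroup perpSubmodule)

instance : NormedSpace ℂ L2Perp := inferInstanceAs (NormedSpace ℂ perpSubmodule)

instance : CompleteSpace L2Perp :=
  inferInstanceAs (CompleteSpace (evalAt 0).ker)

/-- The inclusion of `{u ∈ l²(ℤ) | u(0) = 0}` in `l²(ℤ)`. -/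
def inclPerp : L2Perp →L[ℂ] L2Z := perpSubmodule.subtypeL

/-- The projection `P₀^⊥ : l²(ℤ) → {u | u(0) = 0}`, `P₀^⊥ u = u - u(0) δ₀`. -/
def projPerp : L2Z →L[ℂ] L2Perp :=
  (ContinuousLinearMap.id ℂ L2Z -
    (lp.singleContinuousLinearMap ℂ (fun _ : ℤ => ℂ) 2 0).comp (evalAt 0)).codRestrict
    perpSubmodule
    (fun u => by
      have h : evalAt 0 (lp.single 2 (0 : ℤ) (evalAt 0 u)) = evalAt 0 u :=
        lp.single_apply_self (E := fun _ : ℤ => ℂ) 2 0 (evalAt 0 u)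
      simp [perpSubmodule, h])

/-- `Δ₀ = P₀^⊥ Δ_d`, acting on `{u ∈ l²(ℤ) | u(0) = 0}`. -/
def laplacianZero : L2Perp →L[ℂ] L2Perp :=
  projPerp.comp (discreteLaplacian.comp inclPerp)

/-- The unitary group `e^{itΔ₀}` (exponential of a bounded operator). -/
def propagator (t : ℝ) : L2Perp →L[ℂ] L2Perp :=
  NormedSpace.exp ((Complex.I * (t : ℂ)) • laplacianZero)

open scoped Classical in
/-- A square summable sequence seen as an element of `l²(ℤ)`; other sequences are sent to `0`. -/
def toL2 (u : ℤ → ℂ) : L2Z := if h : Memℓp u 2 then ⟨u, h⟩ else 0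

/-- `e^{itΔ₀} P₀^⊥ u` as an element of `l²(ℤ)`, for a square summable sequence `u`. -/
def evolve (t : ℝ) (u : ℤ → ℂ) : L2Z := inclPerp (propagator t (projPerp (toL2 u)))

/-- `∫₀ᵗ e^{i(t-s)Δ₀} P₀^⊥ f(s) ds`, a Bochner integral in `l²(ℤ)`. -/
def duhamel (f : ℝ → ℤ → ℂ) (t : ℝ) : L2Z := ∫ s in (0 : ℝ)..t, evolve (t - s) (f s)

/-! ### The norms

All norms take values in `[0, ∞]`; the norms on functions on `I × ℤ` are `∞` for functions that are
not measurable on `I`, so that a finite norm includes measurability. -/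

/-- `‖u‖_{l^p_a} = ‖e^{a|·|} u‖_{l^p}`. -/
def seqNorm (p : ℝ≥0∞) (a : ℝ) (u : ℤ → ℂ) : ℝ≥0∞ :=
  eLpNorm (fun x : ℤ => (Real.exp (a * |(x : ℝ)|) : ℂ) * u x) p Measure.count

open scoped Classical in
/-- The norm of `L^q(I, l^p_a)`; it is `∞` for functions that are not measurable on `I`. -/
def mixedNorm (I : Set ℝ) (q p : ℝ≥0∞) (a : ℝ) (u : ℝ → ℤ → ℂ) : ℝ≥0∞ :=
  if ∀ x : ℤ, AEStronglyMeasurable (fun t => u t x) (volume.restrict I) then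
    eLpNorm (fun t => seqNorm p a (u t)) q (volume.restrict I)
  else ∞

/-- The norm of a sum `X + Y` of two spaces of functions on `I × ℤ`: the infimum of
`‖g‖_X + ‖h‖_Y` over all decompositions `f = g + h` (almost everywhere on `I`). -/
def sumNorm (I : Set ℝ) (normX normY : (ℝ → ℤ → ℂ) → ℝ≥0∞) (f : ℝ → ℤ → ℂ) : ℝ≥0∞ :=
  ⨅ (g : ℝ → ℤ → ℂ) (h : ℝ → ℤ → ℂ) (_ : ∀ᵐ t ∂(volume.restrict I), f t = g t + h t),
    normX g + normY h

/-- The norm of `Stz(I) = L^∞(I, l²) ∩ L⁶(I, l^∞)`. -/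
def stzNorm (I : Set ℝ) (u : ℝ → ℤ → ℂ) : ℝ≥0∞ :=
  max (mixedNorm I ∞ 2 0 u) (mixedNorm I 6 ∞ 0 u)

/-- The norm of `Stz*(I) = L¹(I, l²) + L^{6/5}(I, l¹)`. -/
def stzDualNorm (I : Set ℝ) : (ℝ → ℤ → ℂ) → ℝ≥0∞ :=
  sumNorm I (mixedNorm I 1 2 0) (mixedNorm I (6 / 5) 1 0)

end DiscreteNLS

end

/-! The condition at the origin cuts `ℤ` into two half-lines with Dirichlet condition, on which `Δ₀`
is diagonalised by the functions `sin(xθ)` with eigenvalue `2 cos θ - 2`. The kernel of the group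
therefore vanishes when `x` and `y` lie on opposite sides; otherwise the method of images gives it
as `e^{-2it} (J(x-y) - J(x+y)) / π`, where `J(n) = ∫₀^π e^{2it cos θ} cos(nθ) dθ`. Two bounds on
this kernel carry everything.

Dispersion: the phase `λ cos θ + nθ` has a nonvanishing third derivative where the second one
vanishes, so van der Corput's test gives `|t|^{-1/3}` uniformly in `x` and `y`
(`norm_flow_unitVec_apply_le`). Local decay: the image term produces a cancellation. The Bessel
recurrence bounds `J(m-1) - J(m+1)` by `|m| / |t|` times `J(m)`, and telescoping from `x-y` to `x+y`
yields `|t|^{-4/3}`, integrable at infinity, at the price of a polynomial in `x` and `y` that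
exponential weights absorb (`norm_flow_unitVec_apply_le_exp`).

The homogeneous estimates follow by `TT*` (`lpNorm_inner_le`): the Hardy-Littlewood-Sobolev
inequality with kernel `|t|^{-1/3}` maps `L^{6/5}` to `L⁶` and gives Strichartz, while Young's
inequality with an integrable kernel gives Kato smoothing. For the Duhamel term, the energy bounds
are the dual homogeneous estimates. The `L⁶ l^∞` bounds come from Minkowski for `L¹ l²` forcing,
from dispersion and Hardy-Littlewood-Sobolev for `L^{6/5} l¹` forcing, and from the Christ-Kiselev
lemma (`lpNorm_causal_le`, available because `2 < 6`) for `L² l²₁` forcing. The `L² → L²` Kato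
estimate is out of reach of Christ-Kiselev but follows from the kernel bound and Young, since
absolute values may be taken inside the time integral.

All this is done on the whole line; an interval is reached by extending the forcing by zero, which
keeps the constants independent of it. -/

noncomputable section

namespace DiscreteNLS

/-! ### Oscillatory integrals -/

/-- Van der Corput's second derivative test. -/
theorem norm_integral_exp_le_of_le_deriv2 {a b μ : ℝ} (hab : a ≤ b) (hμ : 0 < μ)
    {φ φ' φ'' : ℝ → ℝ} (h1 : ∀ x, HasDerivAt φ (φ' x) x) (h2 : ∀ x, HasDerivAt φ' (φ'' x) x)
    (hc : Continuous φ'') (hle : ∀ x ∈ Set.Icc a b, μ ≤ φ'' x) :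
    ‖∫ x in a..b, Complex.exp (φ x * Complex.I)‖ ≤ (1 + 2 * Real.pi) / √μ := by
  set ρ := √μ with hρ
  have hρ0 : 0 < ρ := Real.sqrt_pos.2 hμ
  have hρ2 : ρ ^ 2 = μ := Real.sq_sqrt hμ.le
  have c0 : Continuous φ := continuous_iff_continuousAt.2 fun x => (h1 x).continuousAt
  have c1 : Continuous φ' := continuous_iff_continuousAt.2 fun x => (h2 x).continuousAt
  have hD : ∀ x, 0 < φ' x ^ 2 + μ := fun x => by positivity
  -- Integration by parts would use `1 / φ'`; this regularisation is bounded by `1 / (2√μ)`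
  -- everywhere, so no neighbourhood of the critical point has to be cut out.
  set g : ℝ → ℝ := fun x => φ' x / (φ' x ^ 2 + μ) with hg
  set g' : ℝ → ℝ := fun x => φ'' x * (μ - φ' x ^ 2) / (φ' x ^ 2 + μ) ^ 2 with hg'
  have hgd : ∀ x, HasDerivAt g (g' x) x := fun x => by
    have := (h2 x).div (((h2 x).pow 2).add_const μ) (hD x).ne'
    refine this.congr_deriv ?_
    simp only [hg']
    congr 1
    simp
    ring
  have hgb : ∀ x, |g x| ≤ 1 / (2 * ρ) := fun x => by
    simp only [hg]
    rw [abs_div, abs_of_pos (hD x), div_le_div_iff₀ (hD x) (by positivity)]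
    nlinarith [sq_nonneg (|φ' x| - ρ), sq_abs (φ' x)]
  set e : ℝ → ℂ := fun x => Complex.exp (φ x * Complex.I) with he
  have hen : ∀ x, ‖e x‖ = 1 := fun x => Complex.norm_exp_ofReal_mul_I _
  have hed : ∀ x, HasDerivAt e (e x * (φ' x * Complex.I)) x := fun x =>
    ((h1 x).ofReal_comp.mul_const Complex.I).cexp
  have hGd : ∀ x, HasDerivAt (fun x => e x * (g x : ℂ))
      (e x * (φ' x * Complex.I) * g x + e x * (g' x : ℝ)) x := fun x =>
    (hed x).mul (hgd x).ofReal_comp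
  have ce : Continuous e := by fun_prop
  have cg' : Continuous g' := by
    refine Continuous.div (by fun_prop) (by fun_prop) fun x => (pow_pos (hD x) 2).ne'
  have cg : Continuous g := continuous_iff_continuousAt.2 fun x => (hgd x).continuousAt
  have hG := intervalIntegral.integral_eq_sub_of_hasDerivAt (a := a) (b := b)
    (fun x _ => hGd x) (Continuous.intervalIntegrable (by fun_prop) _ _)
  set r : ℝ → ℂ := fun x => e x * ((μ / (φ' x ^ 2 + μ) : ℝ) + Complex.I * (g' x : ℝ)) with hr
  have cm : Continuous fun x => μ / (φ' x ^ 2 + μ) :=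
    Continuous.div (by fun_prop) (by fun_prop) fun x => (hD x).ne'
  have cr : Continuous r := by fun_prop
  have hsplit : ∀ x, e x = -Complex.I * (e x * (φ' x * Complex.I) * g x + e x * (g' x : ℝ)) + r x := by
    intro x
    have : (φ' x : ℂ) * g x = 1 - (μ / (φ' x ^ 2 + μ) : ℝ) := by
      rw [← Complex.ofReal_mul, ← Complex.ofReal_one, ← Complex.ofReal_sub]
      congr 1
      simp only [hg]
      field_simp [(hD x).ne']
      ring
    simp only [hr]
    linear_combination (-(e x)) * this + (e x * (φ' x : ℂ) * g x) * Complex.I_sq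
  have hint : ∫ x in a..b, e x
      = -Complex.I * (e b * g b - e a * g a) + ∫ x in a..b, r x := by
    rw [← hG, ← intervalIntegral.integral_const_mul, ← intervalIntegral.integral_add]
    · exact intervalIntegral.integral_congr fun x _ => hsplit x
    · exact Continuous.intervalIntegrable (by fun_prop) _ _
    · exact cr.intervalIntegrable _ _
  -- Both parts of the remainder `r` are at most `φ'' / (φ'² + μ)`, the first because `μ ≤ φ''`.
  -- Twice this is an exact derivative, and the range of the arctangent has length `π`.
  have hq : ∀ x, HasDerivAt (fun x => 2 / ρ * Real.arctan (φ' x / ρ))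
      (2 * (φ'' x / (φ' x ^ 2 + μ))) x := fun x => by
    refine (((h2 x).div_const ρ).arctan.const_mul (2 / ρ)).congr_deriv ?_
    rw [← hρ2]
    field_simp
    ring
  have cq : Continuous fun x => 2 * (φ'' x / (φ' x ^ 2 + μ)) :=
    continuous_const.mul (hc.div (by fun_prop) fun x => (hD x).ne')
  have hrb : ∀ x ∈ Set.Icc a b, ‖r x‖ ≤ 2 * (φ'' x / (φ' x ^ 2 + μ)) := fun x hx => by
    have hx' := hle x hx
    rw [hr, norm_mul, hen, one_mul]
    refine (norm_add_le _ _).trans ?_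
    rw [norm_mul, Complex.norm_I, one_mul, Complex.norm_real, Complex.norm_real, two_mul]
    refine add_le_add ?_ ?_
    · rw [Real.norm_of_nonneg (div_nonneg hμ.le (hD x).le)]
      exact div_le_div_of_nonneg_right hx' (hD x).le
    · rw [Real.norm_eq_abs, hg']
      simp only
      rw [abs_div, abs_mul, abs_of_pos (hμ.trans_le hx'), abs_of_pos (pow_pos (hD x) 2), sq (_ + _),
        ← div_div]
      refine div_le_div_of_nonneg_right ?_ (hD x).le
      rw [div_le_iff₀ (hD x)]
      refine mul_le_mul_of_nonneg_left ?_ (hμ.trans_le hx').le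
      rw [abs_le]; constructor <;> nlinarith [sq_nonneg (φ' x)]
  have hR : ‖∫ x in a..b, r x‖ ≤ 2 * Real.pi / ρ := by
    refine (intervalIntegral.norm_integral_le_of_norm_le hab
      (Filter.Eventually.of_forall fun x hx => hrb x ⟨hx.1.le, hx.2⟩)
      (cq.intervalIntegrable a b)).trans ?_
    rw [intervalIntegral.integral_eq_sub_of_hasDerivAt (fun x _ => hq x)
      (cq.intervalIntegrable a b), ← mul_sub]
    have := Real.arctan_lt_pi_div_two (φ' b / ρ)
    have := Real.neg_pi_div_two_lt_arctan (φ' a / ρ)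
    calc _ ≤ 2 / ρ * Real.pi := by gcongr; linarith
      _ = _ := by ring
  have hB : ‖-Complex.I * (e b * g b - e a * g a)‖ ≤ 1 / ρ := by
    rw [norm_mul, norm_neg, Complex.norm_I, one_mul]
    refine (norm_sub_le _ _).trans ?_
    rw [norm_mul, norm_mul, hen, hen, one_mul, one_mul, Complex.norm_real, Complex.norm_real]
    refine (add_le_add (hgb b) (hgb a)).trans (le_of_eq ?_)
    field_simp
    norm_num
  rw [hint]
  refine (norm_add_le _ _).trans ((add_le_add hB hR).trans (le_of_eq ?_))
  ring

theorem intervalIntegral_conj (a b : ℝ) (f : ℝ → ℂ) :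
    ∫ x in a..b, (starRingEnd ℂ) (f x) = (starRingEnd ℂ) (∫ x in a..b, f x) := by
  simp only [intervalIntegral, integral_conj, map_sub]

theorem norm_integral_exp_neg (a b : ℝ) (φ : ℝ → ℝ) :
    ‖∫ x in a..b, Complex.exp ((-φ x : ℝ) * Complex.I)‖
      = ‖∫ x in a..b, Complex.exp (φ x * Complex.I)‖ := by
  rw [← Complex.norm_conj (∫ x in a..b, Complex.exp (φ x * Complex.I)),
    ← intervalIntegral_conj]
  congr 1
  refine intervalIntegral.integral_congr fun x _ => ?_
  simp [← Complex.exp_conj]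

/-- The linear term `n x` does not enter the second derivative `-l cos x`, hence the uniformity in
`n`. A window of half-width `d = l^{-1/3}` around the degenerate point `π/2` is estimated by its
length, and the second derivative test applies on either side. -/
theorem norm_integral_exp_cos_add_le {l : ℝ} (hl : 0 < l) (n : ℝ) :
    ‖∫ x in (0 : ℝ)..Real.pi, Complex.exp ((l * Real.cos x + n * x : ℝ) * Complex.I)‖
      ≤ 34 * l ^ (-(1 / 3) : ℝ) := by
  have hpi := Real.pi_gt_three
  have hpi' := Real.pi_lt_d2
  set d : ℝ := l ^ (-(1 / 3) : ℝ) with hd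
  have hd0 : 0 < d := Real.rpow_pos_of_pos hl _
  have hd3 : d ^ 3 * l = 1 := by
    rw [hd, ← Real.rpow_natCast, ← Real.rpow_mul hl.le]
    norm_num
    rw [Real.rpow_neg_one]
    exact inv_mul_cancel₀ hl.ne'
  set φ : ℝ → ℝ := fun x => l * Real.cos x + n * x with hφ
  have hn : ∀ x, ‖Complex.exp (φ x * Complex.I)‖ ≤ 1 := fun x =>
    (Complex.norm_exp_ofReal_mul_I _).le
  have hint : ∀ a b, IntervalIntegrable (fun x => Complex.exp (φ x * Complex.I)) volume a b :=
    fun a b => Continuous.intervalIntegrable (by fun_prop) _ _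
  -- If `d > 1` the window may not fit into `[0, π]`, but then the trivial bound `π` suffices.
  rcases lt_or_ge 1 d with h1 | h1
  · have := intervalIntegral.norm_integral_le_of_norm_le_const (a := 0) (b := Real.pi)
      (fun x _ => hn x)
    rw [sub_zero, abs_of_pos Real.pi_pos] at this
    linarith
  -- Outside the window `|cos x| ≥ sin d ≥ 2d/π`, by Jordan's inequality.
  set m : ℝ := l * (2 / Real.pi * d) with hm
  have hm0 : 0 < m := by positivity
  have hs : 2 / Real.pi * d ≤ Real.sin d := Real.mul_le_sin hd0.le (by linarith)
  have d1 : ∀ x, HasDerivAt φ (-(l * Real.sin x) + n) x := fun x => by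
    refine (((Real.hasDerivAt_cos x).const_mul l).add ((hasDerivAt_id x).const_mul n)).congr_deriv ?_
    ring
  have d2 : ∀ x, HasDerivAt (fun x => -(l * Real.sin x) + n) (-(l * Real.cos x)) x := fun x =>
    (((Real.hasDerivAt_sin x).const_mul l).neg).add_const n
  have A1 : ‖∫ x in (0 : ℝ)..(Real.pi / 2 - d), Complex.exp (φ x * Complex.I)‖
      ≤ (1 + 2 * Real.pi) / √m := by
    rw [← norm_integral_exp_neg]
    refine norm_integral_exp_le_of_le_deriv2 (by linarith) hm0 (fun x => (d1 x).neg)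
      (fun x => (d2 x).neg) (by fun_prop) fun x hx => ?_
    rw [neg_neg]
    refine mul_le_mul_of_nonneg_left (hs.trans ?_) hl.le
    rw [← Real.cos_pi_div_two_sub]
    exact Real.cos_le_cos_of_nonneg_of_le_pi hx.1 (by linarith) hx.2
  have A3 : ‖∫ x in (Real.pi / 2 + d)..Real.pi, Complex.exp (φ x * Complex.I)‖
      ≤ (1 + 2 * Real.pi) / √m := by
    refine norm_integral_exp_le_of_le_deriv2 (by linarith) hm0 d1 d2 (by fun_prop) fun x hx => ?_
    rw [← mul_neg]
    refine mul_le_mul_of_nonneg_left (hs.trans ?_) hl.le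
    have : Real.sin d = -Real.cos (Real.pi / 2 + d) := by
      rw [add_comm, Real.cos_add_pi_div_two, neg_neg]
    rw [this]
    exact neg_le_neg (Real.cos_le_cos_of_nonneg_of_le_pi (by linarith) hx.2 hx.1)
  have A2 : ‖∫ x in (Real.pi / 2 - d)..(Real.pi / 2 + d), Complex.exp (φ x * Complex.I)‖
      ≤ 2 * d := by
    refine (intervalIntegral.norm_integral_le_of_norm_le_const (fun x _ => hn x)).trans ?_
    rw [one_mul, abs_of_nonneg] <;> linarith
  have hsq : 1 / √m ≤ 2 * d := by
    rw [div_le_iff₀ (Real.sqrt_pos.2 hm0)]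
    have : 1 / (2 * d) ≤ √m := by
      apply Real.le_sqrt_of_sq_le
      rw [hm, div_pow, div_le_iff₀ (by positivity)]
      have : l * (2 / Real.pi * d) * (2 * d) ^ 2 = 8 / Real.pi * (d ^ 3 * l) := by ring
      rw [this, hd3, mul_one, le_div_iff₀ Real.pi_pos]
      linarith
    rw [div_le_iff₀ (by positivity)] at this
    linarith
  -- Each outer piece costs `16 d` and the window `2 d`, which adds up to `34 d`.
  have A : (1 + 2 * Real.pi) / √m ≤ 8 * (2 * d) := by
    rw [div_eq_mul_one_div]
    exact mul_le_mul (by linarith) hsq (by positivity) (by norm_num)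
  rw [← intervalIntegral.integral_add_adjacent_intervals (hint 0 (Real.pi / 2 - d)) (hint _ _),
    ← intervalIntegral.integral_add_adjacent_intervals
      (hint (Real.pi / 2 - d) (Real.pi / 2 + d)) (hint _ _)]
  refine (norm_add_le _ _).trans ?_
  have := norm_add_le (∫ x in (Real.pi / 2 - d)..(Real.pi / 2 + d), Complex.exp (φ x * Complex.I))
    (∫ x in (Real.pi / 2 + d)..Real.pi, Complex.exp (φ x * Complex.I))
  linarith

/-! ### Bessel integrals: decay and recurrence -/

/-- The Bessel-type integral `∫₀^π e^{iλ cos θ} cos(nθ) dθ`. -/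
def besselIntegral (l : ℝ) (n : ℤ) : ℂ :=
  ∫ x in (0 : ℝ)..Real.pi, Complex.exp ((l * Real.cos x : ℝ) * Complex.I) * Real.cos (n * x)

theorem norm_besselIntegral_neg (l : ℝ) (n : ℤ) :
    ‖besselIntegral (-l) n‖ = ‖besselIntegral l n‖ := by
  rw [besselIntegral, besselIntegral,
    ← Complex.norm_conj (∫ x in (0 : ℝ)..Real.pi,
      Complex.exp ((l * Real.cos x : ℝ) * Complex.I) * Real.cos (n * x)), ← intervalIntegral_conj]
  congr 1
  refine intervalIntegral.integral_congr fun x _ => ?_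
  simp only [map_mul, ← Complex.exp_conj, Complex.conj_ofReal, Complex.conj_I]
  congr 2
  push_cast
  ring

/-- The cosine is the mean of `e^{inx}` and `e^{-inx}`, so the bound for linear perturbations of the
cosine phase applies twice; conjugation reduces negative `l` to positive `l`. -/
theorem norm_besselIntegral_le {l : ℝ} (hl : l ≠ 0) (n : ℤ) :
    ‖besselIntegral l n‖ ≤ 34 * |l| ^ (-(1 / 3) : ℝ) := by
  wlog h : 0 < l generalizing l
  · rw [← norm_besselIntegral_neg, ← abs_neg]
    exact this (neg_ne_zero.2 hl) (by
      rcases lt_or_gt_of_ne hl with h' | h'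
      · linarith
      · exact absurd h' h)
  rw [abs_of_pos h]
  have e : besselIntegral l n
      = (1 / 2 : ℂ) * ((∫ x in (0 : ℝ)..Real.pi,
          Complex.exp ((l * Real.cos x + n * x : ℝ) * Complex.I))
        + ∫ x in (0 : ℝ)..Real.pi,
          Complex.exp ((l * Real.cos x + (-n : ℝ) * x : ℝ) * Complex.I)) := by
    rw [← intervalIntegral.integral_add, ← intervalIntegral.integral_const_mul]
    · refine intervalIntegral.integral_congr fun x _ => ?_
      simp only [Complex.ofReal_add, add_mul, Complex.exp_add, Complex.ofReal_cos (n * x),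
        Complex.cos]
      push_cast
      ring_nf
    · exact Continuous.intervalIntegrable (by fun_prop) _ _
    · exact Continuous.intervalIntegrable (by fun_prop) _ _
  rw [e, norm_mul]
  have h1 := norm_integral_exp_cos_add_le h n
  have h2 := norm_integral_exp_cos_add_le h (-n)
  have h3 := norm_add_le (∫ x in (0 : ℝ)..Real.pi,
          Complex.exp ((l * Real.cos x + n * x : ℝ) * Complex.I)) (∫ x in (0 : ℝ)..Real.pi,
          Complex.exp ((l * Real.cos x + (-n : ℝ) * x : ℝ) * Complex.I))
  norm_num
  norm_num at h1 h2 h3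
  linarith

/-- The function `e^{il cos x} sin(mx)` vanishes at `0` and at `π`, so its derivative has integral
zero; the product `sin x sin(mx)` in that derivative is half a difference of cosines. -/
theorem besselIntegral_recurrence (l : ℝ) (m : ℤ) :
    Complex.I * l * (besselIntegral l (m - 1) - besselIntegral l (m + 1))
      = 2 * m * besselIntegral l m := by
  have hd : ∀ x : ℝ, HasDerivAt (fun x : ℝ => Complex.exp ((l * Real.cos x : ℝ) * Complex.I)
        * (Real.sin (m * x) : ℝ))
      (Complex.exp ((l * Real.cos x : ℝ) * Complex.I) * ((-(l * Real.sin x) : ℝ) * Complex.I)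
        * (Real.sin (m * x) : ℝ)
       + Complex.exp ((l * Real.cos x : ℝ) * Complex.I) * ((m * Real.cos (m * x) : ℝ) : ℂ)) x := by
    intro x
    refine HasDerivAt.mul ?_ ?_
    · refine HasDerivAt.cexp (HasDerivAt.mul_const (HasDerivAt.ofReal_comp ?_) _)
      exact ((Real.hasDerivAt_cos x).const_mul l).congr_deriv (by ring)
    · refine HasDerivAt.ofReal_comp ?_
      exact (((hasDerivAt_id x).const_mul (m : ℝ)).sin).congr_deriv (by simp; ring)
  have h := intervalIntegral.integral_eq_sub_of_hasDerivAt (a := 0) (b := Real.pi)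
    (fun x _ => hd x) (Continuous.intervalIntegrable (by fun_prop) _ _)
  have hz : Real.sin (m * Real.pi) = 0 := Real.sin_int_mul_pi m
  rw [hz] at h
  simp only [mul_zero, Real.sin_zero, Complex.ofReal_zero, sub_self] at h
  have hs : Complex.I * l * (besselIntegral l (m - 1) - besselIntegral l (m + 1))
      - 2 * m * besselIntegral l m = -2 * ∫ x in (0 : ℝ)..Real.pi,
      (Complex.exp ((l * Real.cos x : ℝ) * Complex.I) * ((-(l * Real.sin x) : ℝ) * Complex.I)
        * (Real.sin (m * x) : ℝ)
       + Complex.exp ((l * Real.cos x : ℝ) * Complex.I) * ((m * Real.cos (m * x) : ℝ) : ℂ)) := by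
    rw [besselIntegral, besselIntegral, besselIntegral, ← intervalIntegral.integral_sub,
      ← intervalIntegral.integral_const_mul, ← intervalIntegral.integral_const_mul,
      ← intervalIntegral.integral_sub, ← intervalIntegral.integral_const_mul]
    · refine intervalIntegral.integral_congr fun x _ => ?_
      have hc : Real.cos ((m - 1 : ℤ) * x) - Real.cos ((m + 1 : ℤ) * x)
          = 2 * (Real.sin (m * x) * Real.sin x) := by
        push_cast
        rw [sub_mul, add_mul, one_mul, Real.cos_sub, Real.cos_add]
        ring
      have hc' := congrArg (fun r : ℝ => (r : ℂ)) hc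
      simp only [Complex.ofReal_sub, Complex.ofReal_mul, Complex.ofReal_ofNat] at hc'
      simp only [Complex.ofReal_neg, Complex.ofReal_mul, Complex.ofReal_intCast] at hc' ⊢
      linear_combination (Complex.I * l * Complex.exp (l * (Real.cos x : ℂ) * Complex.I)) * hc'
    all_goals exact Continuous.intervalIntegrable (by fun_prop) _ _
  rw [h, mul_zero] at hs
  exact sub_eq_zero.1 hs

/-- Dividing the recurrence by `l` gains a full power of decay over the uniform bound, at the cost
of a factor `|m|`; the constant is `2 · 34`. -/
theorem norm_besselIntegral_sub_le {l : ℝ} (hl : l ≠ 0) (m : ℤ) :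
    ‖besselIntegral l (m - 1) - besselIntegral l (m + 1)‖
      ≤ 68 * |(m : ℝ)| * |l| ^ (-(4 / 3) : ℝ) := by
  have h := congrArg norm (besselIntegral_recurrence l m)
  have hl' : 0 < |l| := abs_pos.2 hl
  rw [norm_mul, norm_mul, norm_mul, norm_mul, Complex.norm_I, one_mul, Complex.norm_real,
    Real.norm_eq_abs, Complex.norm_intCast, Complex.norm_ofNat] at h
  have h2 := norm_besselIntegral_le hl m
  have h3 : |l| ^ (-(4 / 3) : ℝ) = |l| ^ (-(1 / 3) : ℝ) * |l|⁻¹ := by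
    rw [← Real.rpow_neg_one, ← Real.rpow_add hl']
    norm_num
  rw [h3]
  rw [← mul_le_mul_iff_right₀ hl', h]
  calc 2 * |(m : ℝ)| * ‖besselIntegral l m‖
      ≤ 2 * |(m : ℝ)| * (34 * |l| ^ (-(1 / 3) : ℝ)) := by gcongr
    _ = _ := by field_simp; ring

/-! ### Spectral formula for the kernel of the group -/

/-- `e^{itΔ₀} P₀^⊥` as an operator on `l²(ℤ)`. -/
def flow (t : ℝ) : L2Z →L[ℂ] L2Z := inclPerp.comp ((propagator t).comp projPerp)

/-- The unit vector `δ_y` of `l²(ℤ)`. -/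
def unitVec (y : ℤ) : L2Z := lp.single 2 y (1 : ℂ)

theorem unitVec_apply (x y : ℤ) : unitVec y x = if x = y then 1 else 0 := by
  rw [unitVec, lp.single_apply, Pi.single_apply]

theorem norm_unitVec (y : ℤ) : ‖unitVec y‖ = 1 := by
  rw [unitVec, lp.norm_single (by norm_num), norm_one]

theorem inner_unitVec (x : ℤ) (u : L2Z) : inner ℂ (unitVec x) u = u x := by
  rw [unitVec, lp.inner_single_left]
  simp

theorem inclPerp_apply_zero (v : L2Perp) : inclPerp v 0 = 0 :=
  LinearMap.mem_ker.1 v.2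

theorem projPerp_inclPerp (v : L2Perp) : projPerp (inclPerp v) = v := by
  apply Subtype.ext
  change inclPerp v - lp.single 2 (0 : ℤ) (inclPerp v 0) = inclPerp v
  rw [inclPerp_apply_zero, lp.single_zero, sub_zero]

theorem inclPerp_projPerp_apply (u : L2Z) (x : ℤ) :
    inclPerp (projPerp u) x = if x = 0 then 0 else u x := by
  change (u - lp.single 2 (0 : ℤ) (u 0) : L2Z) x = _
  rw [lp.coeFn_sub, Pi.sub_apply, lp.single_apply]
  split_ifs with h
  · subst h; simp
  · simp [h]

theorem inclPerp_laplacianZero_apply (v : L2Perp) (x : ℤ) :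
    inclPerp (laplacianZero v) x = if x = 0 then 0 else
      inclPerp v (x + 1) - 2 * inclPerp v x + inclPerp v (x - 1) :=
  inclPerp_projPerp_apply _ x

/-- The spectral density of the kernel of `Δ₀`: `2 sin(xθ) sin(yθ)` if `x`, `y` lie on the same
side of the origin. -/
def sineWeight (x y : ℤ) (θ : ℝ) : ℝ :=
  if x * y < 0 then 0 else 2 * (Real.sin (x * θ) * Real.sin (y * θ))

theorem sineWeight_eq_cos_sub {x y : ℤ} (h : 0 ≤ x * y) (θ : ℝ) :
    sineWeight x y θ = Real.cos ((x - y : ℤ) * θ) - Real.cos ((x + y : ℤ) * θ) := by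
  rw [sineWeight, if_neg h.not_gt]
  push_cast
  rw [sub_mul, add_mul, Real.cos_sub, Real.cos_add]
  ring

theorem sineWeight_comm (x y : ℤ) (θ : ℝ) : sineWeight x y θ = sineWeight y x θ := by
  rw [sineWeight, sineWeight, mul_comm y x, mul_comm (Real.sin _)]

theorem sineWeight_zero_left (y : ℤ) (θ : ℝ) : sineWeight 0 y θ = 0 := by
  simp [sineWeight]

theorem sineWeight_zero_right (x : ℤ) (θ : ℝ) : sineWeight x 0 θ = 0 := by
  simp [sineWeight]

theorem abs_sineWeight_le (x y : ℤ) (θ : ℝ) : |sineWeight x y θ| ≤ 2 := by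
  rw [sineWeight]
  split_ifs
  · simp
  · rw [abs_mul, abs_mul, abs_two]
    have h1 := Real.abs_sin_le_one (x * θ)
    have h2 := Real.abs_sin_le_one (y * θ)
    nlinarith [abs_nonneg (Real.sin (x * θ)), abs_nonneg (Real.sin (y * θ))]

theorem continuous_sineWeight (x y : ℤ) : Continuous (sineWeight x y) := by
  unfold sineWeight
  split_ifs <;> fun_prop

/-- Away from the origin `sin(xθ)` is a generalised eigenfunction of the discrete Laplacian. The
cut-off at opposite signs does no harm, because the weight already vanishes at `x = 0`. -/
theorem sineWeight_recurrence {x : ℤ} (hx : x ≠ 0) (y : ℤ) (θ : ℝ) :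
    sineWeight (x + 1) y θ - 2 * sineWeight x y θ + sineWeight (x - 1) y θ
      = (2 * Real.cos θ - 2) * sineWeight x y θ := by
  rcases eq_or_ne y 0 with rfl | hy
  · simp [sineWeight_zero_right]
  have key : Real.sin ((x + 1 : ℤ) * θ) + Real.sin ((x - 1 : ℤ) * θ)
      = 2 * Real.cos θ * Real.sin (x * θ) := by
    push_cast
    rw [sub_mul, add_mul, one_mul, Real.sin_add, Real.sin_sub]
    ring
  rcases lt_or_ge (x * y) 0 with h | h
  · have h0 : sineWeight x y θ = 0 := if_pos h
    -- The neighbours of a site across the origin from `y` are across the origin too, or at the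
    -- origin itself.
    have aux : ∀ z : ℤ, z * y ≤ 0 → sineWeight z y θ = 0 := fun z hz => by
      rcases hz.lt_or_eq with h | h
      · exact if_pos h
      · rcases mul_eq_zero.1 h with rfl | h
        · exact sineWeight_zero_left _ _
        · exact absurd h hy
    rw [h0, aux, aux]
    · ring
    · rcases lt_or_gt_of_ne hx with h' | h'
      · have : 0 < y := pos_of_mul_neg_right h h'.le
        nlinarith
      · have : y < 0 := by nlinarith
        nlinarith
    · rcases lt_or_gt_of_ne hx with h' | h'
      · have : 0 < y := pos_of_mul_neg_right h h'.le
        nlinarith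
      · have : y < 0 := by nlinarith
        nlinarith
  · have aux : 0 ≤ (x + 1) * y ∧ 0 ≤ (x - 1) * y := by
      rcases lt_or_gt_of_ne hx with h' | h'
      · have : y ≤ 0 := by nlinarith
        constructor <;> nlinarith
      · have : 0 ≤ y := by nlinarith
        constructor <;> nlinarith
    rw [sineWeight, sineWeight, sineWeight, if_neg h.not_gt, if_neg aux.1.not_gt,
      if_neg aux.2.not_gt]
    linear_combination 2 * Real.sin (y * θ) * key

theorem integral_cos_int_mul (m : ℤ) :
    ∫ θ in (0 : ℝ)..Real.pi, Real.cos (m * θ) = if m = 0 then Real.pi else 0 := by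
  split_ifs with h
  · simp [h]
  · have hm : (m : ℝ) ≠ 0 := by exact_mod_cast h
    rw [intervalIntegral.integral_comp_mul_left (fun x => Real.cos x) hm, integral_cos,
      Real.sin_int_mul_pi]
    simp

theorem integral_sineWeight (x y : ℤ) : ∫ θ in (0 : ℝ)..Real.pi, sineWeight x y θ
    = if x = 0 then 0 else if x = y then Real.pi else 0 := by
  split_ifs with h0 h
  · simp [h0, sineWeight_zero_left]
  all_goals
    rcases lt_or_ge (x * y) 0 with hxy | hxy
    on_goal 2 =>
      simp_rw [sineWeight_eq_cos_sub hxy]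
      rw [intervalIntegral.integral_sub (Continuous.intervalIntegrable (by fun_prop) _ _)
        (Continuous.intervalIntegrable (by fun_prop) _ _), integral_cos_int_mul,
        integral_cos_int_mul]
  · subst h; nlinarith
  · rw [if_pos (sub_eq_zero.2 h), if_neg (by omega), sub_zero]
  · simp [sineWeight, hxy]
  · rw [if_neg (sub_ne_zero.2 h), if_neg, sub_zero]
    intro h'
    have : y = -x := by omega
    subst this
    have : 0 < x * x := mul_self_pos.2 h0
    nlinarith

/-- The case `n = 0` is the orthogonality of the sines, and each application of `Δ₀` inserts the
eigenvalue under the integral. Working with powers gives the functional calculus without a spectral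
theorem. -/
theorem inclPerp_laplacianZero_pow_apply (n : ℕ) (x y : ℤ) :
    inclPerp ((laplacianZero ^ n) (projPerp (unitVec y))) x
      = ((∫ θ in (0 : ℝ)..Real.pi, (2 * Real.cos θ - 2) ^ n * sineWeight x y θ : ℝ) : ℂ)
        / Real.pi := by
  induction n generalizing x with
  | zero =>
    simp only [pow_zero, one_mul]
    rw [integral_sineWeight]
    change inclPerp (projPerp (unitVec y)) x = _
    rw [inclPerp_projPerp_apply, unitVec_apply]
    split_ifs <;> simp
  | succ n ih =>
    have e : (laplacianZero ^ (n + 1)) (projPerp (unitVec y))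
        = laplacianZero ((laplacianZero ^ n) (projPerp (unitVec y))) := by
      rw [pow_succ']; rfl
    rw [e, inclPerp_laplacianZero_apply]
    split_ifs with h
    · simp [h, sineWeight_zero_left]
    · have hi : ∀ z : ℤ, IntervalIntegrable
          (fun θ => (2 * Real.cos θ - 2) ^ n * sineWeight z y θ) volume 0 Real.pi := fun z =>
        Continuous.intervalIntegrable (by have := continuous_sineWeight z y; fun_prop) _ _
      rw [ih, ih, ih]
      have : ∫ θ in (0 : ℝ)..Real.pi, (2 * Real.cos θ - 2) ^ (n + 1) * sineWeight x y θ
          = (∫ θ in (0 : ℝ)..Real.pi, (2 * Real.cos θ - 2) ^ n * sineWeight (x + 1) y θ)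
            - 2 * (∫ θ in (0 : ℝ)..Real.pi, (2 * Real.cos θ - 2) ^ n * sineWeight x y θ)
            + ∫ θ in (0 : ℝ)..Real.pi, (2 * Real.cos θ - 2) ^ n * sineWeight (x - 1) y θ := by
        rw [← intervalIntegral.integral_const_mul, ← intervalIntegral.integral_sub (hi _)
          ((hi _).const_mul 2), ← intervalIntegral.integral_add ((hi _).sub ((hi _).const_mul 2))
          (hi _)]
        refine intervalIntegral.integral_congr fun θ _ => ?_
        rw [pow_succ]
        linear_combination (-(2 * Real.cos θ - 2) ^ n) * sineWeight_recurrence h y θ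
      rw [this]
      push_cast
      ring

/-- The exponential series is summed under the integral; dominated convergence applies because `|2
cos θ - 2| ≤ 4`. -/
theorem flow_unitVec_apply (t : ℝ) (x y : ℤ) :
    flow t (unitVec y) x = (∫ θ in (0 : ℝ)..Real.pi,
      Complex.exp ((t * (2 * Real.cos θ - 2) : ℝ) * Complex.I) * sineWeight x y θ) / Real.pi := by
  have h1 := (NormedSpace.exp_series_hasSum_exp' (𝕂 := ℂ)
    ((Complex.I * (t : ℂ)) • laplacianZero)).mapL
    (((evalAt x).comp inclPerp).comp
      (ContinuousLinearMap.apply ℂ L2Perp (projPerp (unitVec y))))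
  have h2 : HasSum (fun n : ℕ => (∫ θ in (0 : ℝ)..Real.pi,
      (((n.factorial : ℂ)⁻¹ * ((t * (2 * Real.cos θ - 2) : ℝ) * Complex.I) ^ n)
        * sineWeight x y θ))) (∫ θ in (0 : ℝ)..Real.pi,
      Complex.exp ((t * (2 * Real.cos θ - 2) : ℝ) * Complex.I) * sineWeight x y θ) := by
    refine intervalIntegral.hasSum_integral_of_dominated_convergence
      (fun n _ => ((n.factorial : ℝ)⁻¹ * (|t| * 4) ^ n) * 2) (fun n => ?_) (fun n => ?_) ?_ ?_ ?_
    · refine Continuous.aestronglyMeasurable ?_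
      have := continuous_sineWeight x y
      fun_prop
    · refine Filter.Eventually.of_forall fun θ _ => ?_
      rw [norm_mul, norm_mul, norm_pow, norm_mul, Complex.norm_I, mul_one, norm_inv,
        Complex.norm_natCast, Complex.norm_real, Complex.norm_real, Real.norm_eq_abs,
        Real.norm_eq_abs, abs_mul]
      have h4 : |2 * Real.cos θ - 2| ≤ 4 := by
        rw [abs_le]
        constructor <;> linarith [Real.neg_one_le_cos θ, Real.cos_le_one θ]
      have := abs_sineWeight_le x y θ
      gcongr
    · refine Filter.Eventually.of_forall fun θ _ => ?_
      refine Summable.mul_right _ ?_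
      refine (Real.summable_pow_div_factorial (|t| * 4)).congr fun n => ?_
      rw [div_eq_inv_mul]
    · exact intervalIntegrable_const
    · refine Filter.Eventually.of_forall fun θ _ => ?_
      refine HasSum.mul_right _ ?_
      have := NormedSpace.exp_series_hasSum_exp' (𝕂 := ℂ)
        ((t * (2 * Real.cos θ - 2) : ℝ) * Complex.I)
      rw [← Complex.exp_eq_exp_ℂ] at this
      exact this
  refine HasSum.unique (f := fun n : ℕ => (∫ θ in (0 : ℝ)..Real.pi,
      (((n.factorial : ℂ)⁻¹ * ((t * (2 * Real.cos θ - 2) : ℝ) * Complex.I) ^ n)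
        * sineWeight x y θ)) / (Real.pi : ℂ)) ?_ (h2.div_const _)
  convert! h1 using 2 with n
  rw [smul_pow]
  change _ = ((n.factorial : ℂ)⁻¹ • (Complex.I * (t : ℂ)) ^ n • (inclPerp ((laplacianZero ^ n) (projPerp (unitVec y))) x))
  rw [inclPerp_laplacianZero_pow_apply, smul_eq_mul, smul_eq_mul, ← intervalIntegral.integral_ofReal,
    ← mul_div_assoc, ← mul_div_assoc, ← intervalIntegral.integral_const_mul,
    ← intervalIntegral.integral_const_mul]
  congr 1
  refine intervalIntegral.integral_congr fun θ _ => ?_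
  push_cast
  rw [mul_pow, mul_pow, mul_pow]
  ring

/-! ### Group law, adjoint and contraction property -/

theorem flow_flow (s t : ℝ) (u : L2Z) : flow s (flow t u) = flow (s + t) u := by
  let _ : NormedAlgebra ℚ (L2Perp →L[ℂ] L2Perp) := NormedAlgebra.restrictScalars ℚ ℂ _
  have : propagator (s + t) = propagator s * propagator t := by
    rw [propagator, propagator, propagator, ← NormedSpace.exp_add_of_commute, ← add_smul]
    · push_cast
      rw [mul_add]
    · exact ((Commute.refl laplacianZero).smul_left _).smul_right _
  simp only [flow, ContinuousLinearMap.comp_apply, projPerp_inclPerp, this]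
  rfl

theorem continuous_flow : Continuous flow := by
  let _ : NormedAlgebra ℚ (L2Perp →L[ℂ] L2Perp) := NormedAlgebra.restrictScalars ℚ ℂ _
  have : Continuous propagator := by
    unfold propagator
    exact NormedSpace.exp_continuous.comp (by fun_prop)
  unfold flow
  fun_prop

theorem conj_flow_unitVec_apply (t : ℝ) (x y : ℤ) :
    (starRingEnd ℂ) (flow t (unitVec x) y) = flow (-t) (unitVec y) x := by
  rw [flow_unitVec_apply, flow_unitVec_apply, map_div₀, Complex.conj_ofReal,
    ← intervalIntegral_conj]
  congr 1
  refine intervalIntegral.integral_congr fun θ _ => ?_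
  simp only [map_mul, ← Complex.exp_conj, Complex.conj_ofReal, Complex.conj_I, sineWeight_comm x y]
  congr 2
  push_cast
  ring

/-- Read off matrix entries: the spectral weight is real and symmetric in `x` and `y`, so
conjugating and transposing the kernel only reverses the sign of `t`. -/
theorem adjoint_flow (t : ℝ) : (flow t).adjoint = flow (-t) := by
  refine lp.ext_continuousLinearMap (by norm_num) fun y => ?_
  ext x
  simp only [ContinuousLinearMap.comp_apply, lp.singleContinuousLinearMap_apply]
  change (flow t).adjoint (unitVec y) x = flow (-t) (unitVec y) x
  rw [← inner_unitVec, ContinuousLinearMap.adjoint_inner_right, ← inner_conj_symm, inner_unitVec,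
    conj_flow_unitVec_apply]

theorem inner_flow_left (t : ℝ) (u w : L2Z) : inner ℂ (flow t u) w = inner ℂ u (flow (-t) w) := by
  rw [← adjoint_flow, ContinuousLinearMap.adjoint_inner_right]

/-- `flow 0` is the projection onto sequences vanishing at the origin: it is idempotent and
self-adjoint, hence a contraction. -/
theorem norm_flow_zero_le (u : L2Z) : ‖flow 0 u‖ ≤ ‖u‖ := by
  have h : ‖flow 0 u‖ * ‖flow 0 u‖ ≤ ‖u‖ * ‖flow 0 u‖ := by
    have h1 : inner ℂ (flow 0 u) (flow 0 u) = inner ℂ u (flow 0 u) := by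
      rw [inner_flow_left, flow_flow]
      simp
    have h2 := norm_inner_le_norm (𝕜 := ℂ) u (flow 0 u)
    rw [← h1, inner_self_eq_norm_sq_to_K] at h2
    simpa [sq] using h2
  rcases (norm_nonneg (flow 0 u)).eq_or_lt with h0 | h0
  · rw [← h0]; exact norm_nonneg u
  · exact le_of_mul_le_mul_right h h0

theorem norm_flow_le (t : ℝ) (u : L2Z) : ‖flow t u‖ ≤ ‖u‖ := by
  have h1 : inner ℂ (flow t u) (flow t u) = inner ℂ u (flow 0 u) := by
    rw [inner_flow_left, flow_flow]
    simp
  have h2 := norm_inner_le_norm (𝕜 := ℂ) u (flow 0 u)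
  rw [← h1, inner_self_eq_norm_sq_to_K] at h2
  have h3 : ‖flow t u‖ ^ 2 ≤ ‖u‖ * ‖flow 0 u‖ := by simpa using h2
  have h4 := mul_le_mul_of_nonneg_left (norm_flow_zero_le u) (norm_nonneg u)
  exact le_of_sq_le_sq (by nlinarith) (norm_nonneg u)

/-! ### Pointwise kernel bounds -/

/-- Method of images: `2 sin(xθ) sin(yθ)` is the difference of the cosines of `(x-y)θ` and `(x+y)θ`.
The phase in front comes from the `-2` in the eigenvalue. -/
theorem flow_unitVec_apply_of_nonneg {x y : ℤ} (h : 0 ≤ x * y) (t : ℝ) :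
    flow t (unitVec y) x = Complex.exp ((-2 * t : ℝ) * Complex.I) *
      (besselIntegral (2 * t) (x - y) - besselIntegral (2 * t) (x + y)) / Real.pi := by
  rw [flow_unitVec_apply, besselIntegral, besselIntegral, ← intervalIntegral.integral_sub,
    ← intervalIntegral.integral_const_mul]
  · congr 1
    refine intervalIntegral.integral_congr fun θ _ => ?_
    rw [sineWeight_eq_cos_sub h, Complex.ofReal_sub, ← mul_sub, ← mul_assoc, ← Complex.exp_add]
    congr 2
    push_cast
    ring
  all_goals exact Continuous.intervalIntegrable (by fun_prop) _ _

theorem flow_unitVec_apply_of_neg {x y : ℤ} (h : x * y < 0) (t : ℝ) :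
    flow t (unitVec y) x = 0 := by
  rw [flow_unitVec_apply]
  simp [sineWeight, h]

theorem norm_flow_unitVec_apply_le_one (t : ℝ) (x y : ℤ) : ‖flow t (unitVec y) x‖ ≤ 1 := by
  refine (lp.norm_apply_le_norm (by norm_num) _ x).trans ((norm_flow_le _ _).trans ?_)
  rw [norm_unitVec]

/-- The dispersive estimate. -/
theorem norm_flow_unitVec_apply_le {t : ℝ} (ht : t ≠ 0) (x y : ℤ) :
    ‖flow t (unitVec y) x‖ ≤ 34 * |t| ^ (-(1 / 3) : ℝ) := by
  rcases lt_or_ge (x * y) 0 with h | h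
  · rw [flow_unitVec_apply_of_neg h, norm_zero]
    positivity
  have h2t : 2 * t ≠ 0 := by simpa using ht
  rw [flow_unitVec_apply_of_nonneg h, norm_div, norm_mul, Complex.norm_exp_ofReal_mul_I, one_mul,
    Complex.norm_real, Real.norm_of_nonneg Real.pi_pos.le, div_le_iff₀ Real.pi_pos]
  have h1 := norm_sub_le (besselIntegral (2 * t) (x - y)) (besselIntegral (2 * t) (x + y))
  have h2 := norm_besselIntegral_le h2t (x - y)
  have h3 := norm_besselIntegral_le h2t (x + y)
  have h4 : |2 * t| ^ (-(1 / 3) : ℝ) ≤ |t| ^ (-(1 / 3) : ℝ) := by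
    refine Real.rpow_le_rpow_of_nonpos (abs_pos.2 ht) ?_ (by norm_num)
    rw [abs_mul, abs_two]
    linarith [abs_nonneg t]
  have h5 : 0 ≤ |t| ^ (-(1 / 3) : ℝ) := by positivity
  nlinarith [Real.pi_gt_three]

/-- The difference telescopes into `b` differences of step two, centred at indices of modulus at
most `|a| + b`. This is where the source and its image cancel. -/
theorem norm_besselIntegral_sub_add_le {l : ℝ} (hl : l ≠ 0) (b : ℕ) (a : ℤ) :
    ‖besselIntegral l (a - b) - besselIntegral l (a + b)‖
      ≤ 68 * (b * (|(a : ℝ)| + b)) * |l| ^ (-(4 / 3) : ℝ) := by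
  induction b generalizing a with
  | zero => simp
  | succ b ih =>
    have h1 := ih (a - 1)
    have h2 := norm_besselIntegral_sub_le hl (a + b)
    have e : besselIntegral l (a - (b + 1 : ℕ)) - besselIntegral l (a + (b + 1 : ℕ))
        = (besselIntegral l (a - 1 - b) - besselIntegral l (a - 1 + b))
          + (besselIntegral l (a + b - 1) - besselIntegral l (a + b + 1)) := by
      have e1 : a - (b + 1 : ℕ) = a - 1 - b := by push_cast; ring
      have e2 : a + (b + 1 : ℕ) = a + b + 1 := by push_cast; ring
      have e3 : a - 1 + b = a + b - 1 := by ring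
      rw [e1, e2, e3]
      ring
    rw [e]
    refine (norm_add_le _ _).trans ((add_le_add h1 h2).trans ?_)
    rw [← add_mul]
    refine mul_le_mul_of_nonneg_right ?_ (by positivity)
    push_cast
    have h3 : |(a : ℝ) - 1| ≤ |(a : ℝ)| + 1 := (abs_sub _ _).trans (by simp)
    have h4 : |(a : ℝ) + b| ≤ |(a : ℝ)| + b := (abs_add_le _ _).trans (by simp)
    have h5 := abs_nonneg (a : ℝ)
    have h6 : (0 : ℝ) ≤ b := by positivity
    nlinarith [mul_le_mul_of_nonneg_left h3 h6]

/-- The rate `1/2` is chosen so that `e^{r/2}` remains square summable against the weight `e^{-r}`.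
-/
theorem one_add_sq_le_exp {r : ℝ} (hr : 0 ≤ r) : (1 + r) ^ 2 ≤ 16 * Real.exp (r / 2) := by
  have h := Real.add_one_le_exp (r / 4)
  have e : Real.exp (r / 2) = Real.exp (r / 4) ^ 2 := by
    rw [sq, ← Real.exp_add]; congr 1; ring
  rw [e]
  nlinarith

/-- The local decay estimate: the kernel is integrable in time for fixed `x` and `y`. -/
theorem norm_flow_unitVec_apply_le_exp (t : ℝ) (x y : ℤ) :
    ‖flow t (unitVec y) x‖ ≤ 272 * 256 * (Real.exp (|(x : ℝ)| / 2) * Real.exp (|(y : ℝ)| / 2))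
      * (1 + |t|) ^ (-(4 / 3) : ℝ) := by
  have hx0 := abs_nonneg (x : ℝ)
  have hy0 := abs_nonneg (y : ℝ)
  have h2 : (1 : ℝ) / 4 ≤ 2 ^ (-(4 / 3) : ℝ) := by
    have : (1 : ℝ) / 4 = 2 ^ (-2 : ℝ) := by
      rw [Real.rpow_neg (by norm_num)]; norm_num
    rw [this]
    exact Real.rpow_le_rpow_of_exponent_le (by norm_num) (by norm_num)
  have hexp : 1 ≤ Real.exp (|(x : ℝ)| / 2) * Real.exp (|(y : ℝ)| / 2) := by
    rw [← Real.exp_add]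
    exact Real.one_le_exp (by positivity)
  rcases le_or_gt |t| 1 with ht | ht
  · have h3 : (2 : ℝ) ^ (-(4 / 3) : ℝ) ≤ (1 + |t|) ^ (-(4 / 3) : ℝ) :=
      Real.rpow_le_rpow_of_nonpos (by positivity) (by linarith) (by norm_num)
    have h4 := norm_flow_unitVec_apply_le_one t x y
    nlinarith
  · have ht0 : t ≠ 0 := abs_pos.1 (by linarith)
    -- For `|t| > 1` one has `1 + |t| ≤ 2|t|`, and `2^{4/3} ≤ 4`. This `4` times `68` is the
    -- constant `272`.
    have h3 : |t| ^ (-(4 / 3) : ℝ) ≤ 4 * (1 + |t|) ^ (-(4 / 3) : ℝ) := by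
      have : (2 * |t|) ^ (-(4 / 3) : ℝ) ≤ (1 + |t|) ^ (-(4 / 3) : ℝ) :=
        Real.rpow_le_rpow_of_nonpos (by positivity) (by linarith) (by norm_num)
      rw [Real.mul_rpow (by norm_num) (by positivity)] at this
      have h5 : 0 ≤ |t| ^ (-(4 / 3) : ℝ) := by positivity
      nlinarith
    -- The polynomial is at most `(1+|x|)² (1+|y|)²`, whence the constant `256 = 16²`.
    have hpoly : |(y : ℝ)| * (|(x : ℝ)| + |(y : ℝ)|)
        ≤ 256 * (Real.exp (|(x : ℝ)| / 2) * Real.exp (|(y : ℝ)| / 2)) := by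
      have h5 := one_add_sq_le_exp hx0
      have h6 := one_add_sq_le_exp hy0
      have h7 := mul_le_mul h5 h6 (by positivity) (by positivity)
      refine le_trans ?_ (h7.trans (le_of_eq (by ring)))
      have : |(y : ℝ)| * (|(x : ℝ)| + |(y : ℝ)|) ≤ (1 + |(x : ℝ)|) * (1 + |(y : ℝ)|) ^ 2 := by
        nlinarith [mul_nonneg hx0 hy0, mul_nonneg hx0 (mul_nonneg hy0 hy0)]
      refine this.trans (mul_le_mul_of_nonneg_right ?_ (by positivity))
      nlinarith
    have key : ‖flow t (unitVec y) x‖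
        ≤ 68 * (|(y : ℝ)| * (|(x : ℝ)| + |(y : ℝ)|)) * |t| ^ (-(4 / 3) : ℝ) := by
      rcases lt_or_ge (x * y) 0 with h | h
      · rw [flow_unitVec_apply_of_neg h, norm_zero]
        positivity
      have h2t : 2 * t ≠ 0 := by simpa using ht0
      have hb : ‖besselIntegral (2 * t) (x - y) - besselIntegral (2 * t) (x + y)‖
          ≤ 68 * (|(y : ℝ)| * (|(x : ℝ)| + |(y : ℝ)|)) * |2 * t| ^ (-(4 / 3) : ℝ) := by
        obtain ⟨b, rfl | rfl⟩ := Int.eq_nat_or_neg y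
        · simpa using norm_besselIntegral_sub_add_le h2t b x
        · rw [norm_sub_rev, sub_neg_eq_add, ← sub_eq_add_neg]
          simpa using norm_besselIntegral_sub_add_le h2t b x
      rw [flow_unitVec_apply_of_nonneg h, norm_div, norm_mul, Complex.norm_exp_ofReal_mul_I,
        one_mul, Complex.norm_real, Real.norm_of_nonneg Real.pi_pos.le]
      have h4 : |2 * t| ^ (-(4 / 3) : ℝ) ≤ |t| ^ (-(4 / 3) : ℝ) := by
        refine Real.rpow_le_rpow_of_nonpos (abs_pos.2 ht0) ?_ (by norm_num)
        rw [abs_mul, abs_two]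
        linarith [abs_nonneg t]
      refine (div_le_self (norm_nonneg _) (by linarith [Real.pi_gt_three])).trans (hb.trans ?_)
      gcongr
    refine key.trans ?_
    calc _ ≤ 68 * (256 * (Real.exp (|(x : ℝ)| / 2) * Real.exp (|(y : ℝ)| / 2)))
          * (4 * (1 + |t|) ^ (-(4 / 3) : ℝ)) := by gcongr
      _ = _ := by ring

/-! ### Duality, Minkowski's inequality and the `TT*` argument on the line -/

/-- The `L^p` norm of a nonnegative function on the line. -/
def lpNorm (p : ℝ) (A : ℝ → ℝ≥0∞) : ℝ≥0∞ := (∫⁻ t, A t ^ p) ^ (1 / p)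

theorem lpNorm_mono {p : ℝ} (hp : 0 < p) {A B : ℝ → ℝ≥0∞} (h : ∀ᵐ t, A t ≤ B t) :
    lpNorm p A ≤ lpNorm p B :=
  ENNReal.rpow_le_rpow (lintegral_mono_ae (h.mono fun _ ht => ENNReal.rpow_le_rpow ht hp.le))
    (by positivity)

theorem lpNorm_const_mul {p : ℝ} (hp : 0 < p) {c : ℝ≥0∞} (hc : c ≠ ∞) (A : ℝ → ℝ≥0∞) :
    lpNorm p (fun t => c * A t) = c * lpNorm p A := by
  simp_rw [lpNorm, ENNReal.mul_rpow_of_nonneg _ _ hp.le]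
  rw [lintegral_const_mul' _ _ (ENNReal.rpow_ne_top_of_nonneg hp.le hc),
    ENNReal.mul_rpow_of_nonneg _ _ (by positivity), ← ENNReal.rpow_mul, mul_one_div_cancel hp.ne',
    ENNReal.rpow_one]

theorem lpNorm_rpow {p : ℝ} (hp : 0 < p) (A : ℝ → ℝ≥0∞) :
    lpNorm p A ^ p = ∫⁻ t, A t ^ p := by
  rw [lpNorm, ← ENNReal.rpow_mul, one_div_mul_cancel hp.ne', ENNReal.rpow_one]

theorem lintegral_mul_le_lpNorm_mul {p q : ℝ} (hpq : p.HolderConjugate q) {A B : ℝ → ℝ≥0∞}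
    (hA : Measurable A) (hB : Measurable B) :
    ∫⁻ t, A t * B t ≤ lpNorm p A * lpNorm q B :=
  ENNReal.lintegral_mul_le_Lp_mul_Lq volume hpq hA.aemeasurable hB.aemeasurable

/-- Converse Hölder inequality: it is enough to test against bounded functions of bounded
support. -/
theorem lpNorm_le_of_forall_lintegral_mul_le {p q : ℝ} (hpq : p.HolderConjugate q)
    {A : ℝ → ℝ≥0∞} (hA : Measurable A) {C : ℝ≥0∞}
    (h : ∀ g : ℝ → ℝ≥0∞, Measurable g → (∃ M : ℝ≥0, ∀ t, g t ≤ M) →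
      (∃ R : ℝ, ∀ t, R < |t| → g t = 0) → ∫⁻ t, A t * g t ≤ C * lpNorm q g) :
    lpNorm p A ≤ C := by
  have hp := hpq.pos
  have hp1 := hpq.lt
  have hq := hpq.symm.pos
  -- Truncating in height and support makes `∫ B^p` finite, so that a power of it can be cancelled
  -- below; Fatou's lemma then removes the truncation.
  set B : ℕ → ℝ → ℝ≥0∞ := fun n => (Set.Icc (-n : ℝ) n).indicator fun t => min (A t) n with hB
  have hBm : ∀ n, Measurable (B n) := fun n =>
    (hA.min measurable_const).indicator measurableSet_Icc
  have hBle : ∀ n t, B n t ≤ n := fun n t => by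
    by_cases ht : t ∈ Set.Icc (-n : ℝ) n
    · simp [hB, ht]
    · simp [hB, ht]
  have hBA : ∀ n t, B n t ≤ A t := fun n t => by
    by_cases ht : t ∈ Set.Icc (-n : ℝ) n
    · simp [hB, ht]
    · simp [hB, ht]
  have hB0 : ∀ (n : ℕ) t, (n : ℝ) < |t| → B n t = 0 := fun n t ht => by
    refine Set.indicator_of_notMem (fun hm => ?_) _
    exact absurd (abs_le.2 hm) ht.not_ge
  have key : ∀ n, ∫⁻ t, B n t ^ p ≤ C ^ p := by
    intro n
    set X := ∫⁻ t, B n t ^ p with hX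
    have hXt : X ≠ ∞ := by
      have : X ≤ ∫⁻ t in Set.Icc (-n : ℝ) n, (n : ℝ≥0∞) ^ p := by
        rw [← lintegral_indicator measurableSet_Icc]
        refine lintegral_mono fun t => ?_
        by_cases ht : t ∈ Set.Icc (-n : ℝ) n
        · simp only [ht, Set.indicator_of_mem]
          exact ENNReal.rpow_le_rpow (hBle n t) hp.le
        · simp [hB, ht, hp]
      refine ne_top_of_le_ne_top ?_ this
      rw [setLIntegral_const]
      exact ENNReal.mul_ne_top (ENNReal.rpow_ne_top_of_nonneg hp.le (by simp)) (by simp)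
    have hg : lpNorm q (fun t => B n t ^ (p - 1)) = X ^ (1 / q) := by
      simp_rw [lpNorm, ← ENNReal.rpow_mul, hpq.sub_one_mul_conj]
      rfl
    -- The extremal test function for Hölder's inequality.
    have h1 := h (fun t => B n t ^ (p - 1)) ((hBm n).pow_const _)
      ⟨(n : ℝ≥0) ^ (p - 1), fun t => by
        rw [ENNReal.coe_rpow_of_nonneg _ (by linarith)]
        exact ENNReal.rpow_le_rpow (by simpa using hBle n t) (by linarith)⟩
      ⟨n, fun t ht => by rw [hB0 n t ht, ENNReal.zero_rpow_of_pos (by linarith)]⟩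
    rw [hg] at h1
    have h2 : X ≤ C * X ^ (1 / q) := by
      refine le_trans (lintegral_mono fun t => ?_) h1
      have : B n t ^ p = B n t * B n t ^ (p - 1) := by
        conv_rhs => rw [← ENNReal.rpow_one (B n t), ← ENNReal.rpow_mul, one_mul]
        rw [← ENNReal.rpow_add_of_nonneg _ _ zero_le_one (by linarith)]
        congr 1
        ring
      rw [this]
      gcongr
      exact hBA n t
    rcases eq_or_ne X 0 with h0 | h0
    · rw [h0]; exact zero_le
    have hs : 1 / p + 1 / q = 1 := by
      have := hpq.inv_add_inv_eq_one
      simpa [one_div] using this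
    have h3 : X ^ (1 / p) ≤ C := by
      have e : X = X ^ (1 / p) * X ^ (1 / q) := by
        rw [← ENNReal.rpow_add _ _ h0 hXt, hs, ENNReal.rpow_one]
      rw [e] at h2
      have hne : X ^ (1 / q) ≠ 0 := by simp [h0, hXt]
      have hnt : X ^ (1 / q) ≠ ∞ := ENNReal.rpow_ne_top_of_nonneg (by positivity) hXt
      rw [← e] at h2
      exact (ENNReal.mul_le_mul_iff_left hne hnt).1 (e ▸ h2)
    calc X = (X ^ (1 / p)) ^ p := by
          rw [← ENNReal.rpow_mul, one_div_mul_cancel hp.ne', ENNReal.rpow_one]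
      _ ≤ C ^ p := ENNReal.rpow_le_rpow h3 hp.le
  have hlim : ∀ t, Filter.Tendsto (fun n => B n t ^ p) Filter.atTop (nhds (A t ^ p)) := by
    intro t
    refine (ENNReal.continuous_rpow_const.tendsto _).comp ?_
    have h1 : Filter.Tendsto (fun n : ℕ => min (A t) n) Filter.atTop (nhds (A t)) := by
      have := (tendsto_const_nhds (x := A t)).min ENNReal.tendsto_nat_nhds_top
      simpa using this
    refine h1.congr' ?_
    obtain ⟨N, hN⟩ := exists_nat_ge |t|
    filter_upwards [Filter.eventually_ge_atTop N] with n hn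
    have ht : t ∈ Set.Icc (-n : ℝ) n := abs_le.1 (hN.trans (by exact_mod_cast hn))
    simp [hB, ht]
  have hf : ∫⁻ t, A t ^ p ≤ C ^ p := by
    calc ∫⁻ t, A t ^ p = ∫⁻ t, Filter.liminf (fun n => B n t ^ p) Filter.atTop :=
          lintegral_congr fun t => ((hlim t).liminf_eq).symm
      _ ≤ Filter.liminf (fun n => ∫⁻ t, B n t ^ p) Filter.atTop :=
          lintegral_liminf_le fun n => (hBm n).pow_const _
      _ ≤ C ^ p := Filter.liminf_le_of_frequently_le' (Filter.Frequently.of_forall key)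
  calc lpNorm p A ≤ (C ^ p) ^ (1 / p) := ENNReal.rpow_le_rpow hf (by positivity)
    _ = C := by rw [← ENNReal.rpow_mul, mul_one_div_cancel hp.ne', ENNReal.rpow_one]

/-- Minkowski's integral inequality. -/
theorem lpNorm_lintegral_le {p q : ℝ} (hpq : p.HolderConjugate q) {F : ℝ → ℝ → ℝ≥0∞}
    (hF : Measurable (Function.uncurry F)) :
    lpNorm p (fun t => ∫⁻ s, F t s) ≤ ∫⁻ s, lpNorm p fun t => F t s := by
  -- By duality it suffices to pair with `g`, exchange the integrals and apply Hölder for each fixed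
  -- `s`.
  refine lpNorm_le_of_forall_lintegral_mul_le hpq hF.lintegral_prod_right fun g hg _ _ => ?_
  have hFs : ∀ s, Measurable fun t => F t s := fun s => hF.comp measurable_prodMk_right
  have hFt : ∀ t, Measurable fun s => F t s := fun s => hF.comp measurable_prodMk_left
  calc ∫⁻ t, (∫⁻ s, F t s) * g t = ∫⁻ t, ∫⁻ s, F t s * g t :=
        lintegral_congr fun t => (lintegral_mul_const _ (hFt t)).symm
    _ = ∫⁻ s, ∫⁻ t, F t s * g t := lintegral_lintegral_swap
        (hF.mul (hg.comp measurable_fst)).aemeasurable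
    _ ≤ ∫⁻ s, lpNorm p (fun t => F t s) * lpNorm q g :=
        lintegral_mono fun s => lintegral_mul_le_lpNorm_mul hpq (hFs s) hg
    _ = _ := by
        rw [lintegral_mul_const]
        unfold lpNorm
        have : Measurable fun z : ℝ × ℝ => F z.2 z.1 ^ p :=
          (hF.comp measurable_swap).pow_const p
        exact this.lintegral_prod_right.pow_const _

/-- The `TT*` argument. -/
theorem lpNorm_inner_le {H : Type*} [NormedAddCommGroup H] [InnerProductSpace ℂ H]
    [CompleteSpace H] {p q : ℝ} (hpq : p.HolderConjugate q) {ψ : ℝ → H}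
    (hψ : StronglyMeasurable ψ) (hψ1 : ∀ t, ‖ψ t‖ ≤ 1) {k : ℝ → ℝ → ℝ≥0∞}
    (hk : ∀ s t, ‖inner ℂ (ψ s) (ψ t)‖ₑ ≤ k s t) {C : ℝ≥0}
    (hC : ∀ g : ℝ → ℝ≥0∞, Measurable g → lpNorm q g ≠ ∞ →
      ∫⁻ s, ∫⁻ t, k s t * g s * g t ≤ (C * lpNorm q g) ^ 2) (u : H) :
    lpNorm p (fun t => ‖inner ℂ u (ψ t)‖ₑ) ≤ C * ‖u‖ₑ := by
  have ha : StronglyMeasurable fun t => inner ℂ u (ψ t) :=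
    (continuous_const.inner continuous_id).comp_stronglyMeasurable hψ
  refine lpNorm_le_of_forall_lintegral_mul_le hpq ha.enorm fun g hg ⟨M, hM⟩ ⟨R, hR⟩ => ?_
  have hgt : ∀ t, g t ≠ ∞ := fun t => ne_top_of_le_ne_top ENNReal.coe_ne_top (hM t)
  have hgq : lpNorm q g ≠ ∞ := by
    have hq := hpq.symm.pos
    refine ENNReal.rpow_ne_top_of_nonneg (by positivity) ?_
    have : ∫⁻ t, g t ^ q ≤ ∫⁻ t in Set.Icc (-R) R, (M : ℝ≥0∞) ^ q := by
      rw [← lintegral_indicator measurableSet_Icc]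
      refine lintegral_mono fun t => ?_
      by_cases ht : t ∈ Set.Icc (-R) R
      · simp only [ht, Set.indicator_of_mem]
        exact ENNReal.rpow_le_rpow (hM t) hq.le
      · have h0 : g t = 0 := hR t (lt_of_not_ge fun h => ht (abs_le.1 h))
        simp [h0, hq]
    refine ne_top_of_le_ne_top ?_ this
    rw [setLIntegral_const]
    exact ENNReal.mul_ne_top (ENNReal.rpow_ne_top_of_nonneg hq.le (by simp)) (by simp)
  -- The phase makes `z t * inner ℂ u (ψ t)` nonnegative, so the pairing with `g` becomes the single
  -- inner product of `u` with `Z`. Where the inner product vanishes, division by zero gives `z t =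
  -- 0`, which is harmless.
  set z : ℝ → ℂ := fun t =>
    (g t).toReal * ((starRingEnd ℂ) (inner ℂ u (ψ t)) / ‖inner ℂ u (ψ t)‖) with hz
  have hzm : StronglyMeasurable z := by
    have h1 : Measurable fun t => inner ℂ u (ψ t) := ha.measurable
    have h2 : Measurable fun t => (starRingEnd ℂ) (inner ℂ u (ψ t)) :=
      Complex.continuous_conj.measurable.comp h1
    have : Measurable z := by
      simp only [hz]
      fun_prop
    exact this.stronglyMeasurable
  have hzn : ∀ t, ‖z t‖ ≤ (g t).toReal := fun t => by
    rw [hz]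
    simp only [norm_mul, norm_div, RCLike.norm_conj, Complex.norm_real, norm_norm]
    rw [Real.norm_of_nonneg ENNReal.toReal_nonneg]
    exact mul_le_of_le_one_right ENNReal.toReal_nonneg (div_self_le_one _)
  have hze : ∀ t, ‖z t‖ₑ ≤ g t := fun t => by
    rw [← ofReal_norm]
    exact ENNReal.ofReal_le_of_le_toReal (hzn t)
  have hfi : Integrable fun t => z t • ψ t := by
    have hbd : ∀ t, ‖z t • ψ t‖ ≤ (Set.Icc (-R) R).indicator (fun _ => (M : ℝ)) t := fun t => by
      rw [norm_smul]
      have hgM : (g t).toReal ≤ M := ENNReal.toReal_le_coe_of_le_coe (hM t)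
      by_cases ht : t ∈ Set.Icc (-R) R
      · simp only [ht, Set.indicator_of_mem]
        calc ‖z t‖ * ‖ψ t‖ ≤ M * 1 := mul_le_mul ((hzn t).trans hgM) (hψ1 t) (norm_nonneg _)
              M.2
          _ = M := mul_one _
      · have h0 : g t = 0 := hR t (lt_of_not_ge fun h => ht (abs_le.1 h))
        simp [hz, h0, ht]
    refine Integrable.mono' ?_ (hzm.smul hψ).aestronglyMeasurable
      (Filter.Eventually.of_forall hbd)
    exact (integrable_indicator_iff measurableSet_Icc).2 (integrableOn_const (by simp))
  set Z : H := ∫ t, z t • ψ t with hZ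
  have hZi : ∀ w : H, inner ℂ w Z = ∫ t, z t * inner ℂ w (ψ t) := fun w => by
    rw [hZ, ← integral_inner hfi]
    exact integral_congr_ae (Filter.Eventually.of_forall fun t => inner_smul_right _ _ _)
  have hZe : ∀ w : H, ‖inner ℂ w Z‖ₑ ≤ ∫⁻ t, g t * ‖inner ℂ w (ψ t)‖ₑ := fun w => by
    rw [hZi]
    refine (enorm_integral_le_lintegral_enorm _).trans (lintegral_mono fun t => ?_)
    rw [enorm_mul]
    gcongr
    exact hze t
  -- Expanding the square of `Z` leaves only the Gram kernel of `ψ`, which `k` dominates.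
  have hZsq : ‖Z‖ₑ ^ 2 ≤ (C * lpNorm q g) ^ 2 := by
    have h1 : ‖Z‖ₑ ^ 2 = ‖inner ℂ Z Z‖ₑ := by
      rw [inner_self_eq_norm_sq_to_K, ← ofReal_norm, ← ofReal_norm,
        ← ENNReal.ofReal_pow (norm_nonneg _)]
      simp
    rw [h1]
    refine (hZe Z).trans (le_trans (lintegral_mono fun t => ?_) (hC g hg hgq))
    have h2 : ‖inner ℂ Z (ψ t)‖ₑ = ‖inner ℂ (ψ t) Z‖ₑ := by
      rw [← ofReal_norm, ← ofReal_norm, norm_inner_symm]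
    rw [h2]
    calc g t * ‖inner ℂ (ψ t) Z‖ₑ ≤ g t * ∫⁻ s, g s * ‖inner ℂ (ψ t) (ψ s)‖ₑ := by
          gcongr; exact hZe _
      _ ≤ g t * ∫⁻ s, k t s * g s := by
          refine mul_le_mul' le_rfl (lintegral_mono fun s => ?_)
          rw [mul_comm]
          exact mul_le_mul' (hk t s) le_rfl
      _ = ∫⁻ s, k t s * g t * g s := by
          rw [← lintegral_const_mul' _ _ (hgt t)]
          exact lintegral_congr fun s => by ring
  have hZle : ‖Z‖ₑ ≤ C * lpNorm q g := (ENNReal.pow_le_pow_left_iff two_ne_zero).1 hZsq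
  have hint : ∫⁻ t, ‖inner ℂ u (ψ t)‖ₑ * g t = ‖inner ℂ u Z‖ₑ := by
    have h1 : ∀ t, z t * inner ℂ u (ψ t) = (((g t).toReal * ‖inner ℂ u (ψ t)‖ : ℝ) : ℂ) := by
      intro t
      rcases eq_or_ne (inner ℂ u (ψ t)) 0 with h0 | h0
      · simp [h0]
      · have h0' : (‖inner ℂ u (ψ t)‖ : ℂ) ≠ 0 := by simpa using h0
        simp only [hz]
        rw [mul_assoc, div_mul_eq_mul_div, Complex.conj_mul', sq, mul_div_assoc, div_self h0',
          mul_one]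
        push_cast
        rfl
    rw [hZi, integral_congr_ae (Filter.Eventually.of_forall h1), integral_complex_ofReal,
      ← ofReal_norm]
    have h2 : 0 ≤ ∫ t, (g t).toReal * ‖inner ℂ u (ψ t)‖ :=
      integral_nonneg fun t => mul_nonneg ENNReal.toReal_nonneg (norm_nonneg _)
    have h3 : Integrable fun t => (g t).toReal * ‖inner ℂ u (ψ t)‖ := by
      have := (hfi.const_inner (𝕜 := ℂ) u).norm
      refine this.congr (Filter.Eventually.of_forall fun t => ?_)
      beta_reduce
      rw [inner_smul_right, h1, Complex.norm_real, Real.norm_of_nonneg]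
      positivity
    rw [Complex.norm_real, Real.norm_of_nonneg h2, ofReal_integral_eq_lintegral_ofReal h3
      (Filter.Eventually.of_forall fun t => by positivity)]
    refine lintegral_congr fun t => ?_
    rw [ENNReal.ofReal_mul ENNReal.toReal_nonneg, ENNReal.ofReal_toReal (hgt t),
      ofReal_norm, mul_comm]
  rw [hint]
  have hcs : ‖inner ℂ u Z‖ₑ ≤ ‖u‖ₑ * ‖Z‖ₑ := by
    rw [← ofReal_norm, ← ofReal_norm, ← ofReal_norm,
      ← ENNReal.ofReal_mul (norm_nonneg _)]
    exact ENNReal.ofReal_le_ofReal (norm_inner_le_norm _ _)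
  calc ‖inner ℂ u Z‖ₑ ≤ ‖u‖ₑ * (C * lpNorm q g) := hcs.trans (by gcongr)
    _ = _ := by ring

/-! ### The Hardy-Littlewood-Sobolev inequality for `|t|^{-1/3}` -/

theorem lintegral_comp_abs_sub (F : ℝ → ℝ≥0∞) (hF : Measurable F) (s : ℝ) :
    ∫⁻ t, F |t - s| = 2 * ∫⁻ t in Set.Ioi 0, F t := by
  rw [lintegral_sub_right_eq_self (fun t => F |t|) s,
    ← lintegral_add_compl _ (measurableSet_Ioi (a := (0 : ℝ))), two_mul]
  congr 1
  · exact setLIntegral_congr_fun measurableSet_Ioi fun t ht => by rw [abs_of_pos ht]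
  · rw [Set.compl_Ioi, ← setLIntegral_congr (Iio_ae_eq_Iic (a := (0 : ℝ)))]
    have h := (Measure.measurePreserving_neg (volume : Measure ℝ)).setLIntegral_comp_preimage
      (measurableSet_Ioi (a := (0 : ℝ))) hF
    rw [← h]
    have : (Neg.neg ⁻¹' Set.Ioi (0 : ℝ)) = Set.Iio 0 := by ext; simp
    rw [this]
    exact setLIntegral_congr_fun measurableSet_Iio fun t ht => by rw [abs_of_neg ht]

/-- The Riesz kernel `|t|^{-1/3}`, infinite at the origin. -/
def rieszKernel (t : ℝ) : ℝ≥0∞ := ENNReal.ofReal |t| ^ (-(1 / 3) : ℝ)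

theorem measurable_rieszKernel : Measurable rieszKernel := by
  unfold rieszKernel
  fun_prop

theorem lintegral_rieszKernel_near {r : ℝ} (hr : 0 < r) (s : ℝ) :
    ∫⁻ t, (Set.Iic r).indicator (fun x => ENNReal.ofReal x ^ (-(1 / 3) : ℝ)) |t - s|
      = ENNReal.ofReal (3 * r ^ (2 / 3 : ℝ)) := by
  rw [lintegral_comp_abs_sub _ (Measurable.indicator (by fun_prop) measurableSet_Iic),
    setLIntegral_indicator measurableSet_Iic, Set.Iic_inter_Ioi]
  have h1 : ∫⁻ t in Set.Ioc 0 r, ENNReal.ofReal t ^ (-(1 / 3) : ℝ)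
      = ∫⁻ t in Set.Ioc 0 r, ENNReal.ofReal (t ^ (-(1 / 3) : ℝ)) :=
    setLIntegral_congr_fun measurableSet_Ioc fun t ht => ENNReal.ofReal_rpow_of_pos ht.1
  have h2 : IntegrableOn (fun t : ℝ => t ^ (-(1 / 3) : ℝ)) (Set.Ioc 0 r) :=
    (intervalIntegrable_iff_integrableOn_Ioc_of_le hr.le).1
      (intervalIntegral.intervalIntegrable_rpow' (by norm_num))
  rw [h1, ← ofReal_integral_eq_lintegral_ofReal h2, ← intervalIntegral.integral_of_le hr.le,
    integral_rpow (Or.inl (by norm_num)), ← ENNReal.ofReal_ofNat 2,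
    ← ENNReal.ofReal_mul (by norm_num)]
  · congr 1
    norm_num
    ring
  · refine (ae_restrict_iff' measurableSet_Ioc).2 (Filter.Eventually.of_forall fun t ht => ?_)
    exact Real.rpow_nonneg ht.1.le _

theorem lintegral_rieszKernel_far {r : ℝ} (hr : 0 < r) (s : ℝ) :
    ∫⁻ t, (Set.Ioi r).indicator (fun x => ENNReal.ofReal x ^ (-(1 / 3) : ℝ)) |t - s| ^ (6 : ℝ)
      = ENNReal.ofReal (2 / r) := by
  have h0 : ∀ x, (Set.Ioi r).indicator (fun x => ENNReal.ofReal x ^ (-(1 / 3) : ℝ)) x ^ (6 : ℝ)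
      = (Set.Ioi r).indicator (fun x => ENNReal.ofReal x ^ (-2 : ℝ)) x := fun x => by
    by_cases hx : x ∈ Set.Ioi r
    · simp only [hx, Set.indicator_of_mem, ← ENNReal.rpow_mul]
      norm_num
    · simp [hx]
  simp_rw [h0]
  rw [lintegral_comp_abs_sub _ (Measurable.indicator (by fun_prop) measurableSet_Ioi),
    setLIntegral_indicator measurableSet_Ioi, Set.Ioi_inter_Ioi, max_eq_left hr.le]
  have h1 : ∫⁻ t in Set.Ioi r, ENNReal.ofReal t ^ (-2 : ℝ)
      = ∫⁻ t in Set.Ioi r, ENNReal.ofReal (t ^ (-2 : ℝ)) :=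
    setLIntegral_congr_fun measurableSet_Ioi fun t ht =>
      ENNReal.ofReal_rpow_of_pos (hr.trans ht)
  rw [h1, ← ofReal_integral_eq_lintegral_ofReal
    (integrableOn_Ioi_rpow_of_lt (by norm_num) hr), integral_Ioi_rpow_of_lt (by norm_num) hr,
    ← ENNReal.ofReal_ofNat 2, ← ENNReal.ofReal_mul (by norm_num)]
  · congr 1
    norm_num
    rw [Real.rpow_neg_one]
    ring
  · refine (ae_restrict_iff' measurableSet_Ioi).2 (Filter.Eventually.of_forall fun t ht => ?_)
    exact Real.rpow_nonneg (hr.trans ht).le _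

theorem holderConjugate_six : (6 : ℝ).HolderConjugate (6 / 5) := by
  rw [Real.holderConjugate_iff]; norm_num

/-- The kernel is cut at distance `r`. Near the singularity `h` is replaced by its cap `a`, which
costs `3 r^{2/3} a`; far away Hölder with exponents `6` and `6/5` costs at most `2 r^{-1/6}`. -/
theorem lintegral_rieszKernel_mul_truncated_le {h : ℝ → ℝ≥0∞} (hh : Measurable h)
    (h1 : ∫⁻ t, h t ^ (6 / 5 : ℝ) ≤ 1) (a : ℝ≥0∞) (s : ℝ) :
    ∫⁻ t, rieszKernel (t - s) * (if h t ≤ a then h t else 0) ≤ 5 * a ^ (1 / 5 : ℝ) := by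
  rcases eq_or_ne a ∞ with rfl | hat
  · simp
  rcases eq_or_ne a 0 with rfl | ha0
  · have : ∀ t, rieszKernel (t - s) * (if h t ≤ 0 then h t else 0) = 0 := fun t => by
      split_ifs with ht
      · rw [le_zero_iff.1 ht, mul_zero]
      · rw [mul_zero]
    rw [lintegral_congr this]
    simp
  lift a to ℝ≥0 using hat
  have ha : 0 < (a : ℝ) := by
    have : a ≠ 0 := by simpa using ha0
    positivity
  -- This radius balances the two contributions: both become multiples of `a^{1/5}`.
  set r : ℝ := (a : ℝ) ^ (-(6 / 5) : ℝ) with hr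
  have hr0 : 0 < r := Real.rpow_pos_of_pos ha _
  set N := (Set.Iic r).indicator (fun x => ENNReal.ofReal x ^ (-(1 / 3) : ℝ)) with hN
  set F := (Set.Ioi r).indicator (fun x => ENNReal.ofReal x ^ (-(1 / 3) : ℝ)) with hF
  have hNm : Measurable fun t => N |t - s| :=
    (Measurable.indicator (by fun_prop) measurableSet_Iic).comp (by fun_prop)
  have hFm : Measurable fun t => F |t - s| :=
    (Measurable.indicator (by fun_prop) measurableSet_Ioi).comp (by fun_prop)
  have hpt : ∀ t, rieszKernel (t - s) * (if h t ≤ a then h t else 0)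
      ≤ N |t - s| * a + F |t - s| * h t := by
    intro t
    rcases le_or_gt |t - s| r with hts | hts
    · have : N |t - s| = rieszKernel (t - s) := Set.indicator_of_mem (s := Set.Iic r) hts _
      rw [this]
      refine le_trans ?_ le_self_add
      gcongr
      split_ifs with h'
      · exact h'
      · exact zero_le
    · have : F |t - s| = rieszKernel (t - s) := Set.indicator_of_mem (s := Set.Ioi r) hts _
      rw [this]
      refine le_trans ?_ le_add_self
      gcongr
      split_ifs with h'
      · exact le_rfl
      · exact zero_le
  refine (lintegral_mono hpt).trans ?_
  rw [lintegral_add_left (hNm.mul_const _), lintegral_mul_const _ hNm,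
    lintegral_rieszKernel_near hr0]
  have h2 : ∫⁻ t, F |t - s| * h t ≤ ENNReal.ofReal (2 * (a : ℝ) ^ (1 / 5 : ℝ)) := by
    refine (lintegral_mul_le_lpNorm_mul holderConjugate_six hFm hh).trans ?_
    have e1 : lpNorm 6 (fun t => F |t - s|) ≤ ENNReal.ofReal (2 * (a : ℝ) ^ (1 / 5 : ℝ)) := by
      rw [lpNorm, lintegral_rieszKernel_far hr0, ENNReal.ofReal_rpow_of_pos (by positivity)]
      refine ENNReal.ofReal_le_ofReal ?_
      rw [Real.div_rpow (by norm_num) hr0.le, hr, ← Real.rpow_mul ha.le, div_eq_mul_inv,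
        ← Real.rpow_neg ha.le]
      have : (2 : ℝ) ^ (1 / 6 : ℝ) ≤ 2 := by
        conv_rhs => rw [← Real.rpow_one 2]
        exact Real.rpow_le_rpow_of_exponent_le (by norm_num) (by norm_num)
      norm_num
      norm_num at this
      gcongr
    have e2 : lpNorm (6 / 5) h ≤ 1 := ENNReal.rpow_le_one h1 (by norm_num)
    calc _ ≤ ENNReal.ofReal (2 * (a : ℝ) ^ (1 / 5 : ℝ)) * 1 := mul_le_mul' e1 e2
      _ = _ := mul_one _
  have h3 : ENNReal.ofReal (3 * r ^ (2 / 3 : ℝ)) * a = ENNReal.ofReal (3 * (a : ℝ) ^ (1 / 5 : ℝ)) := by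
    rw [← ENNReal.ofReal_coe_nnreal, ← ENNReal.ofReal_mul (by positivity)]
    congr 1
    rw [hr, ← Real.rpow_mul ha.le, mul_assoc]
    congr 1
    conv_lhs => rw [← Real.rpow_one (a : ℝ), ← Real.rpow_mul ha.le, one_mul, ← Real.rpow_add ha]
    norm_num
  have h4 : (5 : ℝ≥0∞) * (a : ℝ≥0∞) ^ (1 / 5 : ℝ) = ENNReal.ofReal (5 * (a : ℝ) ^ (1 / 5 : ℝ)) := by
    rw [ENNReal.ofReal_mul (by norm_num), ENNReal.ofReal_ofNat, ← ENNReal.ofReal_rpow_of_pos ha,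
      ENNReal.ofReal_coe_nnreal]
  rw [h3, h4]
  refine (add_le_add_right h2 _).trans ?_
  rw [← ENNReal.ofReal_add (by positivity) (by positivity)]
  refine ENNReal.ofReal_le_ofReal (le_of_eq ?_)
  ring

/-- The plane is split according to which of `g s` and `h t` is larger. With the larger value as
cap, the truncated bound turns the inner integral into `5 g^{1/5}`, and `g · g^{1/5} = g^{6/5}`
integrates to at most one. This replaces interpolation. -/
theorem lintegral_rieszKernel_mul_mul_le_of_le_one {g h : ℝ → ℝ≥0∞} (hg : Measurable g)
    (hh : Measurable h) (hg1 : ∫⁻ t, g t ^ (6 / 5 : ℝ) ≤ 1) (hh1 : ∫⁻ t, h t ^ (6 / 5 : ℝ) ≤ 1) :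
    ∫⁻ s, ∫⁻ t, rieszKernel (t - s) * g s * h t ≤ 10 := by
  have hk : Measurable fun z : ℝ × ℝ => rieszKernel (z.2 - z.1) :=
    measurable_rieszKernel.comp (by fun_prop)
  have half : ∀ {g h : ℝ → ℝ≥0∞}, Measurable g → Measurable h →
      ∫⁻ t, g t ^ (6 / 5 : ℝ) ≤ 1 → ∫⁻ t, h t ^ (6 / 5 : ℝ) ≤ 1 →
      ∫⁻ s, ∫⁻ t, g s * (rieszKernel (t - s) * (if h t ≤ g s then h t else 0)) ≤ 5 := by
    intro g h hg hh hg1 hh1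
    calc ∫⁻ s, ∫⁻ t, g s * (rieszKernel (t - s) * (if h t ≤ g s then h t else 0))
        = ∫⁻ s, g s * ∫⁻ t, rieszKernel (t - s) * (if h t ≤ g s then h t else 0) := by
          refine lintegral_congr fun s => lintegral_const_mul _ ?_
          exact (measurable_rieszKernel.comp (by fun_prop)).mul
            (Measurable.ite (measurableSet_le hh measurable_const) hh measurable_const)
      _ ≤ ∫⁻ s, g s * (5 * g s ^ (1 / 5 : ℝ)) := by
          refine lintegral_mono fun s => mul_le_mul' le_rfl ?_
          exact lintegral_rieszKernel_mul_truncated_le hh hh1 _ _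
      _ = ∫⁻ s, 5 * g s ^ (6 / 5 : ℝ) := by
          refine lintegral_congr fun s => ?_
          have : g s ^ (6 / 5 : ℝ) = g s * g s ^ (1 / 5 : ℝ) := by
            conv_rhs => rw [← ENNReal.rpow_one (g s), ← ENNReal.rpow_mul, one_mul,
              ← ENNReal.rpow_add_of_nonneg _ _ zero_le_one (by norm_num)]
            norm_num
          rw [this]
          ring
      _ ≤ 5 * 1 := by
          rw [lintegral_const_mul' _ _ (by simp)]
          gcongr
      _ = 5 := mul_one _
  have hm : ∀ {g h : ℝ → ℝ≥0∞}, Measurable g → Measurable h → Measurable fun z : ℝ × ℝ =>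
      g z.1 * (rieszKernel (z.2 - z.1) * (if h z.2 ≤ g z.1 then h z.2 else 0)) := fun hg hh =>
    (hg.comp measurable_fst).mul (hk.mul (Measurable.ite (measurableSet_le
      (hh.comp measurable_snd) (hg.comp measurable_fst)) (hh.comp measurable_snd)
      measurable_const))
  have hm1 := hm hg hh
  have hm2 := hm hh hg
  calc ∫⁻ s, ∫⁻ t, rieszKernel (t - s) * g s * h t
      ≤ ∫⁻ s, ∫⁻ t, (g s * (rieszKernel (t - s) * (if h t ≤ g s then h t else 0))
          + h t * (rieszKernel (s - t) * (if g s ≤ h t then g s else 0))) := by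
        refine lintegral_mono fun s => lintegral_mono fun t => ?_
        have hsym : rieszKernel (s - t) = rieszKernel (t - s) := by
          rw [rieszKernel, rieszKernel, abs_sub_comm]
        rcases le_total (h t) (g s) with hle | hle
        · rw [if_pos hle]
          exact le_trans (le_of_eq (by ring)) le_self_add
        · rw [if_pos hle, hsym]
          exact le_trans (le_of_eq (by ring)) le_add_self
    _ = (∫⁻ s, ∫⁻ t, g s * (rieszKernel (t - s) * (if h t ≤ g s then h t else 0)))
          + ∫⁻ s, ∫⁻ t, h t * (rieszKernel (s - t) * (if g s ≤ h t then g s else 0)) := by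
        rw [← lintegral_add_left hm1.lintegral_prod_right']
        refine lintegral_congr fun s => ?_
        exact lintegral_add_left (hm1.comp measurable_prodMk_left) _
    _ = (∫⁻ s, ∫⁻ t, g s * (rieszKernel (t - s) * (if h t ≤ g s then h t else 0)))
          + ∫⁻ t, ∫⁻ s, h t * (rieszKernel (s - t) * (if g s ≤ h t then g s else 0)) := by
        congr 1
        exact lintegral_lintegral_swap (hm2.comp measurable_swap).aemeasurable
    _ ≤ 5 + 5 := add_le_add (half hg hh hg1 hh1) (half hh hg hh1 hg1)
    _ = 10 := by norm_num

theorem lintegral_div_lpNorm_rpow {p : ℝ} (hp : 0 < p) {g : ℝ → ℝ≥0∞} (h0 : lpNorm p g ≠ 0)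
    (ht : lpNorm p g ≠ ∞) : ∫⁻ t, (g t / lpNorm p g) ^ p = 1 := by
  simp_rw [ENNReal.div_rpow_of_nonneg _ _ hp.le, div_eq_mul_inv]
  have hpos : lpNorm p g ^ p ≠ 0 := by simp [h0, ht]
  rw [lintegral_mul_const' _ _ (ENNReal.inv_ne_top.2 hpos), ← lpNorm_rpow hp]
  exact ENNReal.mul_inv_cancel hpos (ENNReal.rpow_ne_top_of_nonneg hp.le ht)

theorem ae_eq_zero_of_lpNorm_eq_zero {p : ℝ} (hp : 0 < p) {g : ℝ → ℝ≥0∞} (hg : Measurable g)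
    (h0 : lpNorm p g = 0) : ∀ᵐ t, g t = 0 := by
  have h : ∫⁻ t, g t ^ p = 0 := by
    rw [← lpNorm_rpow hp, h0, ENNReal.zero_rpow_of_pos hp]
  rw [lintegral_eq_zero_iff (hg.pow_const _)] at h
  filter_upwards [h] with t ht
  simpa [hp, hp.not_gt] using ht

/-- The Hardy-Littlewood-Sobolev inequality, bilinear form. -/
theorem lintegral_rieszKernel_mul_mul_le {g h : ℝ → ℝ≥0∞} (hg : Measurable g)
    (hh : Measurable h) (hgt : lpNorm (6 / 5) g ≠ ∞) (hht : lpNorm (6 / 5) h ≠ ∞) :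
    ∫⁻ s, ∫⁻ t, rieszKernel (t - s) * g s * h t
      ≤ 10 * lpNorm (6 / 5) g * lpNorm (6 / 5) h := by
  have hp : (0 : ℝ) < 6 / 5 := by norm_num
  rcases eq_or_ne (lpNorm (6 / 5) g) 0 with hg0 | hg0
  · refine le_of_eq_of_le ?_ zero_le
    rw [lintegral_congr_ae ((ae_eq_zero_of_lpNorm_eq_zero hp hg hg0).mono fun s hs => ?_),
      lintegral_zero]
    simp [hs]
  rcases eq_or_ne (lpNorm (6 / 5) h) 0 with hh0 | hh0
  · refine le_of_eq_of_le ?_ zero_le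
    have : ∀ s, ∫⁻ t, rieszKernel (t - s) * g s * h t = 0 := fun s => by
      rw [lintegral_congr_ae ((ae_eq_zero_of_lpNorm_eq_zero hp hh hh0).mono fun t ht => ?_),
        lintegral_zero]
      simp [ht]
    simp [this]
  set G := lpNorm (6 / 5) g
  set K := lpNorm (6 / 5) h
  have key := lintegral_rieszKernel_mul_mul_le_of_le_one (hg.div_const G) (hh.div_const K)
    (lintegral_div_lpNorm_rpow hp hg0 hgt).le (lintegral_div_lpNorm_rpow hp hh0 hht).le
  have e : ∫⁻ s, ∫⁻ t, rieszKernel (t - s) * g s * h t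
      = (G * K) * ∫⁻ s, ∫⁻ t, rieszKernel (t - s) * (g s / G) * (h t / K) := by
    have hGK : G * K ≠ ∞ := ENNReal.mul_ne_top hgt hht
    rw [← lintegral_const_mul' _ _ hGK]
    refine lintegral_congr fun s => ?_
    rw [← lintegral_const_mul' _ _ hGK]
    refine lintegral_congr fun t => ?_
    calc rieszKernel (t - s) * g s * h t
        = rieszKernel (t - s) * (G * (g s / G)) * (K * (h t / K)) := by
          rw [ENNReal.mul_div_cancel hg0 hgt, ENNReal.mul_div_cancel hh0 hht]
      _ = _ := by ring
  rw [e]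
  calc _ ≤ G * K * 10 := mul_le_mul' le_rfl key
    _ = _ := by ring

/-- The Hardy-Littlewood-Sobolev inequality. -/
theorem lpNorm_lintegral_rieszKernel_mul_le {g : ℝ → ℝ≥0∞} (hg : Measurable g)
    (hgt : lpNorm (6 / 5) g ≠ ∞) :
    lpNorm 6 (fun t => ∫⁻ s, rieszKernel (t - s) * g s) ≤ 10 * lpNorm (6 / 5) g := by
  have hk : Measurable fun z : ℝ × ℝ => rieszKernel (z.1 - z.2) * g z.2 :=
    (measurable_rieszKernel.comp (by fun_prop)).mul (hg.comp measurable_snd)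
  refine lpNorm_le_of_forall_lintegral_mul_le holderConjugate_six hk.lintegral_prod_right'
    fun h hh _ _ => ?_
  -- With an infinite norm on the right the claim is trivial unless the other norm is zero, since `0
  -- * ∞ = 0`; in that case the left side vanishes.
  rcases eq_or_ne (lpNorm (6 / 5) h) ∞ with hht | hht
  · rcases eq_or_ne (lpNorm (6 / 5) g) 0 with hg0 | hg0
    · refine le_of_eq_of_le ?_ zero_le
      have : ∀ t, ∫⁻ s, rieszKernel (t - s) * g s = 0 := fun t => by
        rw [lintegral_congr_ae ((ae_eq_zero_of_lpNorm_eq_zero (by norm_num) hg hg0).mono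
          fun s hs => ?_), lintegral_zero]
        simp [hs]
      simp [this]
    · rw [hht, ENNReal.mul_top (by simp [hg0])]
      exact le_top
  calc ∫⁻ t, (∫⁻ s, rieszKernel (t - s) * g s) * h t
      = ∫⁻ t, ∫⁻ s, rieszKernel (t - s) * g s * h t :=
        lintegral_congr fun t =>
          (lintegral_mul_const _ (hk.comp measurable_prodMk_left)).symm
    _ = ∫⁻ s, ∫⁻ t, rieszKernel (t - s) * g s * h t := lintegral_lintegral_swap
        (hk.mul (hh.comp measurable_fst)).aemeasurable
    _ ≤ _ := lintegral_rieszKernel_mul_mul_le hg hh hgt hht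

/-! ### Young's inequality -/

/-- Young's convolution inequality `L¹ * L² ⊆ L²`. -/
theorem lpNorm_lintegral_mul_le {m g : ℝ → ℝ≥0∞} (hm : Measurable m) (hg : Measurable g) :
    lpNorm 2 (fun t => ∫⁻ s, m (t - s) * g s) ≤ (∫⁻ t, m t) * lpNorm 2 g := by
  have e : ∀ t, ∫⁻ s, m (t - s) * g s = ∫⁻ s, m s * g (t - s) := fun t => by
    rw [← lintegral_sub_left_eq_self _ t]
    simp
  simp_rw [e]
  have hF : Measurable fun z : ℝ × ℝ => m z.2 * g (z.1 - z.2) :=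
    (hm.comp measurable_snd).mul (hg.comp (by fun_prop))
  -- The convolution is a superposition of translates of `g` with weights `m s`, and translation
  -- preserves the norm.
  refine (lpNorm_lintegral_le (F := fun t s => m s * g (t - s))
    Real.HolderConjugate.two_two hF).trans ?_
  rw [← lintegral_mul_const _ hm]
  refine lintegral_mono fun s => ?_
  have hsh : lpNorm 2 (fun t => g (t - s)) = lpNorm 2 g := by
    rw [lpNorm, lintegral_sub_right_eq_self (fun t => g t ^ (2 : ℝ)) s]
    rfl
  rw [← hsh]
  simp_rw [lpNorm, ENNReal.mul_rpow_of_nonneg _ _ (zero_le_two (α := ℝ))]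
  have hgs : Measurable fun t => g (t - s) ^ (2 : ℝ) :=
    (hg.comp (measurable_id.sub_const s)).pow_const _
  rw [lintegral_const_mul _ hgs,
    ENNReal.mul_rpow_of_nonneg _ _ (by norm_num), ← ENNReal.rpow_mul]
  norm_num

theorem lintegral_mul_mul_le {m g h : ℝ → ℝ≥0∞} (hm : Measurable m) (hg : Measurable g)
    (hh : Measurable h) :
    ∫⁻ t, ∫⁻ s, m (t - s) * g s * h t ≤ (∫⁻ t, m t) * lpNorm 2 g * lpNorm 2 h := by
  have hk : Measurable fun z : ℝ × ℝ => m (z.1 - z.2) * g z.2 :=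
    (hm.comp (by fun_prop)).mul (hg.comp measurable_snd)
  calc ∫⁻ t, ∫⁻ s, m (t - s) * g s * h t = ∫⁻ t, (∫⁻ s, m (t - s) * g s) * h t :=
        lintegral_congr fun t => lintegral_mul_const _ (hk.comp measurable_prodMk_left)
    _ ≤ lpNorm 2 (fun t => ∫⁻ s, m (t - s) * g s) * lpNorm 2 h :=
        lintegral_mul_le_lpNorm_mul Real.HolderConjugate.two_two hk.lintegral_prod_right' hh
    _ ≤ _ := mul_le_mul' (lpNorm_lintegral_mul_le hm hg) le_rfl

/-! ### Sequence norms -/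

theorem enorm_exp_mul (a : ℝ) (x : ℤ) (z : ℂ) :
    ‖(Real.exp (a * |(x : ℝ)|) : ℂ) * z‖ₑ = ENNReal.ofReal (Real.exp (a * |(x : ℝ)|)) * ‖z‖ₑ := by
  rw [enorm_mul]
  congr 1
  rw [← ofReal_norm, Complex.norm_real, Real.norm_of_nonneg (Real.exp_pos _).le]

theorem seqNorm_two (a : ℝ) (u : ℤ → ℂ) : seqNorm 2 a u
    = (∑' x : ℤ, (ENNReal.ofReal (Real.exp (a * |(x : ℝ)|)) * ‖u x‖ₑ) ^ (2 : ℝ)) ^ (1 / 2 : ℝ) := by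
  rw [seqNorm, eLpNorm_eq_lintegral_rpow_enorm_toReal (by norm_num) (by norm_num),
    lintegral_count]
  simp_rw [enorm_exp_mul]
  norm_num

theorem seqNorm_two_zero (u : ℤ → ℂ) :
    seqNorm 2 0 u = (∑' x : ℤ, ‖u x‖ₑ ^ (2 : ℝ)) ^ (1 / 2 : ℝ) := by
  rw [seqNorm_two]
  simp

theorem seqNorm_one_zero (u : ℤ → ℂ) : seqNorm 1 0 u = ∑' x : ℤ, ‖u x‖ₑ := by
  rw [seqNorm, eLpNorm_one_eq_lintegral_enorm, lintegral_count]
  simp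

theorem seqNorm_top_zero (u : ℤ → ℂ) : seqNorm ∞ 0 u = ⨆ x : ℤ, ‖u x‖ₑ := by
  rw [seqNorm, eLpNorm_exponent_top, eLpNormEssSup_eq_essSup_enorm, essSup_count]
  simp

theorem enorm_apply_le_seqNorm_top (u : ℤ → ℂ) (x : ℤ) : ‖u x‖ₑ ≤ seqNorm ∞ 0 u := by
  rw [seqNorm_top_zero]
  exact le_iSup (fun x => ‖u x‖ₑ) x

theorem enorm_l2_eq (w : L2Z) : ‖w‖ₑ = (∑' x : ℤ, ‖w x‖ₑ ^ (2 : ℝ)) ^ (1 / 2 : ℝ) := by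
  have h := lp.norm_eq_tsum_rpow (p := 2) (by norm_num) w
  have hs := (memℓp_gen_iff (p := 2) (by norm_num)).1 (lp.memℓp w)
  simp only [ENNReal.toReal_ofNat] at h hs
  rw [← ofReal_norm, h, ← ENNReal.ofReal_rpow_of_nonneg (tsum_nonneg fun x => by positivity)
    (by norm_num), ENNReal.ofReal_tsum_of_nonneg (fun x => by positivity) hs]
  congr 2
  ext x
  rw [← ENNReal.ofReal_rpow_of_nonneg (norm_nonneg _) (by norm_num), ofReal_norm]

theorem seqNorm_two_zero_coe (w : L2Z) : seqNorm 2 0 w = ‖w‖ₑ := by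
  rw [seqNorm_two_zero, enorm_l2_eq]

theorem memlp_of_seqNorm_lt_top {u : ℤ → ℂ} (h : seqNorm 2 0 u < ∞) : Memℓp u 2 := by
  refine (memℓp_gen_iff (p := 2) (by norm_num)).2 ?_
  rw [seqNorm_two_zero, ENNReal.rpow_lt_top_iff_of_pos (by norm_num)] at h
  have : ∀ x, ‖u x‖ₑ ^ (2 : ℝ) = ENNReal.ofReal (‖u x‖ ^ (2 : ℝ)) := fun x => by
    rw [← ENNReal.ofReal_rpow_of_nonneg (norm_nonneg _) (by norm_num), ofReal_norm]
  simp_rw [this] at h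
  have hs := ENNReal.summable_toReal h.ne
  refine hs.congr fun x => ?_
  rw [ENNReal.toReal_ofReal (by positivity), ENNReal.toReal_ofNat]

theorem toL2_apply {u : ℤ → ℂ} (h : Memℓp u 2) (x : ℤ) : toL2 u x = u x := by
  rw [toL2, dif_pos h]

theorem coe_toL2 {u : ℤ → ℂ} (h : Memℓp u 2) : ⇑(toL2 u) = u := funext (toL2_apply h)

theorem toL2_coe (w : L2Z) : toL2 w = w := by
  ext x
  exact toL2_apply (lp.memℓp w) x

theorem seqNorm_two_zero_le_one_zero (u : ℤ → ℂ) : seqNorm 2 0 u ≤ seqNorm 1 0 u := by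
  rw [seqNorm_two_zero, seqNorm_one_zero]
  rcases eq_or_ne (∑' x : ℤ, ‖u x‖ₑ) ∞ with h | h
  · rw [h]; exact le_top
  rw [one_div, ENNReal.rpow_inv_le_iff (by norm_num), ENNReal.rpow_two, sq, ← ENNReal.tsum_mul_right]
  refine ENNReal.tsum_le_tsum fun x => ?_
  rw [ENNReal.rpow_two, sq]
  exact mul_le_mul' le_rfl (ENNReal.le_tsum x)

theorem seqNorm_two_mono {a b : ℝ} (hab : a ≤ b) (u : ℤ → ℂ) : seqNorm 2 a u ≤ seqNorm 2 b u := by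
  rw [seqNorm_two, seqNorm_two]
  refine ENNReal.rpow_le_rpow (ENNReal.tsum_le_tsum fun x => ?_) (by norm_num)
  gcongr

theorem seqNorm_add_le {p : ℝ≥0∞} (hp : 1 ≤ p) (a : ℝ) (u v : ℤ → ℂ) :
    seqNorm p a (fun x => u x + v x) ≤ seqNorm p a u + seqNorm p a v := by
  refine le_trans (le_of_eq ?_) (eLpNorm_add_le (Measurable.of_discrete).aestronglyMeasurable
    (Measurable.of_discrete).aestronglyMeasurable hp)
  rw [seqNorm]
  congr 1
  ext x
  simp [mul_add]

theorem enorm_inner_le_tsum (w v : L2Z) : ‖inner ℂ w v‖ₑ ≤ ∑' x : ℤ, ‖w x‖ₑ * ‖v x‖ₑ := by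
  rw [lp.inner_eq_tsum]
  refine enorm_tsum_le_tsum_enorm.trans (ENNReal.tsum_le_tsum fun x => le_of_eq ?_)
  rw [← ofReal_norm, ← ofReal_norm, ← ofReal_norm, ← ENNReal.ofReal_mul (norm_nonneg _)]
  simp [mul_comm]

theorem enorm_inner_le_top_mul_one (w v : L2Z) :
    ‖inner ℂ w v‖ₑ ≤ seqNorm ∞ 0 w * seqNorm 1 0 v := by
  refine (enorm_inner_le_tsum w v).trans ?_
  rw [seqNorm_one_zero, ← ENNReal.tsum_mul_left]
  exact ENNReal.tsum_le_tsum fun x => mul_le_mul' (enorm_apply_le_seqNorm_top w x) le_rfl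

theorem enorm_inner_le_weighted (w v : L2Z) :
    ‖inner ℂ w v‖ₑ ≤ seqNorm 2 (-1) w * seqNorm 2 1 v := by
  refine (enorm_inner_le_tsum w v).trans ?_
  have h := ENNReal.lintegral_mul_le_Lp_mul_Lq (Measure.count : Measure ℤ)
    Real.HolderConjugate.two_two
    (f := fun x : ℤ => ENNReal.ofReal (Real.exp (-1 * |(x : ℝ)|)) * ‖w x‖ₑ)
    (g := fun x : ℤ => ENNReal.ofReal (Real.exp (1 * |(x : ℝ)|)) * ‖v x‖ₑ)
    Measurable.of_discrete.aemeasurable Measurable.of_discrete.aemeasurable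
  simp only [lintegral_count, Pi.mul_apply] at h
  rw [← seqNorm_two, ← seqNorm_two] at h
  refine le_trans (le_of_eq (tsum_congr fun x => ?_)) h
  calc ‖w x‖ₑ * ‖v x‖ₑ = 1 * (‖w x‖ₑ * ‖v x‖ₑ) := (one_mul _).symm
    _ = (ENNReal.ofReal (Real.exp (-1 * |(x : ℝ)|)) * ENNReal.ofReal (Real.exp (1 * |(x : ℝ)|)))
          * (‖w x‖ₑ * ‖v x‖ₑ) := by
        rw [← ENNReal.ofReal_mul (Real.exp_pos _).le, ← Real.exp_add]
        simp
    _ = _ := by ring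

/-- `∑ e^{-|x|}` over the integers. -/
def expSum : ℝ≥0∞ := ∑' x : ℤ, ENNReal.ofReal (Real.exp (-|(x : ℝ)|))

theorem expSum_ne_top : expSum ≠ ∞ := by
  have h : Summable fun x : ℤ => Real.exp (-|(x : ℝ)|) := by
    rw [summable_int_iff_summable_nat_and_neg]
    constructor <;> simpa using Real.summable_exp_neg_nat
  rw [expSum, ← ENNReal.ofReal_tsum_of_nonneg (fun x => (Real.exp_pos _).le) h]
  exact ENNReal.ofReal_ne_top

/-- A sequence bounded by `B e^{|x|/2}` lies in `l²_{-1}`. -/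
theorem seqNorm_neg_one_le {u : ℤ → ℂ} {B : ℝ≥0∞}
    (h : ∀ x, ‖u x‖ₑ ≤ B * ENNReal.ofReal (Real.exp (|(x : ℝ)| / 2))) :
    seqNorm 2 (-1) u ≤ expSum ^ (1 / 2 : ℝ) * B := by
  -- Squaring `e^{-|x|} e^{|x|/2}` leaves exactly the summable `e^{-|x|}`.
  have h1 : ∀ x : ℤ, (ENNReal.ofReal (Real.exp (-1 * |(x : ℝ)|)) * ‖u x‖ₑ) ^ (2 : ℝ)
      ≤ ENNReal.ofReal (Real.exp (-|(x : ℝ)|)) * B ^ (2 : ℝ) := fun x => by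
    have e : ENNReal.ofReal (Real.exp (-|(x : ℝ)|))
        = (ENNReal.ofReal (Real.exp (-1 * |(x : ℝ)|))
          * ENNReal.ofReal (Real.exp (|(x : ℝ)| / 2))) ^ (2 : ℝ) := by
      rw [← ENNReal.ofReal_mul (Real.exp_pos _).le, ENNReal.rpow_two,
        ← ENNReal.ofReal_pow (by positivity), ← Real.exp_add, sq, ← Real.exp_add]
      congr 2
      ring
    rw [e, ← ENNReal.mul_rpow_of_nonneg _ _ zero_le_two]
    refine ENNReal.rpow_le_rpow ?_ zero_le_two
    calc _ ≤ ENNReal.ofReal (Real.exp (-1 * |(x : ℝ)|))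
          * (B * ENNReal.ofReal (Real.exp (|(x : ℝ)| / 2))) := mul_le_mul' le_rfl (h x)
      _ = _ := by ring
  rw [seqNorm_two]
  refine (ENNReal.rpow_le_rpow (ENNReal.tsum_le_tsum h1) (by norm_num)).trans (le_of_eq ?_)
  rw [ENNReal.tsum_mul_right, ENNReal.mul_rpow_of_nonneg _ _ (by norm_num), ← ENNReal.rpow_mul]
  norm_num [expSum]

/-! ### Kernel bounds and homogeneous estimates -/

theorem enorm_flow_unitVec_apply_le (t : ℝ) (x y : ℤ) :
    ‖flow t (unitVec y) x‖ₑ ≤ 34 * rieszKernel t := by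
  -- At `t = 0` the Riesz kernel is `∞`, so nothing has to be shown.
  rcases eq_or_ne t 0 with rfl | ht
  · simp [rieszKernel]
  · have := ENNReal.ofReal_le_ofReal (norm_flow_unitVec_apply_le ht x y)
    rw [ofReal_norm, ENNReal.ofReal_mul (by norm_num),
      ← ENNReal.ofReal_rpow_of_pos (abs_pos.2 ht)] at this
    simpa [rieszKernel] using this

/-- The integrable time decay `(1 + |t|)^{-4/3}`. -/
def decay (t : ℝ) : ℝ≥0∞ := ENNReal.ofReal ((1 + |t|) ^ (-(4 / 3) : ℝ))

theorem measurable_decay : Measurable decay := by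
  unfold decay
  fun_prop

theorem lintegral_decay_ne_top : ∫⁻ t, decay t ≠ ∞ := by
  have h : Integrable fun t : ℝ => (1 + ‖t‖) ^ (-(4 / 3) : ℝ) :=
    integrable_one_add_norm (by norm_num)
  have h2 : ∫⁻ t, decay t = ∫⁻ t : ℝ, ‖(1 + ‖t‖) ^ (-(4 / 3) : ℝ)‖ₑ := by
    refine lintegral_congr fun t => ?_
    rw [← ofReal_norm, Real.norm_of_nonneg (by positivity)]
    rfl
  rw [h2]
  exact h.hasFiniteIntegral.ne

theorem enorm_flow_unitVec_apply_le_decay (t : ℝ) (x y : ℤ) :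
    ‖flow t (unitVec y) x‖ₑ ≤ 69632 * decay t * ENNReal.ofReal (Real.exp (|(x : ℝ)| / 2))
      * ENNReal.ofReal (Real.exp (|(y : ℝ)| / 2)) := by
  have := ENNReal.ofReal_le_ofReal (norm_flow_unitVec_apply_le_exp t x y)
  rw [ofReal_norm, ENNReal.ofReal_mul (by positivity), ENNReal.ofReal_mul (by norm_num),
    ENNReal.ofReal_mul (Real.exp_pos _).le] at this
  refine this.trans (le_of_eq ?_)
  rw [decay, show (272 * 256 : ℝ) = (69632 : ℕ) by norm_num, ENNReal.ofReal_natCast]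
  push_cast
  ring

theorem flow_apply_eq_inner (t : ℝ) (u : L2Z) (x : ℤ) :
    flow t u x = inner ℂ (flow (-t) (unitVec x)) u := by
  rw [inner_flow_left, neg_neg, inner_unitVec]

/-- The `l¹ → l^∞` dispersive estimate. -/
theorem seqNorm_top_flow_le (t : ℝ) (u : L2Z) :
    seqNorm ∞ 0 (flow t u) ≤ 34 * rieszKernel t * seqNorm 1 0 u := by
  rw [seqNorm_top_zero]
  refine iSup_le fun x => ?_
  rw [flow_apply_eq_inner]
  refine (enorm_inner_le_top_mul_one _ _).trans (mul_le_mul' ?_ le_rfl)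
  rw [seqNorm_top_zero]
  refine iSup_le fun y => (enorm_flow_unitVec_apply_le _ _ _).trans (le_of_eq ?_)
  rw [rieszKernel, abs_neg, rieszKernel]

/-- The weighted local decay estimate. -/
theorem enorm_flow_apply_le_decay (t : ℝ) (u : L2Z) (x : ℤ) :
    ‖flow t u x‖ₑ ≤ (69632 * expSum ^ (1 / 2 : ℝ) * (decay t * seqNorm 2 1 u))
      * ENNReal.ofReal (Real.exp (|(x : ℝ)| / 2)) := by
  rw [flow_apply_eq_inner]
  refine (enorm_inner_le_weighted _ _).trans ?_
  have h1 := seqNorm_neg_one_le (u := flow (-t) (unitVec x))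
    (B := 69632 * decay t * ENNReal.ofReal (Real.exp (|(x : ℝ)| / 2))) fun y => by
      refine (enorm_flow_unitVec_apply_le_decay _ _ _).trans (le_of_eq ?_)
      rw [decay, abs_neg, decay]
      ring
  exact (mul_le_mul' h1 le_rfl).trans (le_of_eq (by ring))

theorem inner_flow_unitVec (t : ℝ) (u : L2Z) (x : ℤ) :
    ‖inner ℂ u (flow (-t) (unitVec x))‖ₑ = ‖flow t u x‖ₑ := by
  rw [flow_apply_eq_inner, ← ofReal_norm, ← ofReal_norm, norm_inner_symm]

theorem inner_flow_unitVec_flow_unitVec (s t : ℝ) (x y : ℤ) :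
    inner ℂ (flow (-s) (unitVec x)) (flow (-t) (unitVec y)) = flow (s - t) (unitVec y) x := by
  rw [inner_flow_left, flow_flow, inner_unitVec, neg_neg, sub_eq_add_neg]

theorem continuous_flow_apply {c : ℝ → L2Z} (hc : Continuous c) (x : ℤ) :
    Continuous fun t => flow t (c t) x :=
  (evalAt x).continuous.comp (continuous_flow.clm_apply hc)

theorem measurable_apply_comp {F : ℤ → ℝ → ℝ≥0∞} (hF : ∀ n, Measurable (F n)) {x : ℝ → ℤ}
    (hx : Measurable x) : Measurable fun t => F (x t) t := by
  have h : Measurable fun z : ℝ × ℤ => F z.2 z.1 := measurable_from_prod_countable_left hF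
  exact h.comp (measurable_id.prodMk hx)

theorem measurable_enorm_flow_apply {x : ℝ → ℤ} (hx : Measurable x) (u : L2Z) :
    Measurable fun t => ‖flow t u (x t)‖ₑ := by
  have hF : ∀ n : ℤ, Measurable fun t => ‖flow t u n‖ₑ := fun n =>
    (continuous_flow_apply continuous_const n).measurable.enorm
  exact measurable_apply_comp hF hx

/-- `TT*` for a site that moves measurably in time. The dispersive bound is uniform in both sites,
so the Gram kernel is dominated by the Riesz kernel whatever the path; letting the path follow the
largest entry recovers the `l^∞` norm. -/
theorem lpNorm_six_flow_apply_le {x : ℝ → ℤ} (hx : Measurable x) (u : L2Z) :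
    lpNorm 6 (fun t => ‖flow t u (x t)‖ₑ) ≤ 19 * ‖u‖ₑ := by
  have hψ : StronglyMeasurable fun t => flow (-t) (unitVec (x t)) := by
    have h1 : StronglyMeasurable fun t => unitVec (x t) :=
      (StronglyMeasurable.of_discrete (f := unitVec)).comp_measurable hx
    have h2 : StronglyMeasurable fun t => flow (-t) :=
      (continuous_flow.comp continuous_neg).stronglyMeasurable
    exact isBoundedBilinearMap_apply.continuous.comp_stronglyMeasurable (h2.prodMk h1)
  have := lpNorm_inner_le holderConjugate_six hψ
    (fun t => (norm_flow_le _ _).trans (norm_unitVec _).le)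
    (k := fun s t => 34 * rieszKernel (t - s)) (fun s t => by
      rw [inner_flow_unitVec_flow_unitVec]
      refine (enorm_flow_unitVec_apply_le _ _ _).trans (le_of_eq ?_)
      rw [rieszKernel, rieszKernel, abs_sub_comm]) (C := 19) (fun g hg hgt => by
      calc ∫⁻ s, ∫⁻ t, 34 * rieszKernel (t - s) * g s * g t
          = 34 * ∫⁻ s, ∫⁻ t, rieszKernel (t - s) * g s * g t := by
            rw [← lintegral_const_mul' _ _ (by simp)]
            refine lintegral_congr fun s => ?_
            rw [← lintegral_const_mul' _ _ (by simp)]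
            refine lintegral_congr fun t => by ring
        _ ≤ 34 * (10 * lpNorm (6 / 5) g * lpNorm (6 / 5) g) := by
            gcongr
            exact lintegral_rieszKernel_mul_mul_le hg hg hgt hgt
        _ = 340 * (lpNorm (6 / 5) g) ^ 2 := by ring
        -- The dispersive constant `34` times the constant `10` is rounded up to `19²`.
        _ ≤ 361 * (lpNorm (6 / 5) g) ^ 2 := by gcongr; norm_num
        _ = _ := by rw [mul_pow]; norm_num) u
  simp only [inner_flow_unitVec] at this
  exact this

/-- The homogeneous Strichartz estimate. -/
theorem lpNorm_six_flow_le (u : L2Z) :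
    lpNorm 6 (fun t => seqNorm ∞ 0 (flow t u)) ≤ 19 * ‖u‖ₑ := by
  obtain ⟨e⟩ : Nonempty (ℕ ≃ ℤ) := ⟨Equiv.intEquivNat.symm⟩
  -- A measurable choice of a site whose entry dominates those at the first `n + 1` sites of the
  -- enumeration; the supremum over `ℤ` is then reached through Fatou's lemma.
  have hsel : ∀ n : ℕ, ∃ x : ℝ → ℤ, Measurable x ∧
      ∀ k ≤ n, ∀ t, ‖flow t u (e k)‖ₑ ≤ ‖flow t u (x t)‖ₑ := by
    intro n
    induction n with
    | zero => exact ⟨fun _ => e 0, measurable_const, fun k hk t => by rw [Nat.le_zero.1 hk]⟩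
    | succ n ih =>
      obtain ⟨x, hx, hk⟩ := ih
      have hm := measurable_enorm_flow_apply hx u
      refine ⟨fun t => if ‖flow t u (x t)‖ₑ ≤ ‖flow t u (e (n + 1))‖ₑ then e (n + 1) else x t,
        Measurable.ite (measurableSet_le hm
          (continuous_flow_apply continuous_const _).measurable.enorm) measurable_const hx, ?_⟩
      intro k hkn t
      rcases Nat.le_succ_iff.1 hkn with h | h
      · have := hk k h t
        beta_reduce
        split_ifs with h'
        · exact this.trans h'
        · exact this
      · subst h
        beta_reduce
        split_ifs with h'
        · exact le_rfl
        · exact (not_le.1 h').le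
  choose x hx hk using hsel
  have hlim : ∀ t, seqNorm ∞ 0 (flow t u) ^ (6 : ℝ)
      ≤ Filter.liminf (fun n => ‖flow t u (x n t)‖ₑ ^ (6 : ℝ)) Filter.atTop := by
    intro t
    rw [← ENNReal.le_rpow_inv_iff (by norm_num), seqNorm_top_zero]
    refine iSup_le fun y => ?_
    rw [ENNReal.le_rpow_inv_iff (by norm_num)]
    refine Filter.le_liminf_of_le (by isBoundedDefault) ?_
    filter_upwards [Filter.eventually_ge_atTop (e.symm y)] with n hn
    have := hk n _ hn t
    rw [e.apply_symm_apply] at this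
    exact ENNReal.rpow_le_rpow this (by norm_num)
  have hmeas : ∀ n, Measurable fun t => ‖flow t u (x n t)‖ₑ ^ (6 : ℝ) := fun n =>
    (measurable_enorm_flow_apply (hx n) u).pow_const _
  have hfin : ∫⁻ t, seqNorm ∞ 0 (flow t u) ^ (6 : ℝ) ≤ (19 * ‖u‖ₑ) ^ (6 : ℝ) := by
    refine (lintegral_mono hlim).trans ((lintegral_liminf_le hmeas).trans ?_)
    refine Filter.liminf_le_of_frequently_le' (Filter.Frequently.of_forall fun n => ?_)
    rw [← lpNorm_rpow (by norm_num)]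
    exact ENNReal.rpow_le_rpow (lpNorm_six_flow_apply_le (hx n) u) (by norm_num)
  rw [lpNorm, one_div]
  exact (ENNReal.rpow_inv_le_iff (by norm_num)).2 hfin

/-- The constant in the Kato smoothing estimate. -/
def katoConst : ℝ≥0 := (69632 * expSum * ∫⁻ t, decay t).toNNReal

theorem coe_katoConst : (katoConst : ℝ≥0∞) = 69632 * expSum * ∫⁻ t, decay t :=
  ENNReal.coe_toNNReal
    (ENNReal.mul_ne_top (ENNReal.mul_ne_top (by simp) expSum_ne_top) lintegral_decay_ne_top)

/-- The homogeneous Kato smoothing estimate at a fixed site. -/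
theorem lpNorm_two_flow_apply_le (x : ℤ) (u : L2Z) :
    lpNorm 2 (fun t => ‖flow t u x‖ₑ)
      ≤ ((69632 * ∫⁻ t, decay t).toNNReal : ℝ≥0∞) ^ (1 / 2 : ℝ)
        * ENNReal.ofReal (Real.exp (|(x : ℝ)| / 2)) * ‖u‖ₑ := by
  set M : ℝ≥0 := (69632 * ∫⁻ t, decay t).toNNReal with hM
  have hMc : (M : ℝ≥0∞) = 69632 * ∫⁻ t, decay t :=
    ENNReal.coe_toNNReal (ENNReal.mul_ne_top (by simp) lintegral_decay_ne_top)
  set E : ℝ≥0 := Real.toNNReal (Real.exp (|(x : ℝ)| / 2)) with hE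
  have hEc : (E : ℝ≥0∞) = ENNReal.ofReal (Real.exp (|(x : ℝ)| / 2)) := rfl
  have hψ : StronglyMeasurable fun t => flow (-t) (unitVec x) :=
    ((continuous_flow.comp continuous_neg).clm_apply continuous_const).stronglyMeasurable
  have hsq : (((M ^ (1 / 2 : ℝ) * E : ℝ≥0) : ℝ≥0∞)) ^ 2 = M * E ^ 2 := by
    rw [ENNReal.coe_mul, mul_pow, ENNReal.coe_rpow_of_nonneg _ (by norm_num),
      ← ENNReal.rpow_natCast, ← ENNReal.rpow_mul]
    norm_num
  have := lpNorm_inner_le Real.HolderConjugate.two_two hψ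
    (fun t => (norm_flow_le _ _).trans (norm_unitVec _).le)
    (k := fun s t => 69632 * decay (s - t) * E ^ 2) (fun s t => by
      rw [inner_flow_unitVec_flow_unitVec]
      refine (enorm_flow_unitVec_apply_le_decay _ _ _).trans (le_of_eq ?_)
      rw [hEc]
      ring) (C := M ^ (1 / 2 : ℝ) * E) (fun g hg hgt => by
      calc ∫⁻ s, ∫⁻ t, 69632 * decay (s - t) * E ^ 2 * g s * g t
          = 69632 * E ^ 2 * ∫⁻ s, ∫⁻ t, decay (s - t) * g t * g s := by
            have hne : (69632 : ℝ≥0∞) * (E : ℝ≥0∞) ^ 2 ≠ ∞ :=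
              ENNReal.mul_ne_top (by simp) (by simp)
            rw [← lintegral_const_mul' _ _ hne]
            refine lintegral_congr fun s => ?_
            rw [← lintegral_const_mul' _ _ hne]
            refine lintegral_congr fun t => by ring
        _ ≤ 69632 * E ^ 2 * ((∫⁻ t, decay t) * lpNorm 2 g * lpNorm 2 g) := by
            gcongr
            exact lintegral_mul_mul_le measurable_decay hg hg
        _ = (M * E ^ 2) * (lpNorm 2 g) ^ 2 := by rw [hMc]; ring
        _ = _ := by rw [mul_pow, hsq]) u
  simp only [inner_flow_unitVec] at this
  rw [ENNReal.coe_mul, ENNReal.coe_rpow_of_nonneg _ (by norm_num), hEc] at this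
  exact this

/-- The homogeneous Kato smoothing estimate. -/
theorem lpNorm_two_flow_le (u : L2Z) :
    lpNorm 2 (fun t => seqNorm 2 (-1) (flow t u)) ≤ (katoConst : ℝ≥0∞) ^ (1 / 2 : ℝ) * ‖u‖ₑ := by
  set M : ℝ≥0∞ := ((69632 * ∫⁻ t, decay t).toNNReal : ℝ≥0∞) with hM
  have hMc : M = 69632 * ∫⁻ t, decay t :=
    ENNReal.coe_toNNReal (ENNReal.mul_ne_top (by simp) lintegral_decay_ne_top)
  -- The fixed-site estimate grows like `e^{|x|/2}`; after weighting and squaring, `e^{-|x|}`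
  -- remains to be summed over the sites.
  have h1 : ∀ x : ℤ, ∫⁻ t, (ENNReal.ofReal (Real.exp (-1 * |(x : ℝ)|)) * ‖flow t u x‖ₑ) ^ (2 : ℝ)
      ≤ ENNReal.ofReal (Real.exp (-|(x : ℝ)|)) * (M * ‖u‖ₑ ^ (2 : ℝ)) := fun x => by
    rw [← lpNorm_rpow (by norm_num), lpNorm_const_mul (by norm_num) (by simp)]
    calc _ ≤ (ENNReal.ofReal (Real.exp (-1 * |(x : ℝ)|)) * (M ^ (1 / 2 : ℝ)
          * ENNReal.ofReal (Real.exp (|(x : ℝ)| / 2)) * ‖u‖ₑ)) ^ (2 : ℝ) := by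
          refine ENNReal.rpow_le_rpow (mul_le_mul' le_rfl (lpNorm_two_flow_apply_le x u))
            (by norm_num)
      _ = (ENNReal.ofReal (Real.exp (-1 * |(x : ℝ)|))
          * ENNReal.ofReal (Real.exp (|(x : ℝ)| / 2))) ^ (2 : ℝ) *
            ((M ^ (1 / 2 : ℝ)) ^ (2 : ℝ) * ‖u‖ₑ ^ (2 : ℝ)) := by
          rw [← ENNReal.mul_rpow_of_nonneg _ _ zero_le_two,
            ← ENNReal.mul_rpow_of_nonneg _ _ zero_le_two]
          congr 1
          ring
      _ = _ := by
          rw [← ENNReal.rpow_mul, ← ENNReal.ofReal_mul (Real.exp_pos _).le, ENNReal.rpow_two,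
            ← ENNReal.ofReal_pow (by positivity), ← Real.exp_add, sq (Real.exp _),
            ← Real.exp_add]
          congr 3
          · ring
          · norm_num
  have h2 : ∫⁻ t, seqNorm 2 (-1) (flow t u) ^ (2 : ℝ) ≤ katoConst * ‖u‖ₑ ^ (2 : ℝ) := by
    simp_rw [seqNorm_two, ← ENNReal.rpow_mul]
    norm_num only [ENNReal.rpow_one]
    rw [lintegral_tsum fun x => ?_]
    · refine (ENNReal.tsum_le_tsum h1).trans (le_of_eq ?_)
      rw [ENNReal.tsum_mul_right, coe_katoConst, hMc, expSum]
      ring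
    · exact (((continuous_flow_apply continuous_const x).measurable.enorm.const_mul _).pow_const
        _).aemeasurable
  rw [lpNorm]
  refine (ENNReal.rpow_le_rpow h2 (by norm_num)).trans (le_of_eq ?_)
  rw [ENNReal.mul_rpow_of_nonneg _ _ (by norm_num), ← ENNReal.rpow_mul]
  norm_num

theorem setLIntegral_Ioc_le_add (F : ℝ → ℝ≥0∞) {a b c : ℝ} (hac : a ≤ c) (hcb : c ≤ b) :
    ∫⁻ t in Set.Ioc a b, F t ≤ (∫⁻ t in Set.Ioc a c, F t) + ∫⁻ t in Set.Ioc c b, F t := by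
  rw [← Set.Ioc_union_Ioc_eq_Ioc hac hcb]
  exact lintegral_union_le _ _ _

/-! ### The Christ-Kiselev lemma -/

section ChristKiselev

variable {H : Type*} [NormedAddCommGroup H] [NormedSpace ℝ H]

/-- One bisection step: the constant `A` of the causal estimate on intervals of length at most `T`
improves to `4/5 (A + C)`. -/
theorem causal_estimate_bisect {Φ : ℝ → H → ℝ≥0∞}
    (hadd : ∀ t v w, Φ t (v + w) ≤ Φ t v + Φ t w)
    (hmeas : ∀ c : ℝ → H, Continuous c → Measurable fun t => Φ t (c t))
    {C₁ C₂ : ℝ} (hC₁ : 0 ≤ C₁) (hC₂ : 0 ≤ C₂)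
    (hΦ : ∀ w, lpNorm 6 (fun t => Φ t w) ≤ ENNReal.ofReal C₁ * ‖w‖ₑ)
    {W : ℝ → H} (hW : ∀ a b, IntervalIntegrable W volume a b)
    {ν : ℝ → ℝ} (hν0 : ∀ t, 0 ≤ ν t) (hν : ∀ a b, IntervalIntegrable ν volume a b)
    (hT : ∀ a b, a ≤ b → ‖∫ s in a..b, W s‖ ≤ C₂ * √(∫ s in a..b, ν s))
    {T A : ℝ} (hA : 0 ≤ A)
    (h : ∀ a b, a ≤ b → b - a ≤ T → ∫⁻ t in Set.Ioc a b, Φ t (∫ s in a..t, W s) ^ (6 : ℝ)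
      ≤ ENNReal.ofReal (A * √(∫ s in a..b, ν s)) ^ (6 : ℝ)) {a b : ℝ} (hab : a ≤ b)
    (hT' : b - a ≤ T) : ∫⁻ t in Set.Ioc a b, Φ t (∫ s in a..t, W s) ^ (6 : ℝ)
      ≤ ENNReal.ofReal (4 / 5 * (A + C₁ * C₂) * √(∫ s in a..b, ν s)) ^ (6 : ℝ) := by
  set M := ∫ s in a..b, ν s with hM
  have hM0 : 0 ≤ M := intervalIntegral.integral_nonneg hab fun s _ => hν0 s
  -- The cut is placed where the mass of `ν` is halved, not at the midpoint in time.
  obtain ⟨c, ⟨hac, hcb⟩, hc⟩ : M / 2 ∈ (fun c => ∫ s in a..c, ν s) '' Set.Icc a b := by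
    refine intermediate_value_Icc hab (intervalIntegral.continuous_primitive hν a).continuousOn ?_
    rw [intervalIntegral.integral_same, ← hM]
    constructor <;> linarith
  beta_reduce at hc
  have hc' : ∫ s in c..b, ν s = M / 2 := by
    have := intervalIntegral.integral_add_adjacent_intervals (hν a c) (hν c b)
    rw [hc, ← hM] at this
    linarith
  set m := √(M / 2) with hm
  have hm0 : 0 ≤ m := Real.sqrt_nonneg _
  have hcont : ∀ a, Continuous fun t => ∫ s in a..t, W s := fun a =>
    intervalIntegral.continuous_primitive hW a
  have h1 := h a c hac (by linarith)
  rw [hc] at h1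
  have h2 := h c b hcb (by linarith)
  rw [hc'] at h2
  set w := ∫ s in a..c, W s with hw
  have hwle : ENNReal.ofReal C₁ * ‖w‖ₑ ≤ ENNReal.ofReal (C₁ * C₂ * m) := by
    have := hT a c hac
    rw [hc] at this
    rw [← ofReal_norm, ← ENNReal.ofReal_mul hC₁, mul_assoc]
    exact ENNReal.ofReal_le_ofReal (mul_le_mul_of_nonneg_left this hC₁)
  -- After the cut the primitive is the fixed vector `w`, controlled by the noncausal bounds `C₁`
  -- and `C₂`, plus a causal integral starting at `c`.
  have h3 : ∫⁻ t in Set.Ioc c b, Φ t (∫ s in a..t, W s) ^ (6 : ℝ)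
      ≤ ENNReal.ofReal ((A + C₁ * C₂) * m) ^ (6 : ℝ) := by
    have hmink := ENNReal.lintegral_Lp_add_le (μ := volume.restrict (Set.Ioc c b))
      (hmeas (fun _ => w) continuous_const).aemeasurable
      (hmeas (fun t => ∫ s in c..t, W s) (hcont c)).aemeasurable
      (p := 6) (by norm_num)
    have hle1 : (∫⁻ t in Set.Ioc c b, Φ t w ^ (6 : ℝ)) ^ (1 / 6 : ℝ)
        ≤ ENNReal.ofReal (C₁ * C₂ * m) := by
      refine le_trans ?_ ((hΦ w).trans hwle)
      exact ENNReal.rpow_le_rpow (setLIntegral_le_lintegral _ _) (by norm_num)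
    have hle2 : (∫⁻ t in Set.Ioc c b, Φ t (∫ s in c..t, W s) ^ (6 : ℝ)) ^ (1 / 6 : ℝ)
        ≤ ENNReal.ofReal (A * m) := by
      rw [one_div, ENNReal.rpow_inv_le_iff (by norm_num)]
      exact h2
    have hsum := hmink.trans (add_le_add hle1 hle2)
    rw [← ENNReal.ofReal_add (by positivity) (by positivity), one_div,
      ENNReal.rpow_inv_le_iff (by norm_num)] at hsum
    refine le_trans ?_ (hsum.trans (le_of_eq ?_))
    · refine lintegral_mono fun t => ENNReal.rpow_le_rpow ?_ (by norm_num)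
      rw [← intervalIntegral.integral_add_adjacent_intervals (hW a c) (hW c t)]
      exact hadd _ _ _
    · congr 2
      ring
  refine (setLIntegral_Ioc_le_add _ hac hcb).trans ((add_le_add h1 h3).trans ?_)
  have h6 : ∀ x : ℝ, 0 ≤ x → ENNReal.ofReal x ^ (6 : ℝ) = ENNReal.ofReal (x ^ 6) := fun x hx => by
    rw [ENNReal.ofReal_rpow_of_nonneg hx (by norm_num)]
    norm_cast
  have hm6 : m ^ 6 = (M / 2) ^ 3 := by
    rw [show m ^ 6 = (m ^ 2) ^ 3 by ring, hm, Real.sq_sqrt (by positivity)]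
  have hM6 : √M ^ 6 = M ^ 3 := by
    rw [show √M ^ 6 = (√M ^ 2) ^ 3 by ring, Real.sq_sqrt hM0]
  rw [h6 _ (by positivity), h6 _ (by positivity), h6 _ (by positivity),
    ← ENNReal.ofReal_add (by positivity) (by positivity)]
  refine ENNReal.ofReal_le_ofReal ?_
  rw [mul_pow, mul_pow, mul_pow, mul_pow, hm6, hM6]
  have hAC : A ^ 6 ≤ (A + C₁ * C₂) ^ 6 :=
    pow_le_pow_left₀ hA (le_add_of_nonneg_right (by positivity)) 6
  have hM3 : 0 ≤ M ^ 3 := by positivity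
  have hAC0 : 0 ≤ (A + C₁ * C₂) ^ 6 := by positivity
  -- The two halves give at most `2 · (1/2)³ = 1/4` times `(A + C₁C₂)⁶ M³`, and `1/4 ≤ (4/5)⁶`. The
  -- gain is due to the output exponent `6` exceeding the input exponent `2`.
  nlinarith [mul_le_mul_of_nonneg_right hAC hM3, mul_nonneg hAC0 hM3]

/-- The Christ-Kiselev lemma on bounded intervals, by iterated bisection. -/
theorem causal_estimate_Ioc {Φ : ℝ → H → ℝ≥0∞}
    (hadd : ∀ t v w, Φ t (v + w) ≤ Φ t v + Φ t w) (hle : ∀ t w, Φ t w ≤ ‖w‖ₑ)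
    (hmeas : ∀ c : ℝ → H, Continuous c → Measurable fun t => Φ t (c t))
    {C₁ C₂ : ℝ} (hC₁ : 0 < C₁) (hC₂ : 0 < C₂)
    (hΦ : ∀ w, lpNorm 6 (fun t => Φ t w) ≤ ENNReal.ofReal C₁ * ‖w‖ₑ)
    {W : ℝ → H} (hW : ∀ a b, IntervalIntegrable W volume a b)
    {ν : ℝ → ℝ} (hν0 : ∀ t, 0 ≤ ν t) (hν : ∀ a b, IntervalIntegrable ν volume a b)
    (hT : ∀ a b, a ≤ b → ‖∫ s in a..b, W s‖ ≤ C₂ * √(∫ s in a..b, ν s))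
    {a b : ℝ} (hab : a ≤ b) : ∫⁻ t in Set.Ioc a b, Φ t (∫ s in a..t, W s) ^ (6 : ℝ)
      ≤ ENNReal.ofReal (5 * (C₁ * C₂) * √(∫ s in a..b, ν s)) ^ (6 : ℝ) := by
  set T := b - a with hTdef
  have hT0 : 0 ≤ T := sub_nonneg.2 hab
  set C := C₁ * C₂ with hC
  have hC0 : 0 < C := mul_pos hC₁ hC₂
  -- A crude starting constant, finite because the interval is bounded and `Φ` is dominated by the
  -- norm. Its dependence on `T` disappears in the iteration.
  set A₀ : ℝ := (T + 1) * C₂ with hA₀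
  have hA₀0 : 0 ≤ A₀ := by positivity
  have hbase : ∀ a b, a ≤ b → b - a ≤ T → ∫⁻ t in Set.Ioc a b, Φ t (∫ s in a..t, W s) ^ (6 : ℝ)
      ≤ ENNReal.ofReal (A₀ * √(∫ s in a..b, ν s)) ^ (6 : ℝ) := by
    intro a b hab hT'
    have hpt : ∀ t ∈ Set.Ioc a b, Φ t (∫ s in a..t, W s) ^ (6 : ℝ)
        ≤ ENNReal.ofReal (C₂ * √(∫ s in a..b, ν s)) ^ (6 : ℝ) := fun t ht => by
      refine ENNReal.rpow_le_rpow ((hle _ _).trans ?_) (by norm_num)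
      rw [← ofReal_norm]
      refine ENNReal.ofReal_le_ofReal ((hT a t ht.1.le).trans ?_)
      have hmono : ∫ s in a..t, ν s ≤ ∫ s in a..b, ν s := by
        have h1 := intervalIntegral.integral_add_adjacent_intervals (hν a t) (hν t b)
        have h2 : 0 ≤ ∫ s in t..b, ν s :=
          intervalIntegral.integral_nonneg ht.2 fun s _ => hν0 s
        linarith
      gcongr
    calc ∫⁻ t in Set.Ioc a b, Φ t (∫ s in a..t, W s) ^ (6 : ℝ)
        ≤ ∫⁻ t in Set.Ioc a b, ENNReal.ofReal (C₂ * √(∫ s in a..b, ν s)) ^ (6 : ℝ) :=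
          setLIntegral_mono measurable_const hpt
      _ = ENNReal.ofReal (C₂ * √(∫ s in a..b, ν s)) ^ (6 : ℝ) * ENNReal.ofReal (b - a) := by
          rw [setLIntegral_const, Real.volume_Ioc]
      _ ≤ ENNReal.ofReal (C₂ * √(∫ s in a..b, ν s)) ^ (6 : ℝ)
          * ENNReal.ofReal (T + 1) ^ (6 : ℝ) := by
          gcongr
          refine (ENNReal.ofReal_le_ofReal (show b - a ≤ T + 1 by linarith)).trans ?_
          conv_lhs => rw [← ENNReal.rpow_one (ENNReal.ofReal (T + 1))]
          refine ENNReal.rpow_le_rpow_of_exponent_le ?_ (by norm_num)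
          rw [← ENNReal.ofReal_one]
          exact ENNReal.ofReal_le_ofReal (by linarith)
      _ = _ := by
          rw [← ENNReal.mul_rpow_of_nonneg _ _ (by norm_num), ← ENNReal.ofReal_mul (by positivity)]
          congr 2
          rw [hA₀]
          ring
  -- The map `A ↦ 4/5 (A + C)` contracts towards its fixed point `4 C`.
  have hiter : ∀ n : ℕ, ∀ a b, a ≤ b → b - a ≤ T →
      ∫⁻ t in Set.Ioc a b, Φ t (∫ s in a..t, W s) ^ (6 : ℝ)
      ≤ ENNReal.ofReal (((4 / 5) ^ n * A₀ + 4 * C) * √(∫ s in a..b, ν s)) ^ (6 : ℝ) := by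
    intro n
    induction n with
    | zero =>
      intro a b hab hT'
      refine (hbase a b hab hT').trans ?_
      gcongr
      linarith
    | succ n ih =>
      intro a b hab hT'
      refine (causal_estimate_bisect hadd hmeas hC₁.le hC₂.le hΦ hW hν0 hν hT (by positivity) ih
        hab hT').trans (le_of_eq ?_)
      congr 3
      rw [← hC]
      ring
  obtain ⟨n, hn⟩ : ∃ n : ℕ, (4 / 5 : ℝ) ^ n < C / (A₀ + 1) :=
    exists_pow_lt_of_lt_one (by positivity) (by norm_num)
  refine (hiter n a b hab le_rfl).trans ?_
  have : (4 / 5 : ℝ) ^ n * A₀ ≤ C := by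
    rw [lt_div_iff₀ (by positivity)] at hn
    have : (0 : ℝ) ≤ (4 / 5) ^ n := by positivity
    nlinarith
  gcongr
  linarith

/-- Monotone limit of the bounded intervals, whose constant does not depend on their length. -/
theorem causal_estimate_Ioi {Φ : ℝ → H → ℝ≥0∞}
    (hadd : ∀ t v w, Φ t (v + w) ≤ Φ t v + Φ t w) (hle : ∀ t w, Φ t w ≤ ‖w‖ₑ)
    (hmeas : ∀ c : ℝ → H, Continuous c → Measurable fun t => Φ t (c t))
    {C₁ C₂ : ℝ} (hC₁ : 0 < C₁) (hC₂ : 0 < C₂)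
    (hΦ : ∀ w, lpNorm 6 (fun t => Φ t w) ≤ ENNReal.ofReal C₁ * ‖w‖ₑ)
    {W : ℝ → H} (hW : ∀ a b, IntervalIntegrable W volume a b)
    {ν : ℝ → ℝ} (hν0 : ∀ t, 0 ≤ ν t) (hν : Integrable ν)
    (hT : ∀ a b, a ≤ b → ‖∫ s in a..b, W s‖ ≤ C₂ * √(∫ s in a..b, ν s)) :
    ∫⁻ t in Set.Ioi 0, Φ t (∫ s in 0..t, W s) ^ (6 : ℝ)
      ≤ ENNReal.ofReal (5 * (C₁ * C₂) * √(∫ s, ν s)) ^ (6 : ℝ) := by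
  have hU : Set.Ioi (0 : ℝ) = ⋃ n : ℕ, Set.Ioc (0 : ℝ) n := by
    ext t
    simp only [Set.mem_Ioi, Set.mem_iUnion, Set.mem_Ioc]
    exact ⟨fun h => (exists_nat_ge t).imp fun n hn => ⟨h, hn⟩, fun ⟨n, h⟩ => h.1⟩
  rw [hU, setLIntegral_iUnion_of_directed]
  · refine iSup_le fun n => ?_
    have hn : (0 : ℝ) ≤ n := Nat.cast_nonneg n
    refine (causal_estimate_Ioc hadd hle hmeas hC₁ hC₂ hΦ hW hν0
      (fun a b => hν.intervalIntegrable) hT hn).trans ?_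
    have : ∫ s in (0 : ℝ)..n, ν s ≤ ∫ s, ν s := by
      rw [intervalIntegral.integral_of_le hn]
      exact setIntegral_le_integral hν (Filter.Eventually.of_forall hν0)
    gcongr
  · refine Monotone.directed_le fun m n hmn => ?_
    exact Set.Ioc_subset_Ioc_right (by exact_mod_cast hmn)

/-- The Christ-Kiselev lemma, for `L² → L⁶`. -/
theorem lpNorm_causal_le {Φ : ℝ → H → ℝ≥0∞}
    (hadd : ∀ t v w, Φ t (v + w) ≤ Φ t v + Φ t w) (hle : ∀ t w, Φ t w ≤ ‖w‖ₑ)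
    (hmeas : ∀ c : ℝ → H, Continuous c → Measurable fun t => Φ t (c t))
    {C₁ C₂ : ℝ} (hC₁ : 0 < C₁) (hC₂ : 0 < C₂)
    (hΦ : ∀ w, lpNorm 6 (fun t => Φ t w) ≤ ENNReal.ofReal C₁ * ‖w‖ₑ)
    {W : ℝ → H} (hW : ∀ a b, IntervalIntegrable W volume a b)
    {ν : ℝ → ℝ} (hν0 : ∀ t, 0 ≤ ν t) (hν : Integrable ν)
    (hT : ∀ a b, a ≤ b → ‖∫ s in a..b, W s‖ ≤ C₂ * √(∫ s in a..b, ν s)) :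
    lpNorm 6 (fun t => Φ t (∫ s in 0..t, W s))
      ≤ ENNReal.ofReal (10 * (C₁ * C₂) * √(∫ s, ν s)) := by
  have hcont : Continuous fun t => ∫ s in (0 : ℝ)..t, W s :=
    intervalIntegral.continuous_primitive hW 0
  have hpos := causal_estimate_Ioi hadd hle hmeas hC₁ hC₂ hΦ hW hν0 hν hT
  -- Negative times are reduced to positive ones by reflection.
  have hint : ∀ t : ℝ, ∫ s in (0 : ℝ)..t, -W (-s) = ∫ s in (0 : ℝ)..(-t), W s := fun t => by
    rw [intervalIntegral.integral_neg, intervalIntegral.integral_comp_neg, neg_zero,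
      intervalIntegral.integral_symm, neg_neg]
  have hneg := causal_estimate_Ioi (Φ := fun t => Φ (-t)) (fun t => hadd (-t)) (fun t => hle (-t))
    (fun c hc => by
      have := (hmeas (fun t => c (-t)) (hc.comp continuous_neg)).comp measurable_neg
      simpa [Function.comp_def] using this) hC₁ hC₂
    (fun w => by
      refine le_trans (le_of_eq ?_) (hΦ w)
      have := (Measure.measurePreserving_neg (volume : Measure ℝ)).lintegral_comp
        ((hmeas (fun _ => w) continuous_const).pow_const (6 : ℝ))
      rw [lpNorm, lpNorm, this])
    (W := fun s => -W (-s)) (fun a b => by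
      have := ((hW (-a) (-b)).comp_sub_left 0).neg
      simpa [Pi.neg_def] using this)
    (ν := fun s => ν (-s)) (fun t => hν0 _) hν.comp_neg
    (fun a b hab => by
      rw [intervalIntegral.integral_neg, norm_neg, intervalIntegral.integral_comp_neg,
        intervalIntegral.integral_comp_neg]
      exact hT _ _ (neg_le_neg hab))
  rw [integral_neg_eq_self] at hneg
  simp_rw [hint] at hneg
  have hrefl : ∫⁻ t in Set.Iio 0, Φ t (∫ s in (0 : ℝ)..t, W s) ^ (6 : ℝ)
      = ∫⁻ t in Set.Ioi 0, Φ (-t) (∫ s in (0 : ℝ)..(-t), W s) ^ (6 : ℝ) := by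
    have h := (Measure.measurePreserving_neg (volume : Measure ℝ)).setLIntegral_comp_preimage
      (measurableSet_Iio (a := (0 : ℝ))) ((hmeas _ hcont).pow_const (6 : ℝ))
    rw [← h]
    have : (Neg.neg ⁻¹' Set.Iio (0 : ℝ)) = Set.Ioi 0 := by ext; simp
    rw [this]
  have hsplit : ∫⁻ t, Φ t (∫ s in (0 : ℝ)..t, W s) ^ (6 : ℝ)
      ≤ ENNReal.ofReal (10 * (C₁ * C₂) * √(∫ s, ν s)) ^ (6 : ℝ) := by
    rw [← lintegral_add_compl _ (measurableSet_Ioi (a := (0 : ℝ))), Set.compl_Ioi,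
      ← setLIntegral_congr (Iio_ae_eq_Iic (a := (0 : ℝ))), hrefl]
    refine (add_le_add hpos hneg).trans ?_
    set X := ENNReal.ofReal (5 * (C₁ * C₂) * √(∫ s, ν s)) with hX
    have e : ENNReal.ofReal (10 * (C₁ * C₂) * √(∫ s, ν s)) = 2 * X := by
      rw [hX, ← ENNReal.ofReal_ofNat 2, ← ENNReal.ofReal_mul (by norm_num)]
      congr 1
      ring
    rw [e, ENNReal.mul_rpow_of_nonneg _ _ (by norm_num), ← two_mul]
    gcongr
    conv_lhs => rw [← ENNReal.rpow_one 2]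
    exact ENNReal.rpow_le_rpow_of_exponent_le (by norm_num) (by norm_num)
  rw [lpNorm, one_div]
  exact (ENNReal.rpow_inv_le_iff (by norm_num)).2 hsplit

end ChristKiselev

/-! ### Measurability -/

section Measurability

variable {α : Type*} [MeasurableSpace α] {u : α → ℤ → ℂ}

theorem measurable_seqNorm_two (a : ℝ) (hu : ∀ x, Measurable fun t => u t x) :
    Measurable fun t => seqNorm 2 a (u t) := by
  simp_rw [seqNorm_two]
  exact (Measurable.tsum fun x => ((hu x).enorm.const_mul _).pow_const _).pow_const _

theorem measurable_seqNorm_one (hu : ∀ x, Measurable fun t => u t x) :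
    Measurable fun t => seqNorm 1 0 (u t) := by
  simp_rw [seqNorm_one_zero]
  exact Measurable.tsum fun x => (hu x).enorm

theorem measurable_seqNorm_top (hu : ∀ x, Measurable fun t => u t x) :
    Measurable fun t => seqNorm ∞ 0 (u t) := by
  simp_rw [seqNorm_top_zero]
  exact Measurable.iSup fun x => (hu x).enorm

end Measurability

theorem measurable_coord {α : Type*} [MeasurableSpace α] {V : α → L2Z}
    (hV : StronglyMeasurable V) (x : ℤ) : Measurable fun t => V t x :=
  ((evalAt x).continuous.comp_stronglyMeasurable hV).measurable

theorem stronglyMeasurable_flow {α : Type*} [MeasurableSpace α] {V : α → L2Z} {r : α → ℝ}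
    (hr : Measurable r) (hV : StronglyMeasurable V) :
    StronglyMeasurable fun z => flow (r z) (V z) := by
  have h := continuous_flow.comp_stronglyMeasurable hr.stronglyMeasurable
  exact isBoundedBilinearMap_apply.continuous.comp_stronglyMeasurable (h.prodMk hV)

/-! ### The Duhamel integral on the line -/

/-- The Duhamel integral `∫₀ᵗ e^{i(t-s)Δ₀} P₀^⊥ V(s) ds`. -/
def duh (V : ℝ → L2Z) (t : ℝ) : L2Z := ∫ s in (0 : ℝ)..t, flow (t - s) (V s)

theorem intervalIntegrable_flow {V : ℝ → L2Z} (hV : StronglyMeasurable V)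
    (hi : ∀ a b, IntervalIntegrable V volume a b) {r : ℝ → ℝ} (hr : Measurable r) (a b : ℝ) :
    IntervalIntegrable (fun s => flow (r s) (V s)) volume a b :=
  (hi a b).norm.mono_fun' (stronglyMeasurable_flow hr hV).aestronglyMeasurable
    (Filter.Eventually.of_forall fun _ => norm_flow_le _ _)

/-- The group law moves the dependence on `t` out of the integrand. What remains is a primitive, the
form to which both duality and the Christ-Kiselev lemma apply. -/
theorem duh_eq_flow {V : ℝ → L2Z} (hV : StronglyMeasurable V)
    (hi : ∀ a b, IntervalIntegrable V volume a b) (t : ℝ) :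
    duh V t = flow t (∫ s in (0 : ℝ)..t, flow (-s) (V s)) := by
  rw [duh, ← ContinuousLinearMap.intervalIntegral_comp_comm _
    (intervalIntegrable_flow hV hi measurable_neg 0 t)]
  simp_rw [flow_flow, sub_eq_add_neg]

theorem continuous_duh {V : ℝ → L2Z} (hV : StronglyMeasurable V)
    (hi : ∀ a b, IntervalIntegrable V volume a b) : Continuous (duh V) := by
  have h : Continuous fun t => ∫ s in (0 : ℝ)..t, flow (-s) (V s) :=
    intervalIntegral.continuous_primitive (intervalIntegrable_flow hV hi measurable_neg) 0
  rw [funext (duh_eq_flow hV hi)]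
  exact continuous_flow.clm_apply h

theorem enorm_duh_apply_le {V : ℝ → L2Z} (hV : StronglyMeasurable V)
    (hi : ∀ a b, IntervalIntegrable V volume a b) (t : ℝ) (x : ℤ) :
    ‖duh V t x‖ₑ ≤ ∫⁻ s, ‖flow (t - s) (V s) x‖ₑ := by
  have h : duh V t x = ∫ s in (0 : ℝ)..t, flow (t - s) (V s) x :=
    ((evalAt x).intervalIntegral_comp_comm (intervalIntegrable_flow hV hi
      (measurable_const.sub measurable_id) 0 t)).symm
  rw [h, intervalIntegral.intervalIntegral_eq_integral_uIoc, enorm_smul]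
  have h1 : ‖(if (0 : ℝ) ≤ t then 1 else -1 : ℝ)‖ₑ = 1 := by split_ifs <;> simp
  rw [h1, one_mul]
  exact (enorm_integral_le_lintegral_enorm _).trans (setLIntegral_le_lintegral _ _)

theorem seqNorm_top_duh_le {V : ℝ → L2Z} (hV : StronglyMeasurable V)
    (hi : ∀ a b, IntervalIntegrable V volume a b) (t : ℝ) :
    seqNorm ∞ 0 (duh V t) ≤ ∫⁻ s, seqNorm ∞ 0 (flow (t - s) (V s)) := by
  rw [seqNorm_top_zero]
  exact iSup_le fun x => (enorm_duh_apply_le hV hi t x).trans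
    (lintegral_mono fun s => enorm_apply_le_seqNorm_top _ x)

/-- Hölder against the indicator of the interval. The weighted and `l¹` forcing spaces embed in
`l²`, so this gives the absolute convergence of their Duhamel integrals. -/
theorem intervalIntegrable_of_lpNorm {p q : ℝ} (hpq : p.HolderConjugate q) {V : ℝ → L2Z}
    (hV : StronglyMeasurable V) {N : ℝ → ℝ≥0∞} (hN : Measurable N) (hVN : ∀ s, ‖V s‖ₑ ≤ N s)
    (hfin : lpNorm q N ≠ ∞) (a b : ℝ) : IntervalIntegrable V volume a b := by
  rw [intervalIntegrable_iff]
  refine ⟨hV.aestronglyMeasurable, lt_of_le_of_lt (lintegral_mono hVN) ?_⟩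
  have h1 : Measurable ((Set.uIoc a b).indicator fun _ => (1 : ℝ≥0∞)) :=
    measurable_const.indicator measurableSet_uIoc
  have h2 := lintegral_mul_le_lpNorm_mul hpq h1 hN
  have h3 : ∫⁻ s in Set.uIoc a b, N s = ∫⁻ s, (Set.uIoc a b).indicator (fun _ => 1) s * N s := by
    rw [← lintegral_indicator measurableSet_uIoc]
    refine lintegral_congr fun s => ?_
    by_cases hs : s ∈ Set.uIoc a b <;> simp [hs]
  rw [h3]
  refine h2.trans_lt (ENNReal.mul_lt_top ?_ hfin.lt_top)
  refine ENNReal.rpow_lt_top_of_nonneg (by have := hpq.pos; positivity) (ne_of_lt ?_)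
  have h4 : ∀ s, (Set.uIoc a b).indicator (fun _ => (1 : ℝ≥0∞)) s ^ p
      = (Set.uIoc a b).indicator (fun _ => 1) s := fun s => by
    by_cases hs : s ∈ Set.uIoc a b <;> simp [hs, hpq.pos]
  simp_rw [h4]
  rw [lintegral_indicator measurableSet_uIoc, setLIntegral_const, one_mul, Set.uIoc, Real.volume_Ioc]
  exact ENNReal.ofReal_lt_top

/-- The dual of a homogeneous estimate, localized to a set of times. -/
theorem enorm_setIntegral_flow_le {p q : ℝ} (hpq : p.HolderConjugate q) {V : ℝ → L2Z}
    {N : ℝ → ℝ≥0∞} (hN : Measurable N) {A : L2Z → ℝ≥0∞} {C : ℝ≥0∞}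
    (hpair : ∀ w s, ‖inner ℂ w (V s)‖ₑ ≤ A w * N s)
    (hA : ∀ w, Measurable fun t => A (flow t w))
    (hC : ∀ w, lpNorm p (fun t => A (flow t w)) ≤ C * ‖w‖ₑ) {S : Set ℝ}
    (hS : IntegrableOn (fun s => flow (-s) (V s)) S) :
    ‖∫ s in S, flow (-s) (V s)‖ₑ ≤ C * (∫⁻ s in S, N s ^ q) ^ (1 / q) := by
  set z := ∫ s in S, flow (-s) (V s) with hz
  rcases eq_or_ne z 0 with h0 | h0
  · simp [h0]
  -- The integral is tested against itself: moving the flow to the other side turns the pairing into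
  -- the homogeneous evolution of `z` against the forcing, and one factor of the norm of `z` cancels
  -- at the end.
  have hsq : ‖z‖ₑ * ‖z‖ₑ = ‖inner ℂ z z‖ₑ := by
    rw [inner_self_eq_norm_sq_to_K, ← ofReal_norm, ← ofReal_norm,
      ← ENNReal.ofReal_mul (norm_nonneg _)]
    simp [sq]
  have hle : ‖inner ℂ z z‖ₑ ≤ ∫⁻ s in S, A (flow s z) * N s := by
    conv_lhs => rw [hz, ← hz, ← integral_inner hS]
    refine (enorm_integral_le_lintegral_enorm _).trans (lintegral_mono fun s => ?_)
    rw [← inner_flow_left]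
    exact hpair _ s
  have hH := ENNReal.lintegral_mul_le_Lp_mul_Lq (volume.restrict S) hpq (hA z).aemeasurable
    hN.aemeasurable
  have hA' : (∫⁻ s in S, A (flow s z) ^ p) ^ (1 / p) ≤ C * ‖z‖ₑ :=
    le_trans (ENNReal.rpow_le_rpow (setLIntegral_le_lintegral _ _)
      (by have := hpq.pos; positivity)) (hC z)
  have hfin : ‖z‖ₑ * ‖z‖ₑ ≤ (C * (∫⁻ s in S, N s ^ q) ^ (1 / q)) * ‖z‖ₑ := by
    rw [hsq]
    refine hle.trans (hH.trans ((mul_le_mul' hA' le_rfl).trans (le_of_eq (by ring))))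
  exact (ENNReal.mul_le_mul_iff_left (by simpa using h0) enorm_ne_top).1 hfin

/-- The causal truncation is free here: for a fixed `t` the integral runs over one interval, and the
dual estimate holds on every set of times. -/
theorem enorm_duh_le {p q : ℝ} (hpq : p.HolderConjugate q) {V : ℝ → L2Z}
    (hV : StronglyMeasurable V) (hi : ∀ a b, IntervalIntegrable V volume a b)
    {N : ℝ → ℝ≥0∞} (hN : Measurable N) {A : L2Z → ℝ≥0∞} {C : ℝ≥0∞}
    (hpair : ∀ w s, ‖inner ℂ w (V s)‖ₑ ≤ A w * N s)
    (hA : ∀ w, Measurable fun t => A (flow t w))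
    (hC : ∀ w, lpNorm p (fun t => A (flow t w)) ≤ C * ‖w‖ₑ) (t : ℝ) :
    ‖duh V t‖ₑ ≤ C * lpNorm q N := by
  rw [duh_eq_flow hV hi]
  have h1 : ∀ w : L2Z, ‖flow t w‖ₑ ≤ ‖w‖ₑ := fun w => by
    rw [← ofReal_norm, ← ofReal_norm]
    exact ENNReal.ofReal_le_ofReal (norm_flow_le _ _)
  refine (h1 _).trans ?_
  rw [intervalIntegral.intervalIntegral_eq_integral_uIoc, enorm_smul]
  have h2 : ‖(if (0 : ℝ) ≤ t then 1 else -1 : ℝ)‖ₑ = 1 := by split_ifs <;> simp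
  rw [h2, one_mul]
  refine (enorm_setIntegral_flow_le hpq hN hpair hA hC (intervalIntegrable_iff.1
    (intervalIntegrable_flow hV hi measurable_neg 0 t))).trans (mul_le_mul' le_rfl ?_)
  exact ENNReal.rpow_le_rpow (setLIntegral_le_lintegral _ _)
    (by have := hpq.symm.pos; positivity)

theorem measurable_seqNorm_top_flow (w : L2Z) :
    Measurable fun t => seqNorm ∞ 0 (flow t w) :=
  measurable_seqNorm_top fun x => (continuous_flow_apply continuous_const x).measurable

theorem measurable_seqNorm_two_flow (a : ℝ) (w : L2Z) :
    Measurable fun t => seqNorm 2 a (flow t w) :=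
  measurable_seqNorm_two a fun x => (continuous_flow_apply continuous_const x).measurable

/-! ### Forcing in `L¹ l²` -/

section LOneLTwo

variable {V : ℝ → L2Z}

theorem integrable_of_lpNorm_one (hV : StronglyMeasurable V)
    (hX : lpNorm 1 (fun s => seqNorm 2 0 (V s)) ≠ ∞) : Integrable V := by
  refine ⟨hV.aestronglyMeasurable, lt_top_iff_ne_top.2 ?_⟩
  simpa [lpNorm, seqNorm_two_zero_coe] using hX

theorem enorm_duh_le_of_lpNorm_one (t : ℝ) :
    ‖duh V t‖ₑ ≤ lpNorm 1 (fun s => seqNorm 2 0 (V s)) := by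
  rw [duh, intervalIntegral.intervalIntegral_eq_integral_uIoc, enorm_smul]
  have h2 : ‖(if (0 : ℝ) ≤ t then 1 else -1 : ℝ)‖ₑ = 1 := by split_ifs <;> simp
  rw [h2, one_mul]
  refine (enorm_integral_le_lintegral_enorm _).trans ((setLIntegral_le_lintegral _ _).trans ?_)
  simp only [lpNorm, seqNorm_two_zero_coe, ENNReal.rpow_one, div_one]
  refine lintegral_mono fun s => ?_
  rw [← ofReal_norm, ← ofReal_norm]
  exact ENNReal.ofReal_le_ofReal (norm_flow_le _ _)

/-- By Minkowski the response is a superposition of free evolutions started at the times `s`, each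
bounded by the homogeneous estimate. -/
theorem lpNorm_six_duh_le_of_lpNorm_one (hV : StronglyMeasurable V)
    (hX : lpNorm 1 (fun s => seqNorm 2 0 (V s)) ≠ ∞) :
    lpNorm 6 (fun t => seqNorm ∞ 0 (duh V t)) ≤ 19 * lpNorm 1 (fun s => seqNorm 2 0 (V s)) := by
  have hi : ∀ a b, IntervalIntegrable V volume a b := fun a b =>
    (integrable_of_lpNorm_one hV hX).intervalIntegrable
  have hF : Measurable (Function.uncurry fun t s => seqNorm ∞ 0 (flow (t - s) (V s))) :=
    measurable_seqNorm_top (measurable_coord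
      (stronglyMeasurable_flow (measurable_fst.sub measurable_snd)
        (hV.comp_measurable measurable_snd)))
  calc lpNorm 6 (fun t => seqNorm ∞ 0 (duh V t))
      ≤ lpNorm 6 (fun t => ∫⁻ s, seqNorm ∞ 0 (flow (t - s) (V s))) :=
        lpNorm_mono (by norm_num) (Filter.Eventually.of_forall (seqNorm_top_duh_le hV hi))
    _ ≤ ∫⁻ s, lpNorm 6 (fun t => seqNorm ∞ 0 (flow (t - s) (V s))) :=
        lpNorm_lintegral_le holderConjugate_six hF
    _ = ∫⁻ s, lpNorm 6 (fun t => seqNorm ∞ 0 (flow t (V s))) := by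
        refine lintegral_congr fun s => ?_
        rw [lpNorm, lintegral_sub_right_eq_self (fun t => seqNorm ∞ 0 (flow t (V s)) ^ (6 : ℝ)) s,
          lpNorm]
    _ ≤ ∫⁻ s, 19 * ‖V s‖ₑ := lintegral_mono fun s => lpNorm_six_flow_le (V s)
    _ = _ := by
        rw [lintegral_const_mul' _ _ (by simp)]
        simp [lpNorm, seqNorm_two_zero_coe]

end LOneLTwo

/-! ### Forcing in `L^{6/5} l¹` -/

section LSixFifthsLOne

variable {V : ℝ → L2Z}

theorem intervalIntegrable_of_lpNorm_six_fifths (hV : StronglyMeasurable V)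
    (hX : lpNorm (6 / 5) (fun s => seqNorm 1 0 (V s)) ≠ ∞) (a b : ℝ) :
    IntervalIntegrable V volume a b :=
  intervalIntegrable_of_lpNorm holderConjugate_six hV
    (measurable_seqNorm_one (measurable_coord hV)) (fun s => by
      rw [← seqNorm_two_zero_coe]
      exact seqNorm_two_zero_le_one_zero _) hX a b

theorem enorm_duh_le_of_lpNorm_six_fifths (hV : StronglyMeasurable V)
    (hX : lpNorm (6 / 5) (fun s => seqNorm 1 0 (V s)) ≠ ∞) (t : ℝ) :
    ‖duh V t‖ₑ ≤ 19 * lpNorm (6 / 5) (fun s => seqNorm 1 0 (V s)) :=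
  enorm_duh_le holderConjugate_six hV (intervalIntegrable_of_lpNorm_six_fifths hV hX)
    (measurable_seqNorm_one (measurable_coord hV)) (A := fun w => seqNorm ∞ 0 w)
    (fun w s => enorm_inner_le_top_mul_one w (V s)) measurable_seqNorm_top_flow
    lpNorm_six_flow_le t

/-- The dispersive bound under the integral sign leaves a convolution with the Riesz kernel; the
constant is `34 · 10`. -/
theorem lpNorm_six_duh_le_of_lpNorm_six_fifths (hV : StronglyMeasurable V)
    (hX : lpNorm (6 / 5) (fun s => seqNorm 1 0 (V s)) ≠ ∞) :
    lpNorm 6 (fun t => seqNorm ∞ 0 (duh V t))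
      ≤ 340 * lpNorm (6 / 5) (fun s => seqNorm 1 0 (V s)) := by
  have hi := intervalIntegrable_of_lpNorm_six_fifths hV hX
  have hpt : ∀ t, seqNorm ∞ 0 (duh V t) ≤ 34 * ∫⁻ s, rieszKernel (t - s) * seqNorm 1 0 (V s) :=
    fun t => by
      rw [← lintegral_const_mul' _ _ (by simp)]
      refine (seqNorm_top_duh_le hV hi t).trans (lintegral_mono fun s => ?_)
      rw [← mul_assoc]
      exact seqNorm_top_flow_le _ _
  refine (lpNorm_mono (by norm_num) (Filter.Eventually.of_forall hpt)).trans ?_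
  rw [lpNorm_const_mul (by norm_num) (by simp)]
  refine (mul_le_mul' le_rfl (lpNorm_lintegral_rieszKernel_mul_le
    (measurable_seqNorm_one (measurable_coord hV)) hX)).trans (le_of_eq ?_)
  rw [← mul_assoc]
  norm_num

end LSixFifthsLOne

/-! ### Forcing in `L² l²₁` -/

section LTwoWeighted

variable {V : ℝ → L2Z}

theorem intervalIntegrable_of_lpNorm_two (hV : StronglyMeasurable V)
    (hX : lpNorm 2 (fun s => seqNorm 2 1 (V s)) ≠ ∞) (a b : ℝ) :
    IntervalIntegrable V volume a b :=
  intervalIntegrable_of_lpNorm Real.HolderConjugate.two_two hV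
    (measurable_seqNorm_two 1 (measurable_coord hV)) (fun s => by
      rw [← seqNorm_two_zero_coe]
      exact seqNorm_two_mono zero_le_one _) hX a b

theorem enorm_duh_le_of_lpNorm_two (hV : StronglyMeasurable V)
    (hX : lpNorm 2 (fun s => seqNorm 2 1 (V s)) ≠ ∞) (t : ℝ) :
    ‖duh V t‖ₑ ≤ (katoConst : ℝ≥0∞) ^ (1 / 2 : ℝ) * lpNorm 2 (fun s => seqNorm 2 1 (V s)) :=
  enorm_duh_le Real.HolderConjugate.two_two hV (intervalIntegrable_of_lpNorm_two hV hX)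
    (measurable_seqNorm_two 1 (measurable_coord hV)) (A := fun w => seqNorm 2 (-1) w)
    (fun w s => enorm_inner_le_weighted w (V s)) (measurable_seqNorm_two_flow _)
    lpNorm_two_flow_le t

/-- No single kernel bound connects `l²₁` forcing to `l^∞`. The noncausal operator factors through
`l²`, as the dual Kato estimate followed by homogeneous Strichartz, and the Christ-Kiselev lemma
restores causality. -/
theorem lpNorm_six_duh_le_of_lpNorm_two (hV : StronglyMeasurable V)
    (hX : lpNorm 2 (fun s => seqNorm 2 1 (V s)) ≠ ∞) :
    lpNorm 6 (fun t => seqNorm ∞ 0 (duh V t))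
      ≤ 190 * ((katoConst : ℝ≥0∞) ^ (1 / 2 : ℝ) + 1)
        * lpNorm 2 (fun s => seqNorm 2 1 (V s)) := by
  have hi := intervalIntegrable_of_lpNorm_two hV hX
  set N : ℝ → ℝ≥0∞ := fun s => seqNorm 2 1 (V s) with hN
  have hNm : Measurable N := measurable_seqNorm_two 1 (measurable_coord hV)
  set κ : ℝ := (katoConst : ℝ) ^ (1 / 2 : ℝ) with hκ
  have hκ0 : 0 ≤ κ := by positivity
  have hκe : (katoConst : ℝ≥0∞) ^ (1 / 2 : ℝ) = ENNReal.ofReal κ := by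
    rw [hκ, ← ENNReal.ofReal_rpow_of_nonneg (NNReal.coe_nonneg _) (by norm_num), ENNReal.ofReal_coe_nnreal]
  set ν : ℝ → ℝ := fun s => (N s ^ (2 : ℝ)).toReal with hν
  have hNfin : ∫⁻ s, N s ^ (2 : ℝ) ≠ ∞ := by
    rw [← lpNorm_rpow (by norm_num)]
    exact ENNReal.rpow_ne_top_of_nonneg (by norm_num) hX
  have hνi : Integrable ν := integrable_toReal_of_lintegral_ne_top
    (hNm.pow_const _).aemeasurable hNfin
  have hνS : ∀ S : Set ℝ, ∫⁻ s in S, N s ^ (2 : ℝ) = ENNReal.ofReal (∫ s in S, ν s) := fun S => by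
    have hS : ∫⁻ s in S, N s ^ (2 : ℝ) ≠ ∞ :=
      ne_top_of_le_ne_top hNfin (setLIntegral_le_lintegral _ _)
    rw [hν, integral_toReal (hNm.pow_const _).aemeasurable
      (ae_lt_top (hNm.pow_const _) hS), ENNReal.ofReal_toReal hS]
  have hsqrt : ∀ x : ℝ, 0 ≤ x → ENNReal.ofReal x ^ (1 / 2 : ℝ) = ENNReal.ofReal √x :=
    fun x hx => by rw [ENNReal.ofReal_rpow_of_nonneg hx (by norm_num), Real.sqrt_eq_rpow]
  have hT : ∀ a b, a ≤ b → ‖∫ s in a..b, flow (-s) (V s)‖ ≤ (κ + 1) * √(∫ s in a..b, ν s) := by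
    intro a b hab
    have h0 : 0 ≤ ∫ s in Set.Ioc a b, ν s := integral_nonneg fun s => ENNReal.toReal_nonneg
    rw [intervalIntegral.integral_of_le hab, intervalIntegral.integral_of_le hab]
    have h1 := enorm_setIntegral_flow_le Real.HolderConjugate.two_two hNm
      (A := fun w => seqNorm 2 (-1) w) (fun w s => enorm_inner_le_weighted w (V s))
      (measurable_seqNorm_two_flow _) lpNorm_two_flow_le
      ((intervalIntegrable_iff_integrableOn_Ioc_of_le hab).1
        (intervalIntegrable_flow hV hi measurable_neg a b))
    rw [hνS, hsqrt _ h0, hκe, ← ENNReal.ofReal_mul hκ0, ← ofReal_norm,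
      ENNReal.ofReal_le_ofReal_iff (by positivity)] at h1
    refine h1.trans ?_
    gcongr
    linarith
  -- The added one keeps `C₂` positive, as the lemma demands; `190` is `10 · 19`.
  have key := lpNorm_causal_le (Φ := fun t w => seqNorm ∞ 0 (flow t w)) (C₁ := 19) (C₂ := κ + 1)
    (W := fun s => flow (-s) (V s)) (ν := ν)
    (fun t v w => by
      rw [map_add]
      exact seqNorm_add_le le_top 0 _ _)
    (fun t w => by
      rw [seqNorm_top_zero]
      refine iSup_le fun x => ?_
      rw [← ofReal_norm, ← ofReal_norm]
      exact ENNReal.ofReal_le_ofReal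
        ((lp.norm_apply_le_norm (by norm_num) _ x).trans (norm_flow_le _ _)))
    (fun c hc => measurable_seqNorm_top fun x => (continuous_flow_apply hc x).measurable)
    (by norm_num) (by positivity)
    (fun w => by
      rw [ENNReal.ofReal_ofNat]
      exact lpNorm_six_flow_le w)
    (intervalIntegrable_flow hV hi measurable_neg) (fun t => ENNReal.toReal_nonneg) hνi hT
  simp_rw [← duh_eq_flow hV hi] at key
  refine key.trans (le_of_eq ?_)
  have h0 : 0 ≤ ∫ s, ν s := integral_nonneg fun s => ENNReal.toReal_nonneg
  have h1 := hνS Set.univ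
  rw [Measure.restrict_univ] at h1
  rw [lpNorm, h1, hsqrt _ h0, hκe, ← ENNReal.ofReal_one, ← ENNReal.ofReal_add hκ0 zero_le_one,
    ← ENNReal.ofReal_ofNat 190, ← ENNReal.ofReal_mul (by norm_num),
    ← ENNReal.ofReal_mul (by positivity)]
  congr 1
  ring

/-- The inhomogeneous Kato smoothing estimate on the line. -/
theorem lpNorm_two_duh_le (hV : StronglyMeasurable V)
    (hX : lpNorm 2 (fun s => seqNorm 2 1 (V s)) ≠ ∞) :
    lpNorm 2 (fun t => seqNorm 2 (-1) (duh V t))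
      ≤ katoConst * lpNorm 2 (fun s => seqNorm 2 1 (V s)) := by
  have hi := intervalIntegrable_of_lpNorm_two hV hX
  have hNm : Measurable fun s => seqNorm 2 1 (V s) := measurable_seqNorm_two 1 (measurable_coord hV)
  have hc : (69632 : ℝ≥0∞) * expSum ^ (1 / 2 : ℝ) ≠ ∞ :=
    ENNReal.mul_ne_top (by simp) (ENNReal.rpow_ne_top_of_nonneg (by norm_num) expSum_ne_top)
  -- Local decay bounds each entry of the integrand in absolute value, so causality plays no role.
  -- One factor `expSum ^ (1 / 2)` comes from pairing with the forcing, the other from the output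
  -- norm.
  have hpt : ∀ t, seqNorm 2 (-1) (duh V t)
      ≤ expSum ^ (1 / 2 : ℝ) * (69632 * expSum ^ (1 / 2 : ℝ))
        * ∫⁻ s, decay (t - s) * seqNorm 2 1 (V s) := fun t => by
    rw [mul_assoc]
    refine seqNorm_neg_one_le fun x => (enorm_duh_apply_le hV hi t x).trans ?_
    rw [← lintegral_const_mul' _ _ hc, ← lintegral_mul_const' _ _ (by simp)]
    exact lintegral_mono fun s => enorm_flow_apply_le_decay _ _ _
  refine (lpNorm_mono (by norm_num) (Filter.Eventually.of_forall hpt)).trans ?_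
  rw [lpNorm_const_mul (by norm_num) (ENNReal.mul_ne_top
    (ENNReal.rpow_ne_top_of_nonneg (by norm_num) expSum_ne_top) hc)]
  refine (mul_le_mul' le_rfl (lpNorm_lintegral_mul_le measurable_decay hNm)).trans (le_of_eq ?_)
  have e : expSum = expSum ^ (1 / 2 : ℝ) * expSum ^ (1 / 2 : ℝ) := by
    rw [← ENNReal.rpow_add_of_nonneg _ _ (by norm_num) (by norm_num)]
    norm_num
  rw [coe_katoConst]
  conv_rhs => rw [e]
  ring

end LTwoWeighted

/-! ### Transfer to functions on an interval -/

/-- Coordinatewise measurability suffices because the finite partial sums of the expansion in unit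
vectors converge in `l²`. -/
theorem stronglyMeasurable_toL2 {u : ℝ → ℤ → ℂ} (hu : ∀ x, Measurable fun t => u t x)
    (hm : ∀ t, Memℓp (u t) 2) : StronglyMeasurable fun t => toL2 (u t) := by
  refine stronglyMeasurable_of_tendsto (u := (Filter.atTop : Filter (Finset ℤ)))
    (f := fun n t => ∑ x ∈ n, u t x • unitVec x) (fun n => ?_) (tendsto_pi_nhds.2 fun t => ?_)
  · refine Finset.stronglyMeasurable_fun_sum n fun x _ => ?_
    exact (hu x).stronglyMeasurable.smul_const _
  · have h : HasSum (fun x => u t x • unitVec x) (toL2 (u t)) := by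
      refine (lp.hasSum_single (p := 2) (by norm_num) (toL2 (u t))).congr_fun fun x => ?_
      rw [toL2_apply (hm t), unitVec, ← lp.single_smul, smul_eq_mul, mul_one]
    simpa only [HasSum, SummationFilter.unconditional_filter] using h

/-- A function of finite mixed norm has a measurable representative with values in `l²(ℤ)`,
extended by zero. -/
theorem exists_representative {I : Set ℝ} (hI : MeasurableSet I) {p : ℝ≥0∞} {a : ℝ} {Q : ℝ≥0∞}
    (hQ0 : Q ≠ 0) (hQt : Q ≠ ∞) (hle : ∀ u, seqNorm 2 0 u ≤ seqNorm p a u)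
    (hmeas : ∀ u : ℝ → ℤ → ℂ, (∀ x, Measurable fun t => u t x) →
      Measurable fun t => seqNorm p a (u t)) {f : ℝ → ℤ → ℂ}
    (hf : mixedNorm I Q p a f ≠ ∞) :
    ∃ V : ℝ → L2Z, StronglyMeasurable V ∧ (∀ᵐ t ∂(volume.restrict I), f t = V t) ∧
      lpNorm Q.toReal (fun t => seqNorm p a (V t)) = mixedNorm I Q p a f := by
  have hQ : 0 < Q.toReal := ENNReal.toReal_pos hQ0 hQt
  -- Nonmeasurable functions have mixed norm `∞` by convention, so finiteness yields measurability.
  have hfm : ∀ x : ℤ, AEStronglyMeasurable (fun t => f t x) (volume.restrict I) := by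
    by_contra h
    exact hf (if_neg h)
  have hfe : mixedNorm I Q p a f = (∫⁻ t in I, seqNorm p a (f t) ^ Q.toReal) ^ (1 / Q.toReal) := by
    rw [mixedNorm, if_pos hfm, eLpNorm_eq_lintegral_rpow_enorm_toReal hQ0 hQt]
    simp
  choose g hgm hfg using fun x => (hfm x).aemeasurable
  have hfg' : ∀ᵐ t ∂(volume.restrict I), f t = fun x => g x t := by
    filter_upwards [ae_all_iff.2 hfg] with t ht
    exact funext ht
  have hNm := hmeas (fun t x => g x t) hgm
  have hge : ∫⁻ t in I, seqNorm p a (fun x => g x t) ^ Q.toReal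
      = ∫⁻ t in I, seqNorm p a (f t) ^ Q.toReal :=
    lintegral_congr_ae (hfg'.mono fun t ht => by beta_reduce; rw [ht])
  have hfin : ∀ᵐ t ∂(volume.restrict I), seqNorm p a (fun x => g x t) < ∞ := by
    have h1 : ∫⁻ t in I, seqNorm p a (fun x => g x t) ^ Q.toReal ≠ ∞ := by
      rw [hge]
      intro h
      rw [hfe, h, ENNReal.top_rpow_of_pos (by positivity)] at hf
      exact hf rfl
    filter_upwards [ae_lt_top (hNm.pow_const _) h1] with t ht
    exact (ENNReal.rpow_lt_top_iff_of_pos hQ).1 ht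
  -- Times with infinite sequence norm form a null set in `I`. Discarding them makes every value
  -- square summable, and vanishing outside `I` makes the norm on the line equal to the norm on `I`.
  set S : Set ℝ := I ∩ {t | seqNorm p a (fun x => g x t) < ∞} with hS
  have hSm : MeasurableSet S := hI.inter (measurableSet_lt hNm measurable_const)
  set u : ℝ → ℤ → ℂ := fun t x => S.indicator (g x) t with hu
  have hus : ∀ t ∈ S, u t = fun x => g x t := fun t ht => funext fun x => by simp [hu, ht]
  have hun : ∀ t ∉ S, u t = 0 := fun t ht => funext fun x => by simp [hu, ht]
  have hmem : ∀ t, Memℓp (u t) 2 := fun t => by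
    by_cases ht : t ∈ S
    · rw [hus t ht]
      exact memlp_of_seqNorm_lt_top ((hle _).trans_lt ht.2)
    · rw [hun t ht]
      exact zero_memℓp
  have hIS : ∀ᵐ t ∂(volume.restrict I), t ∈ S := by
    filter_upwards [hfin, ae_restrict_mem hI] with t h1 h2
    exact ⟨h2, h1⟩
  refine ⟨fun t => toL2 (u t), stronglyMeasurable_toL2 (fun x => (hgm x).indicator hSm) hmem, ?_, ?_⟩
  · filter_upwards [hfg', hIS] with t h1 h2
    rw [coe_toL2 (hmem t), hus t h2, h1]
  · rw [hfe, ← hge, lpNorm]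
    congr 1
    rw [← lintegral_add_compl _ hI]
    have h0 : ∫⁻ t in Iᶜ, seqNorm p a (toL2 (u t)) ^ Q.toReal = ∫⁻ t in Iᶜ, 0 := by
      refine setLIntegral_congr_fun hI.compl fun t ht => ?_
      beta_reduce
      rw [coe_toL2 (hmem t), hun t fun h => ht h.1]
      simp [seqNorm, hQ]
    rw [h0, lintegral_zero, add_zero]
    refine lintegral_congr_ae (hIS.mono fun t ht => ?_)
    beta_reduce
    rw [coe_toL2 (hmem t), hus t ht]

theorem lpNorm_add_le {p : ℝ} (hp : 1 ≤ p) {A B : ℝ → ℝ≥0∞} (hA : Measurable A)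
    (hB : Measurable B) : lpNorm p (fun t => A t + B t) ≤ lpNorm p A + lpNorm p B :=
  ENNReal.lintegral_Lp_add_le hA.aemeasurable hB.aemeasurable hp

theorem mixedNorm_top_le {I : Set ℝ} (hI : MeasurableSet I) {u : ℝ → ℤ → ℂ} {D : ℝ → L2Z}
    (hD : Continuous D) (hu : ∀ t ∈ I, u t = D t) {B : ℝ≥0∞} (hB : ∀ t, ‖D t‖ₑ ≤ B) :
    mixedNorm I ∞ 2 0 u ≤ B := by
  have hm : ∀ x : ℤ, AEStronglyMeasurable (fun t => u t x) (volume.restrict I) := fun x => by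
    refine (((evalAt x).continuous.comp hD).aestronglyMeasurable).congr ?_
    filter_upwards [ae_restrict_mem hI] with t ht
    rw [hu t ht]
    rfl
  rw [mixedNorm, if_pos hm, eLpNorm_exponent_top]
  refine eLpNormEssSup_le_of_ae_enorm_bound ?_
  filter_upwards [ae_restrict_mem hI] with t ht
  rw [hu t ht, seqNorm_two_zero_coe]
  exact hB t

theorem mixedNorm_le_lpNorm {I : Set ℝ} (hI : MeasurableSet I) {Q p : ℝ≥0∞} (hQ0 : Q ≠ 0)
    (hQt : Q ≠ ∞) {a : ℝ} {u : ℝ → ℤ → ℂ} {D : ℝ → L2Z} (hD : Continuous D)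
    (hu : ∀ t ∈ I, u t = D t) :
    mixedNorm I Q p a u ≤ lpNorm Q.toReal (fun t => seqNorm p a (D t)) := by
  have hm : ∀ x : ℤ, AEStronglyMeasurable (fun t => u t x) (volume.restrict I) := fun x => by
    refine (((evalAt x).continuous.comp hD).aestronglyMeasurable).congr ?_
    filter_upwards [ae_restrict_mem hI] with t ht
    rw [hu t ht]
    rfl
  rw [mixedNorm, if_pos hm, eLpNorm_eq_lintegral_rpow_enorm_toReal hQ0 hQt, lpNorm]
  refine ENNReal.rpow_le_rpow ?_ (by positivity)
  refine le_trans (le_of_eq ?_) (setLIntegral_le_lintegral I _)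
  refine setLIntegral_congr_fun hI fun t ht => ?_
  simp [hu t ht]

theorem uIoc_zero_subset {I : Set ℝ} (hI : I.OrdConnected) (h0 : (0 : ℝ) ∈ I) {t : ℝ}
    (ht : t ∈ I) : Set.uIoc 0 t ⊆ I :=
  Set.uIoc_subset_uIcc.trans (hI.uIcc_subset h0 ht)

theorem ae_uIoc_evolve_eq {I : Set ℝ} (hI : I.OrdConnected) (h0 : (0 : ℝ) ∈ I)
    {f : ℝ → ℤ → ℂ} {V : ℝ → L2Z} (hfV : ∀ᵐ t ∂(volume.restrict I), f t = V t) {t : ℝ}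
    (ht : t ∈ I) (r : ℝ → ℝ) :
    (fun s => flow (r s) (V s)) =ᵐ[volume.restrict (Set.uIoc 0 t)]
      fun s => evolve (r s) (f s) := by
  filter_upwards [ae_restrict_of_ae_restrict_of_subset (uIoc_zero_subset hI h0 ht) hfV] with s hs
  rw [hs, evolve, toL2_coe]
  rfl

theorem duhamel_eq_duh {I : Set ℝ} (hI : I.OrdConnected) (h0 : (0 : ℝ) ∈ I)
    {f : ℝ → ℤ → ℂ} {V : ℝ → L2Z} (hfV : ∀ᵐ t ∂(volume.restrict I), f t = V t) {t : ℝ}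
    (ht : t ∈ I) : duhamel f t = duh V t := by
  rw [duhamel, duh]
  refine intervalIntegral.integral_congr_ae_restrict ?_
  exact (ae_uIoc_evolve_eq hI h0 hfV ht _).symm

theorem intervalIntegrable_evolve {I : Set ℝ} (hI : I.OrdConnected) (h0 : (0 : ℝ) ∈ I)
    {f : ℝ → ℤ → ℂ} {V : ℝ → L2Z} (hfV : ∀ᵐ t ∂(volume.restrict I), f t = V t)
    (hV : StronglyMeasurable V) (hi : ∀ a b, IntervalIntegrable V volume a b) {t : ℝ}
    (ht : t ∈ I) : IntervalIntegrable (fun s => evolve (t - s) (f s)) volume 0 t := by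
  have hr : Measurable fun s => t - s := measurable_const.sub measurable_id
  refine (intervalIntegrable_flow hV hi hr 0 t).congr_ae ?_
  exact ae_uIoc_evolve_eq hI h0 hfV ht _

theorem seqNorm_zero_le_two (u : ℤ → ℂ) : seqNorm 2 0 u ≤ seqNorm 2 1 u :=
  seqNorm_two_mono zero_le_one u

/-- The inhomogeneous Strichartz estimate for a given decomposition of the forcing term. -/
theorem strichartz_of_decomposition {I : Set ℝ} (hI : I.OrdConnected) (h0 : (0 : ℝ) ∈ I)
    {f g₁ g₂ h : ℝ → ℤ → ℂ} (hf : ∀ᵐ t ∂(volume.restrict I), f t = g₁ t + g₂ t + h t)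
    (h₁ : mixedNorm I 1 2 0 g₁ ≠ ∞) (h₂ : mixedNorm I (6 / 5) 1 0 g₂ ≠ ∞)
    (h₃ : mixedNorm I 2 2 1 h ≠ ∞) :
    (∀ t ∈ I, IntervalIntegrable (fun s => evolve (t - s) (f s)) volume 0 t) ∧
      stzNorm I (fun t => duhamel f t) ≤ (340 + 190 * ((katoConst : ℝ≥0∞) ^ (1 / 2 : ℝ) + 1)) *
        (mixedNorm I 1 2 0 g₁ + mixedNorm I (6 / 5) 1 0 g₂ + mixedNorm I 2 2 1 h) := by
  have hIm := hI.measurableSet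
  have h65 : ((6 : ℝ≥0∞) / 5).toReal = 6 / 5 := by simp
  have h65t : (6 : ℝ≥0∞) / 5 ≠ ∞ := ENNReal.div_ne_top (by simp) (by simp)
  obtain ⟨V₁, hV₁, hg₁, hn₁⟩ := exists_representative hIm (p := 2) (a := 0) (by simp) (by simp)
    (fun _ => le_rfl) (fun u hu => measurable_seqNorm_two 0 hu) h₁
  obtain ⟨V₂, hV₂, hg₂, hn₂⟩ := exists_representative hIm (p := 1) (a := 0) (by simp) h65t
    seqNorm_two_zero_le_one_zero (fun u hu => measurable_seqNorm_one hu) h₂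
  obtain ⟨V₃, hV₃, hh, hn₃⟩ := exists_representative hIm (p := 2) (a := 1) (by simp) (by simp)
    seqNorm_zero_le_two (fun u hu => measurable_seqNorm_two 1 hu) h₃
  rw [ENNReal.toReal_one] at hn₁
  rw [h65] at hn₂
  rw [ENNReal.toReal_ofNat] at hn₃
  rw [← hn₁] at h₁
  rw [← hn₂] at h₂
  rw [← hn₃] at h₃
  have hi₁ : ∀ a b, IntervalIntegrable V₁ volume a b := fun a b =>
    (integrable_of_lpNorm_one hV₁ h₁).intervalIntegrable
  have hi₂ := intervalIntegrable_of_lpNorm_six_fifths hV₂ h₂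
  have hi₃ := intervalIntegrable_of_lpNorm_two hV₃ h₃
  set V : ℝ → L2Z := fun t => V₁ t + V₂ t + V₃ t with hVdef
  have hV : StronglyMeasurable V := (hV₁.add hV₂).add hV₃
  have hi : ∀ a b, IntervalIntegrable V volume a b := fun a b =>
    ((hi₁ a b).add (hi₂ a b)).add (hi₃ a b)
  have hfV : ∀ᵐ t ∂(volume.restrict I), f t = V t := by
    filter_upwards [hf, hg₁, hg₂, hh] with t e e1 e2 e3
    rw [e, e1, e2, e3]
    rfl
  refine ⟨fun t ht => intervalIntegrable_evolve hI h0 hfV hV hi ht, ?_⟩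
  have hD : ∀ t, duh V t = duh V₁ t + duh V₂ t + duh V₃ t := fun t => by
    have hr : Measurable fun s => t - s := measurable_const.sub measurable_id
    rw [duh, duh, duh, duh, ← intervalIntegral.integral_add
      (intervalIntegrable_flow hV₁ hi₁ hr 0 t) (intervalIntegrable_flow hV₂ hi₂ hr 0 t),
      ← intervalIntegral.integral_add ((intervalIntegrable_flow hV₁ hi₁ hr 0 t).add
        (intervalIntegrable_flow hV₂ hi₂ hr 0 t)) (intervalIntegrable_flow hV₃ hi₃ hr 0 t)]
    simp only [hVdef, map_add]
  have hc := continuous_duh hV hi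
  rw [← hn₁, ← hn₂, ← hn₃]
  set X₁ := lpNorm 1 (fun t => seqNorm 2 0 (V₁ t))
  set X₂ := lpNorm (6 / 5) (fun t => seqNorm 1 0 (V₂ t))
  set X₃ := lpNorm 2 (fun t => seqNorm 2 1 (V₃ t))
  set κ := (katoConst : ℝ≥0∞) ^ (1 / 2 : ℝ)
  -- One constant that dominates the bounds of all three forcing classes, both in the energy norm
  -- and in the `L⁶ l^∞` norm.
  have hcombine : ∀ {b₁ b₂ b₃ : ℝ≥0∞}, b₁ ≤ 340 → b₂ ≤ 340 → b₃ ≤ 190 * (κ + 1) →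
      b₁ * X₁ + b₂ * X₂ + b₃ * X₃ ≤ (340 + 190 * (κ + 1)) * (X₁ + X₂ + X₃) := by
    intro b₁ b₂ b₃ k1 k2 k3
    rw [mul_add, mul_add]
    exact add_le_add (add_le_add (mul_le_mul' (k1.trans le_self_add) le_rfl)
      (mul_le_mul' (k2.trans le_self_add) le_rfl)) (mul_le_mul' (k3.trans le_add_self) le_rfl)
  refine max_le (mixedNorm_top_le hIm hc (fun t ht => by rw [duhamel_eq_duh hI h0 hfV ht])
    fun t => ?_) ?_
  · rw [hD]
    refine (enorm_add_le _ _).trans ((add_le_add ((enorm_add_le _ _).trans (add_le_add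
      (enorm_duh_le_of_lpNorm_one t) (enorm_duh_le_of_lpNorm_six_fifths hV₂ h₂ t)))
      (enorm_duh_le_of_lpNorm_two hV₃ h₃ t)).trans ?_)
    refine le_trans (le_of_eq ?_)
      (hcombine (b₁ := 1) (b₂ := 19) (b₃ := κ) (by norm_num) (by norm_num) ?_)
    · rw [one_mul]
    calc κ ≤ κ + 1 := le_self_add
      _ = 1 * (κ + 1) := (one_mul _).symm
      _ ≤ _ := mul_le_mul' (by norm_num) le_rfl
  · refine (mixedNorm_le_lpNorm hIm (by simp) (by simp) hc
      (fun t ht => by rw [duhamel_eq_duh hI h0 hfV ht])).trans ?_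
    rw [ENNReal.toReal_ofNat]
    have hm : ∀ {V : ℝ → L2Z}, StronglyMeasurable V →
        (∀ a b, IntervalIntegrable V volume a b) → Measurable fun t => seqNorm ∞ 0 (duh V t) :=
      fun hV hi => measurable_seqNorm_top fun x =>
        ((evalAt x).continuous.comp (continuous_duh hV hi)).measurable
    have hpt : ∀ t, seqNorm ∞ 0 (duh V t)
        ≤ seqNorm ∞ 0 (duh V₁ t) + seqNorm ∞ 0 (duh V₂ t) + seqNorm ∞ 0 (duh V₃ t) := fun t => by
      rw [hD]
      exact (seqNorm_add_le le_top 0 (⇑(duh V₁ t + duh V₂ t)) _).trans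
        (add_le_add (seqNorm_add_le le_top 0 _ _) le_rfl)
    refine (lpNorm_mono (by norm_num) (Filter.Eventually.of_forall hpt)).trans ?_
    refine (lpNorm_add_le (by norm_num) ((hm hV₁ hi₁).add (hm hV₂ hi₂)) (hm hV₃ hi₃)).trans ?_
    refine (add_le_add (lpNorm_add_le (by norm_num) (hm hV₁ hi₁) (hm hV₂ hi₂)) le_rfl).trans ?_
    refine (add_le_add (add_le_add (lpNorm_six_duh_le_of_lpNorm_one hV₁ h₁)
      (lpNorm_six_duh_le_of_lpNorm_six_fifths hV₂ h₂))
      (lpNorm_six_duh_le_of_lpNorm_two hV₃ h₃)).trans ?_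
    exact hcombine (by norm_num) le_rfl le_rfl

theorem le_mul_sumNorm {I : Set ℝ} {nX nY : (ℝ → ℤ → ℂ) → ℝ≥0∞} {f : ℝ → ℤ → ℂ} {B : ℝ≥0∞}
    (hB : ∀ g h : ℝ → ℤ → ℂ, (∀ᵐ t ∂(volume.restrict I), f t = g t + h t) → B ≤ nX g + nY h) :
    B ≤ sumNorm I nX nY f :=
  le_iInf fun g => le_iInf fun h => le_iInf fun hgh => hB g h hgh

theorem exists_of_sumNorm_lt {I : Set ℝ} {nX nY : (ℝ → ℤ → ℂ) → ℝ≥0∞} {f : ℝ → ℤ → ℂ}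
    {B : ℝ≥0∞} (hB : sumNorm I nX nY f < B) :
    ∃ g h : ℝ → ℤ → ℂ, (∀ᵐ t ∂(volume.restrict I), f t = g t + h t) ∧ nX g + nY h < B := by
  simp only [sumNorm, iInf_lt_iff] at hB
  obtain ⟨g, h, hgh, hlt⟩ := hB
  exact ⟨g, h, hgh, hlt⟩

/-- The homogeneous Strichartz and Kato smoothing estimates on an interval. -/
theorem homogeneous_estimate {I : Set ℝ} (hI : MeasurableSet I) {u₀ : ℤ → ℂ}
    (h : seqNorm 2 0 u₀ < ∞) :
    max (stzNorm I (fun t => evolve t u₀)) (mixedNorm I 2 2 (-1) (fun t => evolve t u₀))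
      ≤ (19 + (katoConst : ℝ≥0∞) ^ (1 / 2 : ℝ)) * seqNorm 2 0 u₀ := by
  have hm := memlp_of_seqNorm_lt_top h
  have hc : Continuous fun t => flow t (toL2 u₀) := continuous_flow.clm_apply continuous_const
  have hn : seqNorm 2 0 u₀ = ‖toL2 u₀‖ₑ := by rw [← seqNorm_two_zero_coe, coe_toL2 hm]
  rw [hn]
  refine max_le (max_le ?_ ?_) ?_
  · refine mixedNorm_top_le hI hc (fun _ _ => rfl) fun t => ?_
    have h1 : ‖flow t (toL2 u₀)‖ₑ ≤ ‖toL2 u₀‖ₑ := by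
      rw [← ofReal_norm, ← ofReal_norm]
      exact ENNReal.ofReal_le_ofReal (norm_flow_le _ _)
    calc _ ≤ 1 * ‖toL2 u₀‖ₑ := by rwa [one_mul]
      _ ≤ _ := mul_le_mul' (le_trans (by norm_num) le_self_add) le_rfl
  · refine (mixedNorm_le_lpNorm hI (by simp) (by simp) hc fun _ _ => rfl).trans ?_
    rw [ENNReal.toReal_ofNat]
    exact (lpNorm_six_flow_le _).trans (mul_le_mul' le_self_add le_rfl)
  · refine (mixedNorm_le_lpNorm hI (by simp) (by simp) hc fun _ _ => rfl).trans ?_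
    rw [ENNReal.toReal_ofNat]
    exact (lpNorm_two_flow_le _).trans (mul_le_mul' le_add_self le_rfl)

/-- The inhomogeneous Kato smoothing estimate on an interval. -/
theorem inhomogeneous_kato {I : Set ℝ} (hI : I.OrdConnected) (h0 : (0 : ℝ) ∈ I)
    {f : ℝ → ℤ → ℂ} (hf : mixedNorm I 2 2 1 f ≠ ∞) :
    (∀ t ∈ I, IntervalIntegrable (fun s => evolve (t - s) (f s)) volume 0 t) ∧
      mixedNorm I 2 2 (-1) (fun t => duhamel f t) ≤ katoConst * mixedNorm I 2 2 1 f := by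
  have hIm := hI.measurableSet
  obtain ⟨V, hV, hfV, hn⟩ := exists_representative hIm (p := 2) (a := 1) (by simp) (by simp)
    seqNorm_zero_le_two (fun u hu => measurable_seqNorm_two 1 hu) hf
  rw [ENNReal.toReal_ofNat] at hn
  rw [← hn] at hf ⊢
  have hi := intervalIntegrable_of_lpNorm_two hV hf
  refine ⟨fun t ht => intervalIntegrable_evolve hI h0 hfV hV hi ht, ?_⟩
  refine (mixedNorm_le_lpNorm hIm (by simp) (by simp) (continuous_duh hV hi)
    (fun t ht => by rw [duhamel_eq_duh hI h0 hfV ht])).trans ?_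
  rw [ENNReal.toReal_ofNat]
  exact lpNorm_two_duh_le hV hf

end DiscreteNLS
end

/-! ### Assembly of the three estimates -/

theorem proposition2p1 :
    ∃ C : ℝ≥0, ∀ I : Set ℝ, I.OrdConnected → (0 : ℝ) ∈ I →
      -- homogeneous estimates
      (∀ u₀ : ℤ → ℂ, DiscreteNLS.seqNorm 2 0 u₀ < ∞ →
        max (DiscreteNLS.stzNorm I (fun t => DiscreteNLS.evolve t u₀))
            (DiscreteNLS.mixedNorm I 2 2 (-1) (fun t => DiscreteNLS.evolve t u₀))
          ≤ C * DiscreteNLS.seqNorm 2 0 u₀) ∧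
      -- inhomogeneous Strichartz estimates
      (∀ f : ℝ → ℤ → ℂ,
        DiscreteNLS.sumNorm I (DiscreteNLS.stzDualNorm I)
            (DiscreteNLS.mixedNorm I 2 2 1) f < ∞ →
        (∀ t ∈ I, IntervalIntegrable
          (fun s => DiscreteNLS.evolve (t - s) (f s)) volume 0 t) ∧
        DiscreteNLS.stzNorm I (fun t => DiscreteNLS.duhamel f t)
          ≤ C * DiscreteNLS.sumNorm I (DiscreteNLS.stzDualNorm I)
              (DiscreteNLS.mixedNorm I 2 2 1) f) ∧
      -- inhomogeneous Kato smoothing estimate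
      (∀ f : ℝ → ℤ → ℂ, DiscreteNLS.mixedNorm I 2 2 1 f < ∞ →
        (∀ t ∈ I, IntervalIntegrable
          (fun s => DiscreteNLS.evolve (t - s) (f s)) volume 0 t) ∧
        DiscreteNLS.mixedNorm I 2 2 (-1) (fun t => DiscreteNLS.duhamel f t)
          ≤ C * DiscreteNLS.mixedNorm I 2 2 1 f) := by
  set κ : ℝ≥0 := DiscreteNLS.katoConst ^ (1 / 2 : ℝ) with hκ
  have hκe : (DiscreteNLS.katoConst : ℝ≥0∞) ^ (1 / 2 : ℝ) = κ :=
    (ENNReal.coe_rpow_of_nonneg _ (by norm_num)).symm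
  set C₂ : ℝ≥0 := 340 + 190 * (κ + 1) with hC₂
  have hC₂e : (C₂ : ℝ≥0∞) = 340 + 190 * ((DiscreteNLS.katoConst : ℝ≥0∞) ^ (1 / 2 : ℝ) + 1) := by
    rw [hκe, hC₂]
    push_cast
    rfl
  have hC₂0 : (C₂ : ℝ≥0∞) ≠ 0 := by
    rw [hC₂e]
    simp
  refine ⟨(19 + κ) + C₂ + DiscreteNLS.katoConst, fun I hI h0 => ⟨fun u₀ hu₀ => ?_,
    fun f hf => ⟨?_, ?_⟩, fun f hf => ?_⟩⟩
  · refine (DiscreteNLS.homogeneous_estimate hI.measurableSet hu₀).trans (mul_le_mul' ?_ le_rfl)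
    rw [hκe]
    push_cast
    rw [add_assoc]
    exact le_self_add
  · obtain ⟨g, h, hgh, hlt⟩ := DiscreteNLS.exists_of_sumNorm_lt hf
    obtain ⟨hg, hh⟩ := ENNReal.add_lt_top.1 hlt
    obtain ⟨g₁, g₂, hg12, hlt'⟩ := DiscreteNLS.exists_of_sumNorm_lt hg
    obtain ⟨hg₁, hg₂⟩ := ENNReal.add_lt_top.1 hlt'
    refine (DiscreteNLS.strichartz_of_decomposition hI h0 ?_ hg₁.ne hg₂.ne hh.ne).1
    filter_upwards [hgh, hg12] with t e1 e2
    rw [e1, e2]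
  -- The constant is moved to the left so that the bound can be checked decomposition by
  -- decomposition before the infimum is taken.
  · have key : DiscreteNLS.stzNorm I (fun t => DiscreteNLS.duhamel f t) / C₂
        ≤ DiscreteNLS.sumNorm I (DiscreteNLS.stzDualNorm I) (DiscreteNLS.mixedNorm I 2 2 1) f := by
      refine DiscreteNLS.le_mul_sumNorm fun g h hgh => ?_
      -- Subtracting the norm of `h` leaves the inner sum norm alone on the right, so its infimum
      -- can be unfolded in the same way.
      rw [← tsub_le_iff_right]
      refine DiscreteNLS.le_mul_sumNorm fun g₁ g₂ hg12 => ?_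
      rw [tsub_le_iff_right]
      by_cases hfin : DiscreteNLS.mixedNorm I 1 2 0 g₁ + DiscreteNLS.mixedNorm I (6 / 5) 1 0 g₂
          + DiscreteNLS.mixedNorm I 2 2 1 h = ∞
      · rw [hfin]
        exact le_top
      rw [ENNReal.add_eq_top, ENNReal.add_eq_top] at hfin
      push Not at hfin
      rw [ENNReal.div_le_iff hC₂0 ENNReal.coe_ne_top, mul_comm _ (C₂ : ℝ≥0∞), hC₂e]
      refine (DiscreteNLS.strichartz_of_decomposition hI h0 ?_ hfin.1.1 hfin.1.2 hfin.2).2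
      filter_upwards [hgh, hg12] with t e1 e2
      rw [e1, e2]
    rw [ENNReal.div_le_iff hC₂0 ENNReal.coe_ne_top, mul_comm] at key
    refine key.trans (mul_le_mul' ?_ le_rfl)
    push_cast
    exact le_add_self.trans le_self_add
  · obtain ⟨h1, h2⟩ := DiscreteNLS.inhomogeneous_kato hI h0 hf.ne
    refine ⟨h1, h2.trans (mul_le_mul' ?_ le_rfl)⟩
    push_cast
    exact le_add_self
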